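/- All graphs are finite, simple and undirected. A graph is $H$-minor-free ($H$-subgraph-free) if it does not contain $H$ as a minor (as a not necessarily induced subgraph), and $\mathcal F$-minor-free ($\mathcal F$-subgraph-free) if this holds for every $H\in\mathcal F$. Write $\mathrm{tw}(G)$ for the treewidth of $G$ and $\min\mathrm{tw}(\mathcal F)=\min_{H\in\mathcal F}\mathrm{tw}(H)$. A leaf-block of $G$ is a maximal biconnected subgraph of $G$ that contains at most one cut vertex of $G$ (biconnected: connected without a cut vertex); $\mathrm{slb}(G)$ is the number of vertices of a smallest leaf-block of $G$. A graph $G$ is $\alpha$-robust if $|V(G)|\ge\alpha$ and for no vertex $v$ does $G-v$ have a connected component with fewer than $\alpha-1$ vertices; $\alpha\text{-prune}(G)$ is the unique maximal $\alpha$-robust subgraph of $G$ (empty if there is none). Write $H\precsim G$ if every connected component of $H$ is a minor of $G$. Below, "polynomial time" means time polynomial in the length of the formula plus its number $k$ of variables. (a) For every connected graph $H$ with at least three vertices there is a polynomial-time algorithm that, given a CNF formula $\Phi$ on $k$ variables, outputs a graph $G$ and an integer $\ell\ge 0$ such that: 1. there is a set $S\subseteq V(G)$ with $|S|\le 2k$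 and $\mathrm{tw}(G-S)\le\mathrm{tw}(H)$; 2. $G$ contains $\ell$ pairwise vertex-disjoint subgraphs isomorphic to $H$; 3. if $\Phi$ is not satisfiable, there is no $X\subseteq V(G)$ with $|X|\le\ell$ such that $G-X$ is $H$-subgraph-free; 4. if $\Phi$ is satisfiable, there is $X\subseteq V(G)$ with $|X|\le\ell$ such that $G-X$ is $H$-minor-free, $\mathrm{slb}(H)\text{-prune}(G-X)\precsim H$, and $\mathrm{tw}(G-X)\le\mathrm{tw}(H)$. (b) Let $\mathcal F$ be a nonempty family of graphs, each of which has a connected component with at least three vertices. There are a polynomial $q$ and a polynomial-time algorithm (both depending only on $\mathcal F$) that, given a CNF formula $\Phi$ on $k$ variables, outputs a graph $G$ and an integer $\ell\ge 0$ such that: 1. there is a set $S\subseteq V(G)$ with $|S|\le q(k)$ and $\mathrm{tw}(G-S)\le\min\mathrm{tw}(\mathcal F)$; 2. if $\Phi$ is not satisfiable, there is no $X\subseteq V(G)$ with $|X|\le\ell$ such that $G-X$ is $\mathcal F$-subgraph-free; 3. if $\Phi$ is satisfiable, there is $X\subseteq V(G)$ with $|X|\le\ell$ such that $G-X$ is $\mathcal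 F$-minor-free. -/

import Mathlib

namespace MinorDeletion

open Std.Sat (CNF)

/-! ### Minors, treewidth, packings -/

section Graphs

variable {V : Type*} {W : Type*}

/-- `H` is a minor of `G`: there is an `H`-model in `G`, i.e. a choice of pairwise disjoint
connected (in particular nonempty) branch sets `φ v ⊆ V(G)`, one for each vertex `v` of `H`, such
that adjacent vertices of `H` have branch sets joined by an edge of `G`. -/
def IsMinor (H : SimpleGraph V) (G : SimpleGraph W) : Prop :=
  ∃ φ : V → Set W,
    (∀ v, (G.induce (φ v)).Connected) ∧
    (∀ u v, H.Adj u v → ∃ u' ∈ φ u, ∃ v' ∈ φ v, G.Adj u' v') ∧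
    (∀ u v, u ≠ v → Disjoint (φ u) (φ v))

/-- `H` is a component-wise minor of `G`: every connected component of `H` is a minor of `G`. -/
def IsComponentwiseMinor (H : SimpleGraph V) (G : SimpleGraph W) : Prop :=
  ∀ C : H.ConnectedComponent, IsMinor C.toSimpleGraph G

/-- `G - X`, the graph obtained from `G` by deleting the vertices in `X`. -/
abbrev deleteVerts (G : SimpleGraph V) (X : Set V) : SimpleGraph (Xᶜ : Set V) :=
  G.induce Xᶜ

/-- `G` contains `ℓ` pairwise vertex-disjoint subgraphs isomorphic to `H`. -/
def HasPacking (H : SimpleGraph V) (G : SimpleGraph W) (ℓ : ℕ) : Prop :=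
  ∃ f : Fin ℓ → SimpleGraph.Copy H G,
    ∀ i j, i ≠ j → Disjoint (Set.range (f i)) (Set.range (f j))

/-- A tree decomposition of `G` whose tree has the node set `ι`. -/
structure TreeDecomposition (G : SimpleGraph V) (ι : Type) where
  /-- the decomposition tree -/
  tree : SimpleGraph ι
  isTree : tree.IsTree
  /-- the bags -/
  bag : ι → Set V
  exists_mem_bag : ∀ v, ∃ t, v ∈ bag t
  exists_edge_bag : ∀ u v, G.Adj u v → ∃ t, u ∈ bag t ∧ v ∈ bag t
  preconnected : ∀ v, (tree.induce {t | v ∈ bag t}).Preconnected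

/-- The treewidth of a finite graph: the least `w` such that there is a tree decomposition over a
finite tree all of whose bags have at most `w + 1` vertices. -/
noncomputable def treewidth (G : SimpleGraph V) : ℕ :=
  sInf {w | ∃ (ι : Type) (_ : Finite ι) (D : TreeDecomposition G ι),
    ∀ t, (D.bag t).encard ≤ (w + 1 : ℕ)}

/-- The minimum treewidth of the graphs in a (nonempty) family. -/
noncomputable def minTreewidth {ι : Type*} {U : ι → Type*} (F : ∀ i, SimpleGraph (U i)) : ℕ :=
  ⨅ i, treewidth (F i)

/-! ### Leaf-blocks and pruning -/

/-- `v` is a cut vertex of `G`: deleting `v` increases the number of connected components, i.e.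
it separates two other vertices that lie in the same connected component of `G`. -/
def IsCutVertex (G : SimpleGraph V) (v : V) : Prop :=
  ∃ (a b : V) (ha : a ∈ ({v}ᶜ : Set V)) (hb : b ∈ ({v}ᶜ : Set V)),
    G.Reachable a b ∧ ¬ (deleteVerts G {v}).Reachable ⟨a, ha⟩ ⟨b, hb⟩

/-- A graph is biconnected if it is connected and has no cut vertex. -/
def IsBiconnected (G : SimpleGraph V) : Prop :=
  G.Connected ∧ ∀ v, ¬ IsCutVertex G v

/-- `B` is a leaf-block of `G`: a biconnected component (a maximal biconnected subgraph) of `G`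
that contains at most one cut vertex of `G`. -/
def IsLeafBlock (G : SimpleGraph V) (B : G.Subgraph) : Prop :=
  Maximal (fun B' : G.Subgraph => IsBiconnected B'.coe) B ∧
    {v | v ∈ B.verts ∧ IsCutVertex G v}.Subsingleton

/-- The number of vertices of a smallest leaf-block of a finite nonempty graph. -/
noncomputable def slb (G : SimpleGraph V) : ℕ :=
  sInf {s | ∃ B : G.Subgraph, IsLeafBlock G B ∧ s = B.verts.ncard}

/-- A finite graph `G` is `α`-robust if it has at least `α` vertices and there is no vertex `v`
for which `G - v` has a connected component with fewer than `α - 1` vertices. -/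
def IsRobust (α : ℕ) (G : SimpleGraph V) : Prop :=
  α ≤ Nat.card V ∧
    ∀ (v : V) (C : (deleteVerts G {v}).ConnectedComponent), α ≤ C.supp.ncard + 1

/-- The unique maximal `α`-robust subgraph of a finite graph `G`, as the supremum of all
`α`-robust subgraphs; it is the empty subgraph if there are none. -/
def prune (α : ℕ) (G : SimpleGraph V) : G.Subgraph :=
  sSup {P | IsRobust α P.coe}

end Graphs

/-! ### The machine model

Algorithms are programs for a random access machine with registers `R₀, R₁, R₂, …` holding natural
numbers, a read-only input stream and a write-only output stream. The elementary instructions are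
assignment of constants, addition, (truncated) subtraction, indirect loads and stores, reading and
printing. There is no multiplication, so `t` steps lengthen the numbers involved by at most `O(t)`
bits, and polynomial time in this unit-cost model is polynomial time on Turing machines. -/

/-- Elementary instructions. -/
inductive Instr where
  /-- `R i := c` -/
  | const (i c : ℕ)
  /-- `R i := R j + R k` -/
  | add (i j k : ℕ)
  /-- `R i := R j - R k` (or `0` if this is negative) -/
  | sub (i j k : ℕ)
  /-- `R i := R (R j)` -/
  | load (i j : ℕ)
  /-- `R (R i) := R j` -/
  | store (i j : ℕ)
  /-- read the next number of the input into `R i` (`0` if the input is exhausted) -/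
  | read (i : ℕ)
  /-- append `R i` to the output -/
  | print (i : ℕ)

/-- Programs. -/
inductive Prog where
  | skip
  | instr (c : Instr)
  | seq (p q : Prog)
  /-- if `R i > 0` then `p` else `q` -/
  | ifPos (i : ℕ) (p q : Prog)
  /-- while `R i > 0` do `p` -/
  | whilePos (i : ℕ) (p : Prog)

/-- States of the machine: the registers, the unread input, the output printed so far. -/
structure State where
  reg : ℕ → ℕ
  input : List ℕ
  output : List ℕ

/-- The initial state on input `w`. -/
def State.init (w : List ℕ) : State where
  reg := fun _ => 0
  input := w
  output := []

/-- Assign the value `a` to the register `i`. -/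
def State.set (s : State) (i a : ℕ) : State :=
  { s with reg := Function.update s.reg i a }

/-- The effect of an elementary instruction. -/
def Instr.run : Instr → State → State
  | .const i c, s => s.set i c
  | .add i j k, s => s.set i (s.reg j + s.reg k)
  | .sub i j k, s => s.set i (s.reg j - s.reg k)
  | .load i j, s => s.set i (s.reg (s.reg j))
  | .store i j, s => s.set (s.reg i) (s.reg j)
  | .read i, s => { s.set i (s.input.headD 0) with input := s.input.tail }
  | .print i, s => { s with output := s.output ++ [s.reg i] }

/-- `Exec p s t s'`: started in the state `s`, the program `p` halts in the state `s'` after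
exactly `t` steps, where each elementary instruction and each test counts as one step. -/
inductive Exec : Prog → State → ℕ → State → Prop where
  | skip (s : State) : Exec .skip s 1 s
  | instr (c : Instr) (s : State) : Exec (.instr c) s 1 (c.run s)
  | seq {p q : Prog} {s s₁ s₂ : State} {t₁ t₂ : ℕ} :
      Exec p s t₁ s₁ → Exec q s₁ t₂ s₂ → Exec (.seq p q) s (t₁ + t₂) s₂
  | ifPos_pos {i : ℕ} {p q : Prog} {s s' : State} {t : ℕ} :
      0 < s.reg i → Exec p s t s' → Exec (.ifPos i p q) s (t + 1) s'
  | ifPos_zero {i : ℕ} {p q : Prog} {s s' : State} {t : ℕ} :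
      s.reg i = 0 → Exec q s t s' → Exec (.ifPos i p q) s (t + 1) s'
  | while_pos {i : ℕ} {p : Prog} {s s₁ s₂ : State} {t₁ t₂ : ℕ} :
      0 < s.reg i → Exec p s t₁ s₁ → Exec (.whilePos i p) s₁ t₂ s₂ →
        Exec (.whilePos i p) s (t₁ + t₂ + 1) s₂
  | while_zero {i : ℕ} {p : Prog} {s : State} :
      s.reg i = 0 → Exec (.whilePos i p) s 1 s

/-! ### Inputs and outputs -/

/-- A clause is written as its number of literals followed by the literals; the literal `xᵢ` is
written `i, 1` and the literal `¬ xᵢ` is written `i, 0`. -/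
def encodeClause {k : ℕ} (C : CNF.Clause (Fin k)) : List ℕ :=
  C.length :: C.flatMap fun l => [(l.1 : ℕ), if l.2 then 1 else 0]

/-- A formula is written as its number of variables, followed by its number of clauses, followed
by the clauses. -/
def encodeCNF {k : ℕ} (Φ : CNF (Fin k)) : List ℕ :=
  k :: Φ.clauses.size :: Φ.clauses.toList.flatMap encodeClause

/-- The size of an instance of CNF-SAT parameterized by the number `k` of variables: the length of
the encoding plus `k`. (Every number in the encoding is at most this size.) -/
def inputSize {k : ℕ} (Φ : CNF (Fin k)) : ℕ :=
  (encodeCNF Φ).length + k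

/-- The formula has a satisfying truth assignment. -/
def Satisfiable {k : ℕ} (Φ : CNF (Fin k)) : Prop :=
  ∃ a : Fin k → Bool, CNF.Sat a Φ

/-- `w` describes the pair `(G, ℓ)`: it is a list of the edges of `G`, each written as its two
endpoints, followed by the number `n` of vertices of `G` and by `ℓ`. -/
def Describes {n : ℕ} (w : List ℕ) (G : SimpleGraph (Fin n)) (ℓ : ℕ) : Prop :=
  ∃ E : List (Fin n × Fin n),
    (∀ u v, G.Adj u v ↔ (u, v) ∈ E ∨ (v, u) ∈ E) ∧
    w = (E.flatMap fun e => [(e.1 : ℕ), (e.2 : ℕ)]) ++ [n, ℓ]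

/-- On input `Φ`, the program `p` halts after at most `T` steps and outputs `(G, ℓ)`. -/
def Outputs {k n : ℕ} (p : Prog) (Φ : CNF (Fin k)) (T : ℕ) (G : SimpleGraph (Fin n)) (ℓ : ℕ) :
    Prop :=
  ∃ t ≤ T, ∃ s : State, Exec p (State.init (encodeCNF Φ)) t s ∧ Describes s.output G ℓ

end MinorDeletion

open MinorDeletion

/-!
The reduction replaces each symbol of the formula by gadgets glued from copies of a connected
graph `H`. Let `L` be a smallest leaf-block of `H`, attached at `c`, and let `x ∈ L - c`. A *fork*
is a copy of `H`; a *wire* is a copy of `H` in which `L - c` leads from a *hub*, the copy of the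
rest of `H`, to a target vertex that plays the role of `x` and lies in another part of the gadget.
Every copy of `H` has to be hit by the deleted set `X`. Some of the copies are pairwise disjoint
and form a packing, and `ℓ` is its size, so `|X| ≤ ℓ` forces `X` to hit each of them exactly once
and to contain nothing else. For a variable, the fork is in the packing; its vertices `y₀` and `y₁`
are the two literals. A clause is a chain of forks, one for its beginning and one for each literal.
The fork of a literal is hit at `y₂` if a true literal occurs earlier, at `y₁` if its own literal is
the first true one, and at `y₀` otherwise; hitting it at `y₀` is possible only if a further literal
follows. Wires enforce these conditions, so that a small hitting set makes a true literal occur in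
each clause (`Template.wordSat_of_hitting`), and conversely an assignment describes a set which
hits all forks and wires (`Template.hits_deletion`).

After such a deletion every wire has lost its hub centre `c` or its target, so what remains is a
disjoint union of proper subgraphs of `H`, to which parts of `L - c` are attached, each at a single
vertex and with at most `|L| - 2` vertices. Such pendant pieces are irrelevant for graphs
that are robust for `|L|` (`IsPendantLabelling.isMinor_core`, `IsPendantLabelling.prune_verts`), and
`H` is robust for `|L|`, because `|L| - 1` is the smallest size of a component of any `H - v`
(`exists_smallest_leafBlock`). Hence `H` is not a minor, and pruning leaves minors of `H`. The
treewidth is at most that of `H` since the graph is glued from subgraphs of `H` along single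
vertices (`partialTreeDecomposition_of_pieces`); the same holds for the whole graph without the
vertices that represent the literals (`Template.treewidth_le_of_modulator`).

For a family, let `M` be one of its graphs of minimum treewidth that is minimal for the
component-wise minor order, and `H` a maximal component of `M`, chosen such that the smallest
leaf-block of `H` is as small as possible. If `m` components of `M` have `H` as a minor, they are
all isomorphic to `H`, and there are `2 m - 1` copies of each gadget, so that a small set of
vertices misses `m` disjoint copies of `H` unless the formula is satisfiable
(`Template.exists_disjoint_copies`); the remaining components of `M` are added in so many copies
that one of them survives every small deletion. If the formula is satisfiable and some member of
the family were a minor after the deletion, it would have minimum treewidth, and a minimal member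
below it would have robust maximal components by the choice of `H`. These would be minors of `M`,
so by minimality of `M` the graph `H` would be a minor of one of them, and hence of a proper
subgraph of itself or of the components of `M` of which it is not a minor.

The graph is printed block by block by a program with nested counting loops
(`Template.outputs_program`). In the blocks, the vertices are numbered such that the number of a
vertex is the number of the first vertex of a block plus a constant offset, so that every edge is
printed by finitely many additions.
-/

namespace MinorDeletion

open Std.Sat (CNF)

/-! ### Connected vertex sets -/

section Connectivity

variable {V W U : Type*}

/-- `v` can be reached from `u` in `G` by a walk inside `A` (the trivial walk is always allowed). -/
def SetReach (G : SimpleGraph V) (A : Set V) : V → V → Prop :=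
  Relation.ReflTransGen fun x y => G.Adj x y ∧ x ∈ A ∧ y ∈ A

/-- The vertex set `A` induces a preconnected subgraph of `G`. -/
def SetPreconn (G : SimpleGraph V) (A : Set V) : Prop :=
  ∀ u ∈ A, ∀ v ∈ A, SetReach G A u v

variable {G : SimpleGraph V} {A B : Set V}

theorem SetReach.symm {u v : V} (h : SetReach G A u v) : SetReach G A v u := by
  induction h with
  | refl => exact Relation.ReflTransGen.refl
  | tail _ h ih => exact (Relation.ReflTransGen.single ⟨h.1.symm, h.2.2, h.2.1⟩).trans ih

theorem SetReach.mono {u v : V} (hAB : A ⊆ B) (h : SetReach G A u v) : SetReach G B u v :=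
  Relation.ReflTransGen.mono (fun _ _ h => ⟨h.1, hAB h.2.1, hAB h.2.2⟩) _ _ h

theorem SetReach.trans {u v w : V} (h : SetReach G A u v) (h' : SetReach G A v w) :
    SetReach G A u w :=
  Relation.ReflTransGen.trans h h'

theorem SetReach.of_adj {u v : V} (h : G.Adj u v) (hu : u ∈ A) (hv : v ∈ A) :
    SetReach G A u v :=
  Relation.ReflTransGen.single ⟨h, hu, hv⟩

theorem SetReach.refl (u : V) : SetReach G A u u := Relation.ReflTransGen.refl

theorem SetReach.mem_of_mem {u v : V} (h : SetReach G A u v) (hu : u ∈ A) : v ∈ A := by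
  induction h with
  | refl => exact hu
  | tail _ h _ => exact h.2.2

theorem SetReach.induct {u v : V} (h : SetReach G A u v) {P : V → Prop} (hu : P u)
    (step : ∀ x ∈ A, ∀ y ∈ A, G.Adj x y → P x → P y) : P v := by
  induction h with
  | refl => exact hu
  | tail _ h ih => exact step _ h.2.1 _ h.2.2 h.1 ih

theorem SetPreconn.induct (h : SetPreconn G A) {u v : V} (hu : u ∈ A) (hv : v ∈ A)
    {P : V → Prop} (hP : P u) (step : ∀ x ∈ A, ∀ y ∈ A, G.Adj x y → P x → P y) : P v :=
  (h u hu v hv).induct hP step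

theorem reachable_induce_iff {u v : V} (hu : u ∈ A) (hv : v ∈ A) :
    (G.induce A).Reachable ⟨u, hu⟩ ⟨v, hv⟩ ↔ SetReach G A u v := by
  constructor
  · intro h
    rw [SimpleGraph.reachable_iff_reflTransGen] at h
    have := Relation.ReflTransGen.lift (p := fun x y => G.Adj x y ∧ x ∈ A ∧ y ∈ A)
      (Subtype.val) (fun a b hab => ⟨hab, a.2, b.2⟩) _ _ h
    exact this
  · intro h
    suffices ∀ w, SetReach G A u w → ∀ hw : w ∈ A, (G.induce A).Reachable ⟨u, hu⟩ ⟨w, hw⟩ from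
      this v h hv
    intro w hw
    induction hw with
    | refl => intro _; exact SimpleGraph.Reachable.refl _
    | tail _ hab ih =>
      intro hw
      refine (ih hab.2.1).trans (SimpleGraph.Adj.reachable ?_)
      exact hab.1

theorem preconnected_induce_iff : (G.induce A).Preconnected ↔ SetPreconn G A := by
  constructor
  · intro h u hu v hv
    exact (reachable_induce_iff hu hv).1 (h ⟨u, hu⟩ ⟨v, hv⟩)
  · rintro h ⟨u, hu⟩ ⟨v, hv⟩
    exact (reachable_induce_iff hu hv).2 (h u hu v hv)

theorem connected_induce_iff : (G.induce A).Connected ↔ A.Nonempty ∧ SetPreconn G A := by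
  rw [SimpleGraph.connected_iff, preconnected_induce_iff, Set.nonempty_coe_sort, and_comm]

theorem setPreconn_univ_iff : SetPreconn G Set.univ ↔ G.Preconnected := by
  refine ⟨fun h u v => ?_, fun h u _ v _ => ?_⟩
  · rw [SimpleGraph.reachable_iff_reflTransGen]
    exact Relation.ReflTransGen.mono (fun _ _ h => h.1) _ _ (h u trivial v trivial)
  · have := (SimpleGraph.reachable_iff_reflTransGen u v).1 (h u v)
    exact Relation.ReflTransGen.mono (fun _ _ h => ⟨h, trivial, trivial⟩) _ _ this

theorem SetPreconn.union_of_mem (hA : SetPreconn G A) (hB : SetPreconn G B) {w : V}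
    (hwA : w ∈ A) (hwB : w ∈ B) : SetPreconn G (A ∪ B) := by
  have key : ∀ u ∈ A ∪ B, SetReach G (A ∪ B) u w := by
    rintro u (hu | hu)
    · exact (hA u hu w hwA).mono Set.subset_union_left
    · exact (hB u hu w hwB).mono Set.subset_union_right
  exact fun u hu v hv => (key u hu).trans (key v hv).symm

theorem setPreconn_singleton (v : V) : SetPreconn G {v} := by
  rintro u rfl w rfl
  exact SetReach.refl _

theorem SetPreconn.union_of_adj (hA : SetPreconn G A) (hB : SetPreconn G B) {a b : V}
    (ha : a ∈ A) (hb : b ∈ B) (hab : G.Adj a b) : SetPreconn G (A ∪ B) := by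
  have h2 : SetPreconn G {a, b} := by
    rintro u (rfl | rfl) v (rfl | rfl)
    · exact SetReach.refl _
    · exact SetReach.of_adj hab (by simp) (by simp)
    · exact SetReach.of_adj hab.symm (by simp) (by simp)
    · exact SetReach.refl _
  have := (hA.union_of_mem h2 ha (by simp)).union_of_mem hB (Or.inr (by simp : b ∈ _)) hb
  convert! this using 1
  ext v
  simp only [Set.mem_union, Set.mem_insert_iff, Set.mem_singleton_iff]
  constructor
  · tauto
  · rintro ((h | rfl | rfl) | h) <;> tauto

/-- Replacing each vertex of a connected set by a connected set so that neighbours get sets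
which touch results in a connected set. -/
theorem SetPreconn.biUnion {K : SimpleGraph U} (hA : SetPreconn G A) {ψ : V → Set U}
    (hψ : ∀ w ∈ A, SetPreconn K (ψ w))
    (hadj : ∀ w ∈ A, ∀ w' ∈ A, G.Adj w w' → ∃ x ∈ ψ w, ∃ y ∈ ψ w', x = y ∨ K.Adj x y) :
    SetPreconn K (⋃ w ∈ A, ψ w) := by
  intro x hx y hy
  simp only [Set.mem_iUnion] at hx hy
  obtain ⟨w, hw, hx⟩ := hx
  obtain ⟨w', hw', hy⟩ := hy
  have sub : ∀ v ∈ A, ψ v ⊆ ⋃ w ∈ A, ψ w := fun v hv => Set.subset_biUnion_of_mem (u := ψ) hv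
  have : ∀ z ∈ ψ w', SetReach K (⋃ w ∈ A, ψ w) x z := by
    refine hA.induct (P := fun v => ∀ z ∈ ψ v, SetReach K (⋃ w ∈ A, ψ w) x z) hw hw'
      (fun z hz => (hψ w hw x hx z hz).mono (sub w hw)) ?_
    intro v hv v' hv' hvv' ih z hz
    obtain ⟨p, hp, q, hq, hpq⟩ := hadj v hv v' hv' hvv'
    have h1 := ih p hp
    have h2 : SetReach K (⋃ w ∈ A, ψ w) p q := by
      rcases hpq with rfl | h
      · exact SetReach.refl _
      · exact SetReach.of_adj h (sub v hv hp) (sub v' hv' hq)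
    exact (h1.trans h2).trans ((hψ v' hv' q hq z hz).mono (sub v' hv'))
  exact this y hy

/-- The image of a connected set under a map sending adjacent vertices to adjacent or equal
ones. -/
theorem SetPreconn.image {K : SimpleGraph U} (hA : SetPreconn G A) {r : V → U}
    (hr : ∀ w ∈ A, ∀ w' ∈ A, G.Adj w w' → r w = r w' ∨ K.Adj (r w) (r w')) :
    SetPreconn K (r '' A) := by
  have := hA.biUnion (K := K) (ψ := fun v => {r v}) (fun w _ => setPreconn_singleton _) (by
      intro w hw w' hw' h
      exact ⟨_, rfl, _, rfl, hr w hw w' hw' h⟩)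
  convert this using 1
  ext; simp [eq_comm]

/-- A subset closed under adjacency contains every connected set it meets. -/
theorem SetPreconn.subset_of_closed (hA : SetPreconn G A) {D : Set V} {u : V} (hu : u ∈ A)
    (huD : u ∈ D) (h : ∀ x ∈ A, ∀ y ∈ A, G.Adj x y → x ∈ D → y ∈ D) : A ⊆ D :=
  fun _ hv => hA.induct (P := (· ∈ D)) hu hv huD h

end Connectivity

/-! ### Minors -/

section Minors

variable {V W U : Type*} {H : SimpleGraph V} {G : SimpleGraph W} {K : SimpleGraph U}

theorem isMinor_iff : IsMinor H G ↔ ∃ φ : V → Set W,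
    (∀ v, (φ v).Nonempty) ∧ (∀ v, SetPreconn G (φ v)) ∧
    (∀ u v, H.Adj u v → ∃ u' ∈ φ u, ∃ v' ∈ φ v, G.Adj u' v') ∧
    (∀ u v, u ≠ v → Disjoint (φ u) (φ v)) := by
  simp only [IsMinor, connected_induce_iff, forall_and, and_assoc]

theorem isMinor_of_injective_hom (f : V → W) (hf : Function.Injective f)
    (hadj : ∀ u v, H.Adj u v → G.Adj (f u) (f v)) : IsMinor H G := by
  refine isMinor_iff.2 ⟨fun v => {f v}, fun v => Set.singleton_nonempty _,
    fun v => setPreconn_singleton _, fun u v h => ⟨_, rfl, _, rfl, hadj u v h⟩, ?_⟩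
  intro u v huv
  simpa using fun h => huv (hf h)

theorem IsMinor.refl (H : SimpleGraph V) : IsMinor H H :=
  isMinor_of_injective_hom id Function.injective_id fun _ _ h => h

theorem IsMinor.trans (h₁ : IsMinor H G) (h₂ : IsMinor G K) : IsMinor H K := by
  obtain ⟨φ, hne, hconn, hadj, hdisj⟩ := isMinor_iff.1 h₁
  obtain ⟨ψ, hne', hconn', hadj', hdisj'⟩ := isMinor_iff.1 h₂
  refine isMinor_iff.2 ⟨fun v => ⋃ w ∈ φ v, ψ w, fun v => ?_, fun v => ?_, ?_, ?_⟩
  · obtain ⟨w, hw⟩ := hne v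
    obtain ⟨x, hx⟩ := hne' w
    exact ⟨x, Set.mem_biUnion hw hx⟩
  · refine (hconn v).biUnion (fun w _ => hconn' w) fun w _ w' _ h => ?_
    obtain ⟨x, hx, y, hy, hxy⟩ := hadj' w w' h
    exact ⟨x, hx, y, hy, Or.inr hxy⟩
  · intro u v huv
    obtain ⟨a, ha, b, hb, hab⟩ := hadj u v huv
    obtain ⟨x, hx, y, hy, hxy⟩ := hadj' a b hab
    exact ⟨x, Set.mem_biUnion ha hx, y, Set.mem_biUnion hb hy, hxy⟩
  · intro u v huv
    rw [Set.disjoint_left]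
    intro x hx hy
    simp only [Set.mem_iUnion] at hx hy
    obtain ⟨a, ha, hx⟩ := hx
    obtain ⟨b, hb, hy⟩ := hy
    have hab : a ≠ b := by
      rintro rfl
      exact Set.disjoint_left.1 (hdisj u v huv) ha hb
    exact Set.disjoint_left.1 (hdisj' a b hab) hx hy

theorem IsMinor.card_le [Finite W] (h : IsMinor H G) : Nat.card V ≤ Nat.card W := by
  obtain ⟨φ, hne, -, -, hdisj⟩ := isMinor_iff.1 h
  choose f hf using hne
  refine Nat.card_le_card_of_injective f fun u v huv => ?_
  by_contra hne
  exact Set.disjoint_left.1 (hdisj u v hne) (hf u) (huv ▸ hf v)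

/-- If the branch sets of a minor model fill a vertex set of the same size, they are singletons,
so that the model is a copy. -/
theorem IsMinor.exists_copy_of_card_le [Finite W] (h : IsMinor H G)
    (hcard : Nat.card W ≤ Nat.card V) :
    ∃ f : V → W, Function.Injective f ∧ ∀ u v, H.Adj u v → G.Adj (f u) (f v) := by
  obtain ⟨φ, hne, -, hadj, hdisj⟩ := isMinor_iff.1 h
  choose f hf using hne
  have hinj : Function.Injective f := fun u v huv => by
    by_contra hne
    exact Set.disjoint_left.1 (hdisj u v hne) (hf u) (huv ▸ hf v)
  have : Finite V := Finite.of_injective f hinj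
  have hbij : Function.Bijective f :=
    (Nat.bijective_iff_injective_and_card f).2
      ⟨hinj, le_antisymm (Nat.card_le_card_of_injective f hinj) hcard⟩
  have hsing : ∀ v, ∀ w ∈ φ v, w = f v := by
    intro v w hw
    obtain ⟨u, rfl⟩ := hbij.2 w
    by_contra hne
    exact Set.disjoint_left.1 (hdisj u v fun h => hne (h ▸ rfl : f u = f v)) (hf u) hw
  refine ⟨f, hinj, fun u v huv => ?_⟩
  obtain ⟨a, ha, b, hb, hab⟩ := hadj u v huv
  rwa [hsing u a ha, hsing v b hb] at hab

/-- The union of the branch sets of a model of a connected graph is connected. -/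
theorem setPreconn_iUnion_model (hH : H.Preconnected) {φ : V → Set W}
    (hconn : ∀ v, SetPreconn G (φ v))
    (hadj : ∀ u v, H.Adj u v → ∃ u' ∈ φ u, ∃ v' ∈ φ v, G.Adj u' v') :
    SetPreconn G (⋃ v, φ v) := by
  have := (setPreconn_univ_iff.2 hH).biUnion (K := G) (ψ := φ) (fun w _ => hconn w)
    fun w _ w' _ h => by
      obtain ⟨x, hx, y, hy, hxy⟩ := hadj w w' h
      exact ⟨x, hx, y, hy, Or.inr hxy⟩
  simpa using this

/-- A model living on a set of vertices that `π` maps injectively and homomorphically. -/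
theorem isMinor_of_model_injOn {φ : V → Set W} (hne : ∀ v, (φ v).Nonempty)
    (hconn : ∀ v, SetPreconn G (φ v))
    (hadj : ∀ u v, H.Adj u v → ∃ u' ∈ φ u, ∃ v' ∈ φ v, G.Adj u' v')
    (hdisj : ∀ u v, u ≠ v → Disjoint (φ u) (φ v))
    (π : W → U) (hπ : Set.InjOn π (⋃ v, φ v))
    (hhom : ∀ x ∈ ⋃ v, φ v, ∀ y ∈ ⋃ v, φ v, G.Adj x y → K.Adj (π x) (π y))
    {Z : Set U} (hZ : ∀ x ∈ ⋃ v, φ v, π x ∈ Z) :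
    IsMinor H (K.induce Z) := by
  have sub : ∀ v, φ v ⊆ ⋃ v, φ v := fun v => Set.subset_iUnion φ v
  have hconn' : ∀ v, SetPreconn K (π '' φ v) := fun v =>
    (hconn v).image fun w hw w' hw' h => Or.inr (hhom w (sub v hw) w' (sub v hw') h)
  refine isMinor_iff.2 ⟨fun v => {z | (z : U) ∈ π '' φ v}, fun v => ?_, fun v => ?_, ?_, ?_⟩
  · obtain ⟨w, hw⟩ := hne v
    exact ⟨⟨π w, hZ w (sub v hw)⟩, w, hw, rfl⟩
  · rintro ⟨a, ha⟩ hav ⟨b, hb⟩ hbv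
    have := (hconn' v).induct (P := fun y => ∀ hy : y ∈ Z,
        SetReach (K.induce Z) {z | (z : U) ∈ π '' φ v} ⟨a, ha⟩ ⟨y, hy⟩) hav hbv
      (fun _ => SetReach.refl _) ?_ hb
    · exact this
    · rintro x hx y hy hxy ih hyZ
      have hxZ : x ∈ Z := by
        obtain ⟨x', hx', rfl⟩ := hx
        exact hZ x' (sub v hx')
      exact (ih hxZ).trans (SetReach.of_adj (by exact hxy) hx hy)
  · intro u v huv
    obtain ⟨a, ha, b, hb, hab⟩ := hadj u v huv
    exact ⟨⟨π a, hZ a (sub u ha)⟩, ⟨a, ha, rfl⟩, ⟨π b, hZ b (sub v hb)⟩, ⟨b, hb, rfl⟩,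
      hhom a (sub u ha) b (sub v hb) hab⟩
  · intro u v huv
    rw [Set.disjoint_left]
    rintro ⟨z, hz⟩ ⟨a, ha, rfl⟩ ⟨b, hb, hab⟩
    have : b = a := hπ (sub v hb) (sub u ha) hab
    exact Set.disjoint_left.1 (hdisj u v huv) ha (this ▸ hb)

/-- A connected minor of a graph is a minor of one of its connected components. -/
theorem IsMinor.exists_connectedComponent (hH : H.Connected) (h : IsMinor H G) :
    ∃ C : G.ConnectedComponent, IsMinor H C.toSimpleGraph := by
  obtain ⟨φ, hne, hconn, hadj, hdisj⟩ := isMinor_iff.1 h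
  have hU := setPreconn_iUnion_model hH.preconnected hconn hadj
  obtain ⟨v₀⟩ := hH.nonempty
  obtain ⟨w₀, hw₀⟩ := hne v₀
  refine ⟨G.connectedComponentMk w₀, ?_⟩
  refine isMinor_of_model_injOn hne hconn hadj hdisj id (Function.injective_id.injOn)
    (fun _ _ _ _ h => h) fun x hx => ?_
  refine hU.induct (P := fun x => x ∈ (G.connectedComponentMk w₀).supp)
    (Set.mem_iUnion_of_mem v₀ hw₀) hx rfl ?_
  intro x _ y _ hxy hx
  exact (SimpleGraph.ConnectedComponent.mem_supp_congr_adj _ hxy).1 hx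

theorem isMinor_induce (Z : Set W) : IsMinor (G.induce Z) G :=
  isMinor_of_injective_hom Subtype.val Subtype.val_injective fun _ _ h => h

end Minors

/-! ### Treewidth -/

section Treewidth

variable {V W T : Type*}

theorem exists_treeDecomposition [Finite V] (G : SimpleGraph V) :
    ∃ (ι : Type) (_ : Finite ι) (D : TreeDecomposition G ι),
      ∀ t, (D.bag t).encard ≤ (treewidth G + 1 : ℕ) := by
  have hne : {w | ∃ (ι : Type) (_ : Finite ι) (D : TreeDecomposition G ι),
      ∀ t, (D.bag t).encard ≤ (w + 1 : ℕ)}.Nonempty := by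
    refine ⟨Nat.card V, Unit, inferInstance,
      ⟨⊥, SimpleGraph.IsTree.of_subsingleton, fun _ => Set.univ, fun v => ⟨(), trivial⟩,
        fun u v _ => ⟨(), trivial, trivial⟩, fun v => SimpleGraph.Preconnected.of_subsingleton⟩,
        fun t => ?_⟩
    rw [Set.encard_univ, ENat.card_eq_coe_natCard]
    exact_mod_cast Nat.le_succ _
  exact Nat.sInf_mem hne

theorem treewidth_le_of_decomposition {G : SimpleGraph V} {w : ℕ} {ι : Type} [Finite ι]
    (D : TreeDecomposition G ι) (hD : ∀ t, (D.bag t).encard ≤ (w + 1 : ℕ)) : treewidth G ≤ w :=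
  Nat.sInf_le ⟨ι, inferInstance, D, hD⟩

theorem IsMinor.treewidth_le [Finite W] {H : SimpleGraph V} {G : SimpleGraph W}
    (h : IsMinor H G) : treewidth H ≤ treewidth G := by
  obtain ⟨φ, hne, hconn, hadj, hdisj⟩ := isMinor_iff.1 h
  obtain ⟨ι, _, D, hD⟩ := exists_treeDecomposition G
  refine treewidth_le_of_decomposition (ι := ι)
    ⟨D.tree, D.isTree, fun t => {v | (φ v ∩ D.bag t).Nonempty}, fun v => ?_, fun u v huv => ?_,
      fun v => ?_⟩ fun t => ?_
  · obtain ⟨w, hw⟩ := hne v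
    obtain ⟨t, ht⟩ := D.exists_mem_bag w
    exact ⟨t, w, hw, ht⟩
  · obtain ⟨a, ha, b, hb, hab⟩ := hadj u v huv
    obtain ⟨t, hat, hbt⟩ := D.exists_edge_bag a b hab
    exact ⟨t, ⟨a, ha, hat⟩, ⟨b, hb, hbt⟩⟩
  · rw [preconnected_induce_iff]
    have := (hconn v).biUnion (K := D.tree) (ψ := fun w => {t | w ∈ D.bag t})
      (fun w _ => preconnected_induce_iff.1 (D.preconnected w))
      fun w _ w' _ h => by
        obtain ⟨t, h1, h2⟩ := D.exists_edge_bag w w' h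
        exact ⟨t, h1, t, h2, Or.inl rfl⟩
    convert! this using 1
    ext t
    simp [Set.Nonempty]
  · -- distinct vertices have disjoint branch sets, hence distinct representatives in the bag
    refine le_trans ?_ (hD t)
    choose f hf using fun v : {v | (φ v ∩ D.bag t).Nonempty} => v.2
    have hinj : Function.Injective fun v => (⟨f v, (hf v).2⟩ : D.bag t) := by
      intro u v huv
      by_contra hne
      have : f u = f v := congrArg Subtype.val huv
      exact Set.disjoint_left.1 (hdisj u v fun h => hne (Subtype.ext h)) (hf u).1
        (this ▸ (hf v).1)
    exact ENat.card_le_card_of_injective hinj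

theorem isTree_sum_sup_edge {ι κ : Type*} [Finite ι] [Finite κ] {S : SimpleGraph ι}
    {T : SimpleGraph κ} (hS : S.IsTree) (hT : T.IsTree) (s : ι) (t : κ) :
    ((S ⊕g T) ⊔ SimpleGraph.edge (Sum.inl s) (Sum.inr t)).IsTree := by
  set R := (S ⊕g T) ⊔ SimpleGraph.edge (Sum.inl s) (Sum.inr t) with hR
  have hst : R.Adj (Sum.inl s) (Sum.inr t) := by
    simp [hR, SimpleGraph.edge_adj]
  have hl : ∀ a b, R.Reachable (Sum.inl a) (Sum.inl b) := fun a b =>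
    (hS.connected.preconnected a b).map
      (⟨Sum.inl, fun {a b} h => Or.inl (by simpa using h)⟩ : S →g R)
  have hr : ∀ a b, R.Reachable (Sum.inr a) (Sum.inr b) := fun a b =>
    (hT.connected.preconnected a b).map
      (⟨Sum.inr, fun {a b} h => Or.inl (by simpa using h)⟩ : T →g R)
  have hconn : R.Connected := by
    rw [SimpleGraph.connected_iff_exists_forall_reachable]
    refine ⟨Sum.inl s, ?_⟩
    rintro (a | b)
    · exact hl s a
    · exact hst.reachable.trans (hr t b)
  refine SimpleGraph.isTree_iff_connected_and_card.2 ⟨hconn, le_antisymm ?_ ?_⟩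
  · have h1 := (SimpleGraph.isTree_iff_connected_and_card.1 hS).2
    have h2 := (SimpleGraph.isTree_iff_connected_and_card.1 hT).2
    have h3 : Nat.card (S ⊕g T).edgeSet = Nat.card S.edgeSet + Nat.card T.edgeSet := by
      rw [Nat.card_congr SimpleGraph.edgeSetSumEquiv, Nat.card_sum]
    have h4 : Nat.card R.edgeSet ≤ Nat.card (S ⊕g T).edgeSet + 1 := by
      rw [Nat.card_coe_set_eq, Nat.card_coe_set_eq, hR, SimpleGraph.edgeSet_sup]
      refine (Set.ncard_union_le _ _).trans (Nat.add_le_add_left ?_ _)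
      refine (Set.ncard_le_ncard (t := {s(Sum.inl s, Sum.inr t)}) ?_ (Set.finite_singleton _)).trans
        (by simp)
      simp [SimpleGraph.edge, SimpleGraph.edgeSet_fromEdgeSet]
    rw [Nat.card_sum]
    omega
  · exact hconn.card_vert_le_card_edgeSet_add_one

/-- A decomposition of width `w` of the vertex set `A` with the edges of `E`, over a finite tree;
vertices outside `A` are in no bag. -/
def PartialTreeDecomposition (w : ℕ) (A : Set W) (E : W → W → Prop) : Prop :=
  ∃ (ι : Type) (_ : Finite ι) (T : SimpleGraph ι) (bag : ι → Set W), T.IsTree ∧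
    (∀ t, bag t ⊆ A) ∧ (∀ v ∈ A, ∃ t, v ∈ bag t) ∧
    (∀ u v, E u v → ∃ t, u ∈ bag t ∧ v ∈ bag t) ∧
    (∀ v, SetPreconn T {t | v ∈ bag t}) ∧ ∀ t, (bag t).encard ≤ (w + 1 : ℕ)

theorem partialTreeDecomposition_empty (w : ℕ) :
    PartialTreeDecomposition w (∅ : Set W) fun _ _ => False :=
  ⟨Unit, inferInstance, ⊥, fun _ => ∅, SimpleGraph.IsTree.of_subsingleton, by simp, by simp,
    by simp, by simp [SetPreconn], by simp⟩

/-- Two decompositions of vertex sets with at most one common vertex can be glued. -/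
theorem PartialTreeDecomposition.union {w : ℕ} {A B : Set W} {E F : W → W → Prop}
    (hA : PartialTreeDecomposition w A E) (hB : PartialTreeDecomposition w B F)
    (hAB : (A ∩ B).Subsingleton) :
    PartialTreeDecomposition w (A ∪ B) fun u v => E u v ∨ F u v := by
  obtain ⟨ι, _, S, bag, hS, hsub, hcov, hedge, hconn, hcard⟩ := hA
  obtain ⟨κ, _, T, bag', hT, hsub', hcov', hedge', hconn', hcard'⟩ := hB
  obtain ⟨s, t, hst⟩ : ∃ s t, ∀ v ∈ A ∩ B, v ∈ bag s ∧ v ∈ bag' t := by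
    rcases (A ∩ B).eq_empty_or_nonempty with h | ⟨v, hv⟩
    · obtain ⟨s⟩ := hS.connected.nonempty
      obtain ⟨t⟩ := hT.connected.nonempty
      exact ⟨s, t, by simp [h]⟩
    · obtain ⟨s, hs⟩ := hcov v hv.1
      obtain ⟨t, ht⟩ := hcov' v hv.2
      exact ⟨s, t, fun u hu => by rw [hAB hu hv]; exact ⟨hs, ht⟩⟩
  refine ⟨ι ⊕ κ, inferInstance, _, Sum.elim bag bag', isTree_sum_sup_edge hS hT s t, ?_, ?_, ?_,
    ?_, ?_⟩
  · rintro (a | a)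
    · exact (hsub a).trans Set.subset_union_left
    · exact (hsub' a).trans Set.subset_union_right
  · rintro v (hv | hv)
    · obtain ⟨a, ha⟩ := hcov v hv
      exact ⟨Sum.inl a, ha⟩
    · obtain ⟨a, ha⟩ := hcov' v hv
      exact ⟨Sum.inr a, ha⟩
  · rintro u v (h | h)
    · obtain ⟨a, ha⟩ := hedge u v h
      exact ⟨Sum.inl a, ha⟩
    · obtain ⟨a, ha⟩ := hedge' u v h
      exact ⟨Sum.inr a, ha⟩
  · intro v
    have h1 := (hconn v).image (K := (S ⊕g T) ⊔ SimpleGraph.edge (Sum.inl s) (Sum.inr t))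
      (r := Sum.inl) fun a _ b _ h => Or.inr (Or.inl (by simpa using h))
    have h2 := (hconn' v).image (K := (S ⊕g T) ⊔ SimpleGraph.edge (Sum.inl s) (Sum.inr t))
      (r := Sum.inr) fun a _ b _ h => Or.inr (Or.inl (by simpa using h))
    have hset : {a | v ∈ Sum.elim bag bag' a} =
        Sum.inl '' {a | v ∈ bag a} ∪ Sum.inr '' {a | v ∈ bag' a} := by
      ext (a | a) <;> simp
    rw [hset]
    by_cases hvA : v ∈ A
    · by_cases hvB : v ∈ B
      · obtain ⟨hs, ht⟩ := hst v ⟨hvA, hvB⟩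
        exact h1.union_of_adj h2 (a := Sum.inl s) (b := Sum.inr t) ⟨s, hs, rfl⟩ ⟨t, ht, rfl⟩
          (by simp [SimpleGraph.edge_adj])
      · have : {a | v ∈ bag' a} = ∅ := by
          ext a; simpa using fun h => hvB (hsub' a h)
        simpa [this] using h1
    · have : {a | v ∈ bag a} = ∅ := by
        ext a; simpa using fun h => hvA (hsub a h)
      simpa [this] using h2
  · rintro (a | a)
    · exact hcard a
    · exact hcard' a

theorem PartialTreeDecomposition.mono {w : ℕ} {A : Set W} {E F : W → W → Prop}
    (hA : PartialTreeDecomposition w A E) (h : ∀ u v, F u v → E u v) :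
    PartialTreeDecomposition w A F := by
  obtain ⟨ι, hι, S, bag, hS, hsub, hcov, hedge, hconn, hcard⟩ := hA
  exact ⟨ι, hι, S, bag, hS, hsub, hcov, fun u v huv => hedge u v (h u v huv), hconn, hcard⟩

/-- A decomposition of a graph `M` pulled back along a map that is injective on `B`. -/
theorem partialTreeDecomposition_of_injOn [Finite T] (M : SimpleGraph T) {B : Set W} {π : W → T}
    (hπ : Set.InjOn π B) :
    PartialTreeDecomposition (treewidth M) B
      fun u v => u ∈ B ∧ v ∈ B ∧ M.Adj (π u) (π v) := by
  obtain ⟨ι, hι, D, hD⟩ := exists_treeDecomposition M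
  refine ⟨ι, hι, D.tree, fun t => B ∩ π ⁻¹' D.bag t, D.isTree, fun t => Set.inter_subset_left,
    ?_, ?_, ?_, ?_⟩
  · intro v hv
    obtain ⟨t, ht⟩ := D.exists_mem_bag (π v)
    exact ⟨t, hv, ht⟩
  · rintro u v ⟨hu, hv, huv⟩
    obtain ⟨t, ht, ht'⟩ := D.exists_edge_bag _ _ huv
    exact ⟨t, ⟨hu, ht⟩, ⟨hv, ht'⟩⟩
  · intro v
    by_cases hv : v ∈ B
    · simpa [hv] using preconnected_induce_iff.1 (D.preconnected (π v))
    · simp [hv, SetPreconn]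
  · intro t
    refine le_trans ?_ (hD t)
    rw [← (hπ.mono Set.inter_subset_left).encard_image]
    exact Set.encard_le_encard (by rintro _ ⟨v, hv, rfl⟩; exact hv.2)

/-- The treewidth of a graph glued from subgraphs of `M` along single vertices. The vertex sets
`B j` of the pieces are added in the order of their ranks; `own v` is the piece that introduces
the vertex `v`. -/
theorem partialTreeDecomposition_of_pieces [Finite T] (M : SimpleGraph T) {J : Type*}
    (s : Finset J) (B : J → Set W) (π : J → W → T) (rk : J → ℕ) (own : W → J)
    (hπ : ∀ j, Set.InjOn (π j) (B j))
    (hown : ∀ j, ∀ v ∈ B j, own v = j ∨ rk (own v) < rk j)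
    (hsub : ∀ j, {v ∈ B j | own v ≠ j}.Subsingleton) :
    PartialTreeDecomposition (treewidth M) (⋃ j ∈ s, B j)
      fun u v => ∃ j ∈ s, u ∈ B j ∧ v ∈ B j ∧ M.Adj (π j u) (π j v) := by
  classical
  induction s using Finset.induction_on_max_value rk with
  | empty => simpa using partialTreeDecomposition_empty (W := W) (treewidth M)
  | insert a s has hmax ih =>
    have := ih.union (partialTreeDecomposition_of_injOn M (hπ a)) ?_
    · rw [Finset.set_biUnion_insert, Set.union_comm]
      refine this.mono ?_
      rintro u v ⟨j, hj, h⟩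
      rcases Finset.mem_insert.1 hj with rfl | hj
      · exact Or.inr h
      · exact Or.inl ⟨j, hj, h⟩
    · refine (hsub a).anti ?_
      rintro v ⟨hv, hva⟩
      refine ⟨hva, fun hva' => ?_⟩
      simp only [Set.mem_iUnion] at hv
      obtain ⟨j, hj, hvj⟩ := hv
      rcases hown j v hvj with h | h
      · exact has (by rw [← hva', h]; exact hj)
      · have := hmax j hj
        rw [hva'] at h
        omega

/-- Vertices in no piece are isolated and get bags of their own. -/
theorem PartialTreeDecomposition.extend [Finite W] {w : ℕ} {A : Set W} {E : W → W → Prop}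
    (hA : PartialTreeDecomposition w A E) {C : Set W} (hAC : A ⊆ C) :
    PartialTreeDecomposition w C E := by
  suffices h : ∀ F : Set W, F.Finite → PartialTreeDecomposition w (A ∪ F) E by
    have := h C (Set.toFinite C)
    rwa [Set.union_eq_right.2 hAC] at this
  intro F hF
  induction F, hF using Set.Finite.induction_on with
  | empty => simpa using hA
  | @insert a s has _ ih =>
    by_cases haA : a ∈ A ∪ s
    · rwa [Set.union_insert, Set.insert_eq_of_mem haA]
    · have h1 : PartialTreeDecomposition w ({a} : Set W) fun _ _ => False :=
        ⟨Unit, inferInstance, ⊥, fun _ => {a}, SimpleGraph.IsTree.of_subsingleton, by simp,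
          by simp, by simp, fun v x _ y _ => by
            rw [Subsingleton.elim x y]; exact SetReach.refl _, by simp⟩
      have := ih.union h1 (by
        rintro x ⟨hx, rfl⟩
        exact absurd hx haA)
      rw [Set.union_insert, Set.insert_eq, Set.union_comm {a}]
      exact this.mono fun u v h => Or.inl h

theorem PartialTreeDecomposition.treewidth_deleteVerts_le {G : SimpleGraph W} {w : ℕ}
    {X : Set W} {E : W → W → Prop} (h : PartialTreeDecomposition w Xᶜ E)
    (hE : ∀ u ∉ X, ∀ v ∉ X, G.Adj u v → E u v ) :
    treewidth (deleteVerts G X) ≤ w := by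
  obtain ⟨ι, hι, S, bag, hS, hsub, hcov, hedge, hconn, hcard⟩ := h
  refine treewidth_le_of_decomposition (ι := ι) ⟨S, hS, fun t => Subtype.val ⁻¹' bag t,
    fun v => hcov v v.2, fun u v huv => hedge u v (hE u u.2 v v.2 huv),
    fun v => preconnected_induce_iff.2 (hconn v)⟩ fun t => ?_
  refine le_trans ?_ (hcard t)
  rw [← Subtype.val_injective.injOn.encard_image]
  exact Set.encard_le_encard (by rintro _ ⟨v, hv, rfl⟩; exact hv)

end Treewidth

/-! ### Leaf-blocks -/

section LeafBlocks

variable {V : Type*} {H : SimpleGraph V}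

/-- `D` is a nonempty union of connected components of `H - v`. -/
def IsSeparatedBy (H : SimpleGraph V) (v : V) (D : Set V) : Prop :=
  D.Nonempty ∧ v ∉ D ∧ ∀ a ∈ D, ∀ b, H.Adj a b → b = v ∨ b ∈ D

/-- The vertex set `A` induces a biconnected subgraph. -/
def SetBiconn (H : SimpleGraph V) (A : Set V) : Prop :=
  A.Nonempty ∧ SetPreconn H A ∧ ∀ z, SetPreconn H (A \ {z})

theorem isCutVertex_iff (hH : H.Preconnected) (v : V) :
    IsCutVertex H v ↔ ¬ SetPreconn H {v}ᶜ := by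
  constructor
  · rintro ⟨a, b, ha, hb, -, h⟩ h'
    exact h ((reachable_induce_iff ha hb).2 (h' a ha b hb))
  · intro h
    simp only [SetPreconn, not_forall] at h
    obtain ⟨a, ha, b, hb, h⟩ := h
    exact ⟨a, b, ha, hb, hH a b, fun h' => h ((reachable_induce_iff ha hb).1 h')⟩

theorem setBiconn_verts {B : H.Subgraph} (hB : IsBiconnected B.coe) : SetBiconn H B.verts := by
  have hP := hB.1.preconnected
  have key : ∀ A : Set B.verts, SetPreconn B.coe A → SetPreconn H (Subtype.val '' A) :=
    fun A hA => hA.image fun w _ w' _ h => Or.inr (B.adj_sub h)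
  refine ⟨Set.nonempty_coe_sort.1 hB.1.nonempty, ?_, fun z => ?_⟩
  · simpa using key _ (setPreconn_univ_iff.2 hP)
  · by_cases hz : z ∈ B.verts
    · have := key _ (not_not.1 fun h => hB.2 ⟨z, hz⟩ ((isCutVertex_iff hP _).2 h))
      convert! this using 1
      ext w
      simp only [Set.mem_sdiff, Set.mem_singleton_iff, Set.mem_image, Set.mem_compl_iff,
        Subtype.exists, Subtype.mk.injEq, exists_and_right, exists_eq_right]
      constructor
      · rintro ⟨h1, h2⟩
        exact ⟨h1, h2⟩
      · rintro ⟨h1, h2⟩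
        exact ⟨h1, h2⟩
    · rw [Set.sdiff_singleton_eq_self hz]
      simpa using key _ (setPreconn_univ_iff.2 hP)

theorem SetBiconn.isBiconnected {A : Set V} (hA : SetBiconn H A) :
    IsBiconnected ((⊤ : H.Subgraph).induce A).coe := by
  set K := ((⊤ : H.Subgraph).induce A).coe
  have lift : ∀ C : Set V, C ⊆ A → SetPreconn H C → ∀ u (hu : u ∈ A) v (hv : v ∈ A), u ∈ C →
      v ∈ C → SetReach K (Subtype.val ⁻¹' C) ⟨u, hu⟩ ⟨v, hv⟩ := by
    intro C hCA hC u hu v hv huC hvC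
    refine hC.induct (P := fun v => ∀ hv : v ∈ A,
        SetReach K (Subtype.val ⁻¹' C) ⟨u, hu⟩ ⟨v, hv⟩) huC hvC (fun _ => SetReach.refl _) ?_ hv
    intro x hx y hy hxy ih hyA
    refine (ih (hCA hx)).trans (SetReach.of_adj ?_ hx hy)
    show ((⊤ : H.Subgraph).induce A).Adj x y
    exact ⟨hCA hx, hyA, hxy⟩
  have hpre : K.Preconnected := by
    rw [← setPreconn_univ_iff]
    rintro ⟨u, hu⟩ - ⟨v, hv⟩ -
    exact (lift A subset_rfl hA.2.1 u hu v hv hu hv).mono (Set.subset_univ _)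
  refine ⟨(SimpleGraph.connected_iff _).2 ⟨hpre, Set.nonempty_coe_sort.2 hA.1⟩, fun z => ?_⟩
  rw [isCutVertex_iff hpre, not_not]
  rintro ⟨u, hu⟩ hu' ⟨v, hv⟩ hv'
  refine (lift (A \ {z.1}) Set.sdiff_subset (hA.2.2 z) u hu v hv ⟨hu, ?_⟩ ⟨hv, ?_⟩).mono ?_
  · exact fun h => hu' (Subtype.ext h)
  · exact fun h => hv' (Subtype.ext h)
  · rintro w hw rfl
    exact hw.2 rfl

theorem setBiconn_pair {a b : V} (h : H.Adj a b) : SetBiconn H {a, b} := by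
  have hs : ∀ A : Set V, A ⊆ {a, b} → SetPreconn H A := by
    intro A hA u hu v hv
    rcases hA hu with rfl | rfl <;> rcases hA hv with rfl | rfl
    · exact SetReach.refl _
    · exact SetReach.of_adj h hu hv
    · exact SetReach.of_adj h.symm hu hv
    · exact SetReach.refl _
  exact ⟨⟨a, by simp⟩, hs _ subset_rfl, fun z => hs _ Set.sdiff_subset⟩

/-- The vertices reachable inside `P` from `u`. -/
theorem setPreconn_setReach (P : Set V) (u : V) :
    SetPreconn H {w | SetReach H P u w} := by
  have key : ∀ w, SetReach H P u w → SetReach H {w | SetReach H P u w} u w := by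
    intro w hw
    induction hw with
    | refl => exact SetReach.refl _
    | @tail x y hx hxy ih =>
      exact ih.trans (SetReach.of_adj hxy.1 hx (Relation.ReflTransGen.tail hx hxy))
  exact fun x hx y hy => (key x hx).symm.trans (key y hy)

/-- Adding an ear: if `a ∈ A` is not a cut vertex, every neighbour of `a` outside `A` lies in a
biconnected set extending `A`. The ear is an inclusion-minimal connected set through the
neighbour which touches `A` in a second vertex. -/
theorem SetBiconn.exists_ear [Finite V] {A : Set V} (hA : SetBiconn H A) {a b : V} (haA : a ∈ A)
    (hbA : b ∉ A) (hab : H.Adj a b) (ha : SetPreconn H {a}ᶜ) :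
    ∃ A', SetBiconn H A' ∧ A ⊆ A' ∧ b ∈ A' := by
  by_cases hex : ∃ a' ∈ A, a' ≠ a
  swap
  · push Not at hex
    refine ⟨{a, b}, setBiconn_pair hab, fun u hu => ?_, by simp⟩
    rw [hex u hu]; simp
  obtain ⟨a', ha'A, ha'⟩ := hex
  let Good : Set V → Prop := fun P =>
    b ∈ P ∧ P ⊆ Aᶜ ∧ SetPreconn H P ∧ ∃ p ∈ P, ∃ q ∈ A, q ≠ a ∧ H.Adj p q
  have hgood : ∃ n, ∃ P, Good P ∧ P.ncard = n := by
    refine ⟨_, {w | SetReach H Aᶜ b w}, ⟨SetReach.refl b, fun w hw => hw.mem_of_mem hbA,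
      setPreconn_setReach _ b, ?_⟩, rfl⟩
    by_contra hno
    push Not at hno
    have hba : b ≠ a := fun h => hbA (h ▸ haA)
    have : SetReach H Aᶜ b a' :=
      ha.induct (P := fun w => SetReach H Aᶜ b w) (u := b) (v := a') hba ha' (SetReach.refl b) (by
        intro x _ y hy hxy hx
        by_cases hyA : y ∈ A
        · exact absurd hxy (hno x hx y hyA hy)
        · exact hx.trans (SetReach.of_adj hxy (hx.mem_of_mem hbA) hyA))
    exact this.mem_of_mem hbA ha'A
  classical
  obtain ⟨P, ⟨hbP, hPA, hP, p, hpP, q, hqA, hqa, hpq⟩, hPn⟩ := Nat.find_spec hgood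
  have hmin : ∀ Q, Good Q → P.ncard ≤ Q.ncard := fun Q hQ => by
    rw [hPn]; exact Nat.find_min' hgood ⟨Q, hQ, rfl⟩
  refine ⟨A ∪ P, ⟨hA.1.mono Set.subset_union_left, hA.2.1.union_of_adj hP haA hbP hab,
    fun z => ?_⟩, Set.subset_union_left, Or.inr hbP⟩
  by_cases hzP : z ∈ P
  · have hzA : z ∉ A := hPA hzP
    have hset : (A ∪ P) \ {z} = A ∪ P \ {z} := by
      rw [Set.union_sdiff_distrib, Set.sdiff_singleton_eq_self hzA]
    rw [hset]
    have key : ∀ u ∈ A ∪ P \ {z}, SetReach H (A ∪ P \ {z}) u a := by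
      rintro u (hu | hu)
      · exact (hA.2.1 u hu a haA).mono Set.subset_union_left
      -- the component `Q` of `u` in `P - z`: if no edge leads from it to `A`, then `P \ Q` is
      -- a smaller ear
      set Q := {w | SetReach H (P \ {z}) u w} with hQ
      have hQP : Q ⊆ P \ {z} := fun w hw => hw.mem_of_mem hu
      by_cases hex : ∃ w ∈ Q, ∃ y ∈ A, H.Adj w y
      · obtain ⟨w, hw, y, hy, hwy⟩ := hex
        exact ((hw.mono Set.subset_union_right).trans (SetReach.of_adj hwy
          (Or.inr (hQP hw)) (Or.inl hy))).trans ((hA.2.1 y hy a haA).mono Set.subset_union_left)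
      · exfalso
        push Not at hex
        have hbQ : b ∉ Q := fun h => hex b h a haA hab.symm
        have hpQ : p ∉ Q := fun h => hex p h q hqA hpq
        have hzQ : z ∈ P \ Q := ⟨hzP, fun h => (hQP h).2 rfl⟩
        have hreach : ∀ w ∈ P \ Q, SetReach H (P \ Q) w z := by
          intro w hw
          by_contra hnz
          have hz : SetReach H (P \ Q) w z :=
            hP.induct (P := fun y => SetReach H (P \ Q) w y) hw.1 hzP (SetReach.refl w) (by
              intro x _ y hyP hxy hx
              have hxPQ := hx.mem_of_mem hw
              have hxz : x ≠ z := by rintro rfl; exact hnz hx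
              by_cases hyQ : y ∈ Q
              · exact absurd (SetReach.trans hyQ
                  (SetReach.of_adj hxy.symm (hQP hyQ) ⟨hxPQ.1, hxz⟩)) hxPQ.2
              · exact hx.trans (SetReach.of_adj hxy hxPQ ⟨hyP, hyQ⟩))
          exact hnz hz
        have hle := hmin (P \ Q) ⟨⟨hbP, hbQ⟩, Set.sdiff_subset.trans hPA,
          fun x hx y hy => (hreach x hx).trans (hreach y hy).symm,
          p, ⟨hpP, hpQ⟩, q, hqA, hqa, hpq⟩
        have hlt : (P \ Q).ncard < P.ncard :=
          Set.ncard_lt_ncard ⟨Set.sdiff_subset, fun h => (h hu.1).2 (SetReach.refl u)⟩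
            (Set.toFinite _)
        omega
    exact fun u hu v hv => (key u hu).trans (key v hv).symm
  · rw [Set.union_sdiff_distrib, Set.sdiff_singleton_eq_self hzP]
    by_cases hza : z = a
    · subst hza
      exact (hA.2.2 z).union_of_adj hP (a := q) (b := p) ⟨hqA, hqa⟩ hpP hpq.symm
    · exact (hA.2.2 z).union_of_adj hP (a := a) (b := b) ⟨haA, fun h => hza h.symm⟩ hbP hab

theorem SetBiconn.subset_of_maximal {B : H.Subgraph}
    (hB : Maximal (fun B' : H.Subgraph => IsBiconnected B'.coe) B) {A : Set V}
    (hA : SetBiconn H A) (h : B.verts ⊆ A) : A ⊆ B.verts := by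
  have hle : B ≤ (⊤ : H.Subgraph).induce A :=
    ⟨h, fun u v huv => ⟨h (B.edge_vert huv), h (B.edge_vert huv.symm), B.adj_sub huv⟩⟩
  exact (hB.2 hA.isBiconnected hle).1

/-- The structure of a smallest leaf-block `L` of a connected graph `H`: it is attached to the rest
of the graph at a vertex `c`, and there is no vertex `v` for which `H - v` has a component with
fewer than `|L| - 1` vertices. It is found as `D ∪ {c}` with `D` smallest among all components
of all the graphs `H - c`. -/
theorem exists_smallest_leafBlock [Finite V] (hH : H.Connected) (h2 : 2 ≤ Nat.card V) :
    ∃ (L : Set V) (c x : V), c ∈ L ∧ x ∈ L ∧ x ≠ c ∧ L.ncard = slb H ∧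
      (∀ a ∈ L, a ≠ c → ∀ b, H.Adj a b → b ∈ L) ∧
      ∀ v D, IsSeparatedBy H v D → slb H ≤ D.ncard + 1 := by
  classical
  have hnt : Nontrivial V := Finite.one_lt_card_iff_nontrivial.1 h2
  have hpre := setPreconn_univ_iff.2 hH.preconnected
  have hex : ∃ n v D, IsSeparatedBy H v D ∧ D.ncard = n := by
    obtain ⟨v, w, hvw⟩ := exists_pair_ne V
    exact ⟨_, v, {v}ᶜ, ⟨⟨w, hvw.symm⟩, by simp, fun a _ b _ => by
      simpa using em (b = v)⟩, rfl⟩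
  obtain ⟨c, D, ⟨⟨x, hxD⟩, hcD, hclosed⟩, hDn⟩ := Nat.find_spec hex
  have hmin : ∀ v D', IsSeparatedBy H v D' → D.ncard ≤ D'.ncard := fun v D' h => by
    rw [hDn]; exact Nat.find_min' hex ⟨v, D', h, rfl⟩
  -- `D` is connected and joined to `c`
  have hD : SetPreconn H D := by
    have key : ∀ u ∈ D, {w | SetReach H D u w} = D := by
      intro u hu
      refine Set.eq_of_subset_of_ncard_le (fun w hw => hw.mem_of_mem hu) (hmin c _ ⟨⟨u,
        SetReach.refl u⟩, fun h => hcD (h.mem_of_mem hu), fun a ha b hab => ?_⟩) (Set.toFinite _)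
      refine (hclosed a (ha.mem_of_mem hu) b hab).imp_right fun hb => ?_
      exact SetReach.trans ha (SetReach.of_adj hab (ha.mem_of_mem hu) hb)
    intro u hu v hv
    exact (key u hu).ge hv
  obtain ⟨d, hdD, hdc⟩ : ∃ d ∈ D, H.Adj d c := by
    by_contra hno
    push Not at hno
    refine hcD (hpre.induct (P := (· ∈ D)) (u := x) (v := c) trivial trivial hxD ?_)
    intro a _ b _ hab ha
    rcases hclosed a ha b hab with rfl | h
    · exact absurd hab (hno a ha)
    · exact h
  set L := D ∪ {c} with hL
  have hcL : c ∈ L := Or.inr rfl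
  have hLcard : L.ncard = D.ncard + 1 := by
    rw [hL, Set.union_singleton, Set.ncard_insert_of_notMem hcD (Set.toFinite _)]
  have hLclosed : ∀ a ∈ D, ∀ b, H.Adj a b → b ∈ L := fun a ha b hab =>
    (hclosed a ha b hab).elim (fun h => Or.inr h) Or.inl
  -- a component of `L - z` that misses `c` would be a smaller choice than `D`
  have hLbic : SetBiconn H L := by
    refine ⟨⟨c, hcL⟩, hD.union_of_adj (setPreconn_singleton c) hdD rfl hdc, fun z => ?_⟩
    by_cases hzD : z ∈ D
    · have key : ∀ u ∈ L \ {z}, SetReach H (L \ {z}) u c := by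
        intro u hu
        by_contra hno
        have hsub : {w | SetReach H (L \ {z}) u w} ⊆ D \ {z} := by
          intro w hw
          have hwL := hw.mem_of_mem hu
          refine ⟨hwL.1.resolve_right fun h => hno ?_, hwL.2⟩
          rw [Set.mem_singleton_iff] at h
          exact h ▸ hw
        have h1 := hmin z {w | SetReach H (L \ {z}) u w} ⟨⟨u, SetReach.refl u⟩,
          fun h => (hsub h).2 rfl, fun a ha b hab => ?_⟩
        · have h2 : (D \ {z}).ncard < D.ncard :=
            Set.ncard_lt_ncard ⟨Set.sdiff_subset, fun h => (h hzD).2 rfl⟩ (Set.toFinite _)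
          have h3 := Set.ncard_le_ncard hsub (Set.toFinite _)
          omega
        · by_cases hbz : b = z
          · exact Or.inl hbz
          · right
            exact SetReach.trans ha (SetReach.of_adj hab (SetReach.mem_of_mem ha hu)
              ⟨hLclosed a (hsub ha).1 b hab, hbz⟩)
      exact fun u hu v hv => (key u hu).trans (key v hv).symm
    · by_cases hzc : z = c
      · have : L \ {z} = D := by
          rw [hL, hzc, Set.union_sdiff_right, Set.sdiff_singleton_eq_self hcD]
        rwa [this]
      · have : L \ {z} = L := Set.sdiff_singleton_eq_self (by
          rintro (h | h)
          · exact hzD h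
          · exact hzc h)
        rw [this]
        exact hD.union_of_adj (setPreconn_singleton c) hdD rfl hdc
  -- no vertex of `D` is a cut vertex
  have hcut : ∀ z ∈ D, SetPreconn H {z}ᶜ := by
    intro z hzD
    have hcz : c ≠ z := fun h => hcD (h ▸ hzD)
    have key : ∀ u ∈ ({z}ᶜ : Set V), SetReach H {z}ᶜ u c := by
      intro u hu
      by_contra hno
      set E := {w | SetReach H {z}ᶜ u w} with hE
      have hEz : z ∉ E := fun h => SetReach.mem_of_mem h hu rfl
      have hEcl : ∀ a ∈ E, ∀ b, H.Adj a b → b = z ∨ b ∈ E := fun a ha b hab => by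
        by_cases hbz : b = z
        · exact Or.inl hbz
        · exact Or.inr (SetReach.trans ha (SetReach.of_adj hab (SetReach.mem_of_mem ha hu) hbz))
      by_cases hsub : E ⊆ D
      · have h1 := hmin z E ⟨⟨u, SetReach.refl u⟩, hEz, hEcl⟩
        have h2 : E.ncard < D.ncard :=
          Set.ncard_lt_ncard ⟨hsub, fun h => hEz (h hzD)⟩ (Set.toFinite _)
        omega
      · obtain ⟨w, hwE, hwD⟩ := Set.not_subset.1 hsub
        -- the rest of `E` would be a union of components of `H` that misses `c`
        have : c ∈ E \ D := by
          refine hpre.induct (P := (· ∈ E \ D)) (u := w) trivial trivial ⟨hwE, hwD⟩ ?_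
          intro a _ b _ hab ha
          have hbD : b ∉ D := by
            intro hb
            rcases hclosed b hb a hab.symm with rfl | h
            · exact hno ha.1
            · exact ha.2 h
          exact ⟨(hEcl a ha.1 b hab).resolve_left fun h => hbD (h ▸ hzD), hbD⟩
        exact hno this.1
    exact fun u hu v hv => (key u hu).trans (key v hv).symm
  -- `L` is a leaf-block
  have hLleaf : IsLeafBlock H ((⊤ : H.Subgraph).induce L) := by
    refine ⟨⟨hLbic.isBiconnected, fun B hB hle => ?_⟩, ?_⟩
    · have hBv : SetBiconn H B.verts := setBiconn_verts hB
      have hsub : B.verts ⊆ L := by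
        intro w hw
        by_contra hwL
        have hLB : L ⊆ B.verts := hle.1
        have hwc : w ≠ c := fun h => hwL (h ▸ hcL)
        have hxc : x ≠ c := fun h => hcD (h ▸ hxD)
        refine hwL (Or.inl ?_)
        refine (hBv.2.2 c).induct (P := (· ∈ D)) (u := x) ⟨hLB (Or.inl hxD), hxc⟩ ⟨hw, hwc⟩ hxD ?_
        intro a _ b hb hab ha
        exact (hclosed a ha b hab).resolve_left hb.2
      exact ⟨hsub, fun u v huv => ⟨hsub (B.edge_vert huv), hsub (B.edge_vert huv.symm),
        B.adj_sub huv⟩⟩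
    · have : ∀ u, u ∈ L ∧ IsCutVertex H u → u = c := by
        rintro u ⟨hu | hu, hc⟩
        · exact absurd (hcut u hu) ((isCutVertex_iff hH.preconnected u).1 hc)
        · exact hu
      intro u hu v hv
      rw [this u hu, this v hv]
  -- no leaf-block is smaller
  have hlow : ∀ B : H.Subgraph, IsLeafBlock H B → D.ncard + 1 ≤ B.verts.ncard := by
    rintro B ⟨hmax, hss⟩
    have hBv : SetBiconn H B.verts := setBiconn_verts hmax.1
    -- the neighbours of a vertex of `B` that is not a cut vertex lie in `B`, by maximality
    have hnc : ∀ a ∈ B.verts, ¬ IsCutVertex H a → ∀ b, H.Adj a b → b ∈ B.verts := by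
      intro a ha hac b hab
      by_contra hb
      rw [isCutVertex_iff hH.preconnected, not_not] at hac
      obtain ⟨A', hA', hsub, hbA'⟩ := hBv.exists_ear ha hb hab hac
      exact hb (SetBiconn.subset_of_maximal hmax hA' hsub hbA')
    by_cases huniv : B.verts = Set.univ
    · rw [huniv, ← hLcard]
      exact Set.ncard_le_ncard (Set.subset_univ _) (Set.toFinite _)
    · obtain ⟨u, hu⟩ := hBv.1
      obtain ⟨w, hw⟩ : ∃ w, w ∉ B.verts := by
        by_contra h
        push Not at h
        exact huniv (Set.eq_univ_of_forall h)
      obtain ⟨a, ha, haC⟩ : ∃ a ∈ B.verts, IsCutVertex H a := by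
        by_contra hno
        push Not at hno
        exact hw (hpre.induct (P := (· ∈ B.verts)) (u := u) trivial trivial hu
          fun y _ z _ hyz hy => hnc y hy (hno y hy) z hyz)
      have hsep : IsSeparatedBy H a (B.verts \ {a}) := by
        refine ⟨?_, by simp, fun y hy z hyz => ?_⟩
        · by_contra hempty
          rw [Set.not_nonempty_iff_eq_empty, Set.sdiff_eq_empty] at hempty
          obtain ⟨b, hab⟩ : ∃ b, H.Adj a b := hH.preconnected.exists_adj_of_nontrivial a
          have := SetBiconn.subset_of_maximal hmax (setBiconn_pair hab)
            (hempty.trans (by simp)) (by simp : b ∈ _)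
          exact hab.ne (hempty this).symm
        · by_cases hza : z = a
          · exact Or.inl hza
          · exact Or.inr ⟨hnc y hy.1 (fun hyc => hy.2 (hss ⟨hy.1, hyc⟩ ⟨ha, haC⟩)) z hyz, hza⟩
      have := hmin a _ hsep
      have h2 := Set.ncard_sdiff_singleton_add_one ha (Set.toFinite _)
      omega
  have hslb : slb H = D.ncard + 1 := by
    refine le_antisymm ?_ ?_
    · rw [← hLcard]
      exact Nat.sInf_le ⟨_, hLleaf, rfl⟩
    · obtain ⟨B, hB, hs⟩ := Nat.sInf_mem
        (s := {s | ∃ B : H.Subgraph, IsLeafBlock H B ∧ s = B.verts.ncard}) ⟨_, _, hLleaf, rfl⟩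
      exact (hlow B hB).trans_eq hs.symm
  refine ⟨L, c, x, hcL, Or.inl hxD, fun h => hcD (h ▸ hxD), by rw [hLcard, hslb], ?_, ?_⟩
  · rintro a (ha | ha) hac b hab
    · exact hLclosed a ha b hab
    · exact absurd ha hac
  · intro v D' h
    rw [hslb]
    exact Nat.add_le_add_right (hmin v D' h) 1

end LeafBlocks

/-! ### Pendant pieces are irrelevant for robust graphs -/

section Pendants

variable {V W T E Λ : Type*}

/-- Robustness in terms of vertex sets: there are at least `s` vertices, and `K - v` has no
component with fewer than `s - 1` vertices, for all `v`. -/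
def SetRobust (s : ℕ) (K : SimpleGraph V) : Prop :=
  s ≤ Nat.card V ∧ ∀ v D, IsSeparatedBy K v D → s ≤ D.ncard + 1

/-- The function `piece` labels the vertices of the pendant pieces of `G`, the remaining vertices
being mapped to `none`: each piece has at most `s - 2` vertices and at most one neighbour
outside, and different pieces are not adjacent. -/
structure IsPendantLabelling (s : ℕ) (G : SimpleGraph W) (piece : W → Option E) : Prop where
  small : ∀ e, {w | piece w = some e}.ncard + 2 ≤ s
  attach : ∀ e, {w | piece w ≠ some e ∧ ∃ u, piece u = some e ∧ G.Adj u w}.Subsingleton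
  eq_of_adj : ∀ e f u w, piece u = some e → piece w = some f → G.Adj u w → e = f

variable {s : ℕ} {G : SimpleGraph W} {piece : W → Option E}

/-- In a model of a robust graph no branch set lies inside the pendant pieces: the branch sets
inside a piece would belong to vertices that form a small union of components of `K - y`, where `y`
is the vertex whose branch set contains the attachment vertex of the piece. -/
theorem IsPendantLabelling.exists_mem_core [Finite V] [Finite W]
    (hp : IsPendantLabelling s G piece)
    {K : SimpleGraph V} (hK : SetRobust s K) {φ : V → Set W} (hne : ∀ v, (φ v).Nonempty)
    (hconn : ∀ v, SetPreconn G (φ v))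
    (hadj : ∀ u v, K.Adj u v → ∃ u' ∈ φ u, ∃ v' ∈ φ v, G.Adj u' v')
    (hdisj : ∀ u v, u ≠ v → Disjoint (φ u) (φ v)) (v : V) :
    ∃ w ∈ φ v, piece w = none := by
  by_contra hno
  push Not at hno
  obtain ⟨u₀, hu₀⟩ := hne v
  obtain ⟨e, he⟩ := Option.ne_none_iff_exists'.1 (hno u₀ hu₀)
  set D := {w | piece w = some e} with hD
  have hvD : φ v ⊆ D := by
    refine (hconn v).subset_of_closed hu₀ he fun x _ y hy hxy hx => ?_
    obtain ⟨f, hf⟩ := Option.ne_none_iff_exists'.1 (hno y hy)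
    rw [hD, Set.mem_ofPred_eq, hf, hp.eq_of_adj e f x y hx hf hxy]
  have hcard : ∀ C : Set V, (∀ u ∈ C, φ u ⊆ D) → C.ncard ≤ D.ncard := by
    intro C hC
    choose f hf using hne
    refine Set.ncard_le_ncard_of_injOn f (fun u hu => hC u hu (hf u)) ?_ (Set.toFinite _)
    intro a _ b _ hab
    by_contra hne
    exact Set.disjoint_left.1 (hdisj a b hne) (hf a) (hab ▸ hf b)
  have hsmall : D.ncard + 2 ≤ s := hp.small e
  obtain ⟨y, hy, hyatt⟩ : ∃ y, ¬ φ y ⊆ D ∧ ∀ u, ∀ w ∈ φ u, w ∉ D →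
      (∃ z, piece z = some e ∧ G.Adj z w) → u = y := by
    by_cases hatt : ∃ u, ∃ w ∈ φ u, w ∉ D ∧ ∃ z, piece z = some e ∧ G.Adj z w
    · obtain ⟨y, w, hw, hwD, hz⟩ := hatt
      refine ⟨y, fun h => hwD (h hw), fun u w' hw' hw'D hz' => ?_⟩
      by_contra hne
      have : w' = w := hp.attach e ⟨hw'D, hz'⟩ ⟨hwD, hz⟩
      exact Set.disjoint_left.1 (hdisj u y hne) hw' (this ▸ hw)
    · push Not at hatt
      by_contra hall
      have : ∀ y, φ y ⊆ D := by
        intro y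
        by_contra hy
        refine hall ⟨y, hy, fun u w hw hwD hz => ?_⟩
        obtain ⟨z, hz, hzw⟩ := hz
        exact absurd hzw (hatt u w hw hwD z hz)
      have h1 := hcard Set.univ fun u _ => this u
      rw [Set.ncard_univ] at h1
      have := hK.1
      omega
  have hsep : IsSeparatedBy K y {u | φ u ⊆ D} := by
    refine ⟨⟨v, hvD⟩, hy, fun a ha b hab => ?_⟩
    by_cases hby : b = y
    · exact Or.inl hby
    · right
      obtain ⟨a', ha', b', hb', hab'⟩ := hadj a b hab
      have hb'D : b' ∈ D := by
        by_contra h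
        exact hby (hyatt b b' hb' h ⟨a', ha ha', hab'⟩)
      refine (hconn b).subset_of_closed hb' hb'D fun p _ q hq hpq hp => ?_
      by_contra h
      exact hby (hyatt b q hq h ⟨p, hp, hpq⟩)
  have h1 := hK.2 y _ hsep
  have h2 := hcard {u | φ u ⊆ D} fun u hu => hu
  omega

/-- Pendant pieces can be cut off from a model of a robust graph: a branch set which enters a
piece contains the vertex to which the piece is attached. -/
theorem IsPendantLabelling.isMinor_core [Finite V] [Finite W]
    (hp : IsPendantLabelling s G piece)
    {K : SimpleGraph V} (hK : SetRobust s K) (h : IsMinor K G) :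
    IsMinor K (G.induce {w | piece w = none}) := by
  classical
  obtain ⟨φ, hne, hconn, hadj, hdisj⟩ := isMinor_iff.1 h
  have hcore := hp.exists_mem_core hK hne hconn hadj hdisj
  let Att : E → W → Prop := fun e w => piece w ≠ some e ∧ ∃ u, piece u = some e ∧ G.Adj u w
  have hattcore : ∀ e w, Att e w → piece w = none := by
    rintro e w ⟨hw, u, hu, huw⟩
    by_contra hne
    obtain ⟨f, hf⟩ := Option.ne_none_iff_exists'.1 hne
    exact hw (by rw [hf, hp.eq_of_adj e f u w hu hf huw])
  have hatt : ∀ v, ∀ u ∈ φ v, ∀ e, piece u = some e → ∃ y ∈ φ v, Att e y := by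
    intro v u hu e he
    by_contra hno
    push Not at hno
    obtain ⟨w, hw, hwn⟩ := hcore v
    have : w ∈ {w | piece w = some e} := by
      refine (hconn v).subset_of_closed (D := {w | piece w = some e}) hu he ?_ hw
      intro x _ y hy hxy hx
      by_contra h
      exact hno y hy ⟨h, x, hx, hxy⟩
    rw [Set.mem_ofPred_eq, hwn] at this
    cases this
  -- `r` retracts each piece to its attachment vertex, so it maps the branch sets into the core
  let r : W → W := fun w => match piece w with
    | none => w
    | some e => if h : ∃ y, Att e y then h.choose else w
  have hr0 : ∀ w, piece w = none → r w = w := fun w hw => by simp only [r, hw]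
  have hr1 : ∀ w e y, piece w = some e → Att e y → r w = y := fun w e y hw hy => by
    have hex : ∃ y, Att e y := ⟨y, hy⟩
    simp only [r, hw, dif_pos hex]
    exact hp.attach e hex.choose_spec hy
  have himg : ∀ v, r '' φ v = {w ∈ φ v | piece w = none} := by
    intro v
    ext w
    constructor
    · rintro ⟨u, hu, rfl⟩
      cases hpu : piece u with
      | none => rw [hr0 u hpu]; exact ⟨hu, hpu⟩
      | some e =>
        obtain ⟨y, hy, hatty⟩ := hatt v u hu e hpu
        rw [hr1 u e y hpu hatty]
        exact ⟨hy, hattcore e y hatty⟩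
    · rintro ⟨hw, hwn⟩
      exact ⟨w, hw, hr0 w hwn⟩
  have hconn' : ∀ v, SetPreconn G {w ∈ φ v | piece w = none} := by
    intro v
    rw [← himg v]
    refine (hconn v).image fun w hw w' hw' hww' => ?_
    cases hpw : piece w with
    | none =>
      cases hpw' : piece w' with
      | none => right; rwa [hr0 w hpw, hr0 w' hpw']
      | some e =>
        left
        rw [hr0 w hpw, hr1 w' e w hpw' ⟨by simp [hpw], w', hpw', hww'.symm⟩]
    | some e =>
      left
      by_cases hpw' : piece w' = some e
      · obtain ⟨y, _, hatty⟩ := hatt v w hw e hpw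
        rw [hr1 w e y hpw hatty, hr1 w' e y hpw' hatty]
      · have hatt' : Att e w' := ⟨hpw', w, hpw, hww'⟩
        rw [hr1 w e w' hpw hatt', hr0 w' (hattcore e w' hatt')]
  have hedge : ∀ u v, u ≠ v → ∀ u' ∈ φ u, ∀ v' ∈ φ v, G.Adj u' v' → piece u' = none := by
    intro u v huv u' hu' v' hv' hadj'
    by_contra hne
    obtain ⟨e, he⟩ := Option.ne_none_iff_exists'.1 hne
    obtain ⟨y, hy, hatty⟩ := hatt u u' hu' e he
    have : y ∈ φ v := by
      by_cases hv'e : piece v' = some e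
      · obtain ⟨z, hz, hattz⟩ := hatt v v' hv' e hv'e
        rwa [hp.attach e hatty hattz]
      · rwa [hp.attach e hatty ⟨hv'e, u', he, hadj'⟩]
    exact Set.disjoint_left.1 (hdisj u v huv) hy this
  have key := isMinor_of_model_injOn (H := K) (G := G) (K := G)
    (φ := fun v => {w ∈ φ v | piece w = none})
    hcore hconn' (fun u v huv => by
      obtain ⟨a, ha, b, hb, hab⟩ := hadj u v huv
      exact ⟨a, ⟨ha, hedge u v huv.ne a ha b hb hab⟩, b,
        ⟨hb, hedge v u huv.ne' b hb a ha hab.symm⟩, hab⟩)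
    (fun u v huv => (hdisj u v huv).mono (fun _ h => h.1) fun _ h => h.1)
    id Function.injective_id.injOn (fun _ _ _ _ h => h) (Z := {w | piece w = none})
    (fun x hx => by
      obtain ⟨v, hv⟩ := Set.mem_iUnion.1 hx
      exact hv.2)
  exact key

/-- Robust subgraphs avoid pendant pieces: the part of a robust subgraph in a piece would be
separated from the rest by the attachment vertex. -/
theorem IsPendantLabelling.prune_verts [Finite W] (hp : IsPendantLabelling s G piece) :
    ∀ w ∈ (prune s G).verts, piece w = none := by
  intro w hw
  simp only [prune, SimpleGraph.Subgraph.verts_sSup, Set.mem_iUnion] at hw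
  obtain ⟨P, hP, hw⟩ := hw
  by_contra hne
  obtain ⟨e, he⟩ := Option.ne_none_iff_exists'.1 hne
  set D := {w | piece w = some e} with hD
  have hsmall : D.ncard + 2 ≤ s := hp.small e
  obtain ⟨v, hv, hvD, hvatt⟩ : ∃ v ∈ P.verts, v ∉ D ∧ ∀ y ∈ P.verts, y ∉ D →
      (∃ z, piece z = some e ∧ G.Adj z y) → y = v := by
    by_cases hatt : ∃ y ∈ P.verts, y ∉ D ∧ ∃ z, piece z = some e ∧ G.Adj z y
    · obtain ⟨v, hv, hvD, hz⟩ := hatt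
      exact ⟨v, hv, hvD, fun y _ hyD hz' => hp.attach e ⟨hyD, hz'⟩ ⟨hvD, hz⟩⟩
    · push Not at hatt
      by_contra hall
      have hsub : P.verts ⊆ D := by
        intro y hy
        by_contra hyD
        refine hall ⟨y, hy, hyD, fun y hy hyD hz => ?_⟩
        obtain ⟨z, hz, hzy⟩ := hz
        exact absurd hzy (hatt y hy hyD z hz)
      have h1 := Set.ncard_le_ncard hsub (Set.toFinite _)
      have h2 := hP.1
      rw [Nat.card_coe_set_eq] at h2
      omega
  have hwv : (⟨w, hw⟩ : P.verts) ∈ ({⟨v, hv⟩}ᶜ : Set P.verts) := by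
    intro h
    have hwv : w = v := congrArg Subtype.val h
    exact hvD (hwv ▸ he)
  set C := (deleteVerts P.coe {⟨v, hv⟩}).connectedComponentMk ⟨⟨w, hw⟩, hwv⟩ with hC
  have h1 := hP.2 ⟨v, hv⟩ C
  have h2 : ∀ z : ({⟨v, hv⟩}ᶜ : Set P.verts), z ∈ C.supp → (z.1.1 : W) ∈ D := by
    rintro ⟨z, hz⟩ hzC
    have hr := (SimpleGraph.ConnectedComponent.eq.1 hzC).symm
    rw [reachable_induce_iff] at hr
    refine hr.induct (P := fun z => (z.1 : W) ∈ D) he ?_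
    intro x _ y hy hxy hx
    by_contra hyD
    exact hy (Subtype.ext (hvatt y y.2 hyD ⟨x, hx, P.adj_sub hxy⟩))
  have h3 := Set.ncard_le_ncard_of_injOn (s := C.supp) (t := D) (fun z => (z.1.1 : W)) h2
      (fun a _ b _ hab => Subtype.ext (Subtype.ext hab)) (Set.toFinite _)
  omega

/-- The core, i.e. the graph without its pendant pieces, is a disjoint union of graphs which `π`
embeds into `M`; a connected minor of the core is a minor of one of them. -/
theorem exists_label_of_isMinor_core {K : SimpleGraph V} (hK : K.Connected) {C : Set W}
    (h : IsMinor K (G.induce C)) (M : SimpleGraph T) (lab : W → Λ) (π : W → T)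
    (hadj : ∀ u ∈ C, ∀ v ∈ C, G.Adj u v → lab u = lab v ∧ M.Adj (π u) (π v))
    (hinj : ∀ l, Set.InjOn π {u ∈ C | lab u = l}) :
    ∃ u ∈ C, IsMinor K (M.induce (π '' {v ∈ C | lab v = lab u})) := by
  obtain ⟨φ, hne, hconn, hadj', hdisj⟩ := isMinor_iff.1 h
  have hU := setPreconn_iUnion_model hK.preconnected hconn hadj'
  obtain ⟨v₀⟩ := hK.nonempty
  obtain ⟨w₀, hw₀⟩ := hne v₀
  have hlab : ∀ x ∈ ⋃ v, φ v, lab x = lab w₀ := fun x hx =>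
    hU.induct (P := fun x => lab x = lab w₀) (Set.mem_iUnion_of_mem v₀ hw₀) hx rfl
      fun x _ y _ hxy hx => (hadj x x.2 y y.2 hxy).1.symm.trans hx
  refine ⟨w₀, w₀.2, isMinor_of_model_injOn hne hconn hadj' hdisj (fun x => π x) ?_
    (fun x _ y _ hxy => (hadj x x.2 y y.2 hxy).2) fun x hx => ⟨x, ⟨x.2, hlab x hx⟩, rfl⟩⟩
  intro x hx y hy hxy
  exact Subtype.ext (hinj _ ⟨x.2, hlab x hx⟩ ⟨y.2, hlab y hy⟩ hxy)

end Pendants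

/-! ### The gadgets -/

section Construction

/-- The symbols of a formula written as a word: every variable of the formula, the beginning of
a clause, and a literal given by its variable and its sign. -/
inductive Sym where
  | var
  | start
  | lit (i : ℕ) (s : Bool)

/-- The vertices of the constructed graph: `(b, ν, ρ, a)` is the vertex with label `a` of the
part with role `ρ` in the `ν`-th copy of the gadget for the `b`-th symbol. -/
abbrev Vtx (T : Type*) := ℕ × ℕ × ℕ × T

/-- The graph-theoretic data of the reduction. The graph `M` has a part `H = M[A]` with a
leaf-block on the vertex set `L`, attached at `c`, and another part `M[Y]`; `x` is a vertex of
`L - c`, and `y₀`, `y₁`, `y₂` are distinct vertices of `H`. There are `N` copies of each gadget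
and `q` copies of `M[Y]` per symbol. -/
structure Template (T : Type*) where
  M : SimpleGraph T
  A : Set T
  Y : Set T
  L : Set T
  c : T
  x : T
  y₀ : T
  y₁ : T
  y₂ : T
  N : ℕ
  q : ℕ
  L_sub : L ⊆ A
  c_mem : c ∈ L
  x_mem : x ∈ L
  x_ne : x ≠ c
  y₀_mem : y₀ ∈ A
  y₁_mem : y₁ ∈ A
  y₂_mem : y₂ ∈ A
  y₀₁ : y₀ ≠ y₁
  y₀₂ : y₀ ≠ y₂
  y₁₂ : y₁ ≠ y₂
  sep : ∀ a ∈ L, a ≠ c → ∀ b ∈ A, M.Adj a b → b ∈ L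

variable {T : Type*} (τ : Template T)

namespace Template

/-- The roles `0`, `2`, `4` are hubs (copies of `H - (L - c)`), the role `3` is a fork (a copy of
`H`). A wire with role `ρ ≠ 3` is a copy of `H` that consists of the hub `hubOf ρ` and a copy of
`L` leading from the centre of the hub to a target vertex. -/
def hubOf : ℕ → ℕ
  | 0 => 0
  | 1 => 0
  | 2 => 2
  | 3 => 3
  | _ => 4

/-- The targets of the wires in the `b`-th gadget, if its symbol is the literal with variable `i`
and sign `s`. The hub `0` has wires to the vertex `y₀` of the fork before it and to the centre of
the hub `2`, which has a wire to the vertex `y₂` of the fork of the literal. The hub `4` has wires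
to the vertex `y₁` of this fork and to the vertex of the fork of the variable that represents the
literal. The last argument is the role of the wire; the role `4` is the default case. -/
def tgt (b i : ℕ) (s : Bool) (ν : ℕ) : ℕ → Vtx T
  | 0 => (b - 1, ν, 3, τ.y₀)
  | 1 => (b, ν, 2, τ.c)
  | 2 => (b, ν, 3, τ.y₂)
  | 5 => (i, ν, 3, if s then τ.y₀ else τ.y₁)
  | _ => (b, ν, 3, τ.y₁)

open Classical in
/-- The embedding of `H` as a wire; the vertices of `L - c - x` get the role of the wire. -/
noncomputable def wire (b ν ρ : ℕ) (t : Vtx T) (a : T) : Vtx T :=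
  if a = τ.x then t else if a ∈ τ.L ∧ a ≠ τ.c then (b, ν, ρ, a) else (b, ν, hubOf ρ, a)

/-- The adjacency relation of the constructed graph. -/
inductive EdgeRel (w : List Sym) : Vtx T → Vtx T → Prop
  | fork {b ν : ℕ} {a a' : T} : b < w.length → ν < τ.N → a ∈ τ.A → a' ∈ τ.A → τ.M.Adj a a' →
      EdgeRel w (b, ν, 3, a) (b, ν, 3, a')
  | wire {b i : ℕ} {s : Bool} {ν ρ : ℕ} {a a' : T} : w[b]? = some (Sym.lit i s) → ν < τ.N →
      ρ ∈ ({0, 1, 2, 4, 5} : Finset ℕ) → a ∈ τ.A → a' ∈ τ.A → τ.M.Adj a a' →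
      EdgeRel w (τ.wire b ν ρ (τ.tgt b i s ν ρ) a) (τ.wire b ν ρ (τ.tgt b i s ν ρ) a')
  | extra {b j : ℕ} {a a' : T} : b < w.length → j < τ.q → a ∈ τ.Y → a' ∈ τ.Y → τ.M.Adj a a' →
      EdgeRel w (b, τ.N, j, a) (b, τ.N, j, a')

theorem wire_x (b ν ρ : ℕ) (t : Vtx T) : τ.wire b ν ρ t τ.x = t := by simp [wire]

theorem wire_c (b ν ρ : ℕ) (t : Vtx T) : τ.wire b ν ρ t τ.c = (b, ν, hubOf ρ, τ.c) := by
  simp [wire, τ.x_ne.symm]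

theorem wire_leaf {b ν ρ : ℕ} {t : Vtx T} {a : T} (hx : a ≠ τ.x) (ha : a ∈ τ.L) (hc : a ≠ τ.c) :
    τ.wire b ν ρ t a = (b, ν, ρ, a) := by simp [wire, hx, ha, hc]

theorem wire_hub {b ν ρ : ℕ} {t : Vtx T} {a : T} (h : a ∉ τ.L ∨ a = τ.c) :
    τ.wire b ν ρ t a = (b, ν, hubOf ρ, a) := by
  have hx : a ≠ τ.x := by
    rintro rfl
    rcases h with h | h
    · exact h τ.x_mem
    · exact τ.x_ne h
  rcases h with h | h
  · simp [wire, hx, h]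
  · subst h
    exact τ.wire_c b ν ρ t

theorem tgt_role {b i ν ρ : ℕ} {s : Bool} (hρ : ρ ∈ ({0, 1, 2, 4, 5} : Finset ℕ)) :
    (τ.tgt b i s ν ρ).2.2.1 = 3 ∨ (ρ = 1 ∧ τ.tgt b i s ν ρ = (b, ν, 2, τ.c)) := by
  fin_cases hρ <;> simp [tgt]

theorem EdgeRel.symm {w : List Sym} {p q : Vtx T} (h : τ.EdgeRel w p q) : τ.EdgeRel w q p := by
  cases h with
  | fork h1 h2 h3 h4 h5 => exact .fork h1 h2 h4 h3 h5.symm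
  | wire h1 h2 h3 h4 h5 h6 => exact .wire h1 h2 h3 h5 h4 h6.symm
  | extra h1 h2 h3 h4 h5 => exact .extra h1 h2 h4 h3 h5.symm

/-- Literals are preceded by another symbol of their clause, and refer to a variable symbol. -/
def WellFormed (w : List Sym) : Prop :=
  ∀ b i s, w[b]? = some (Sym.lit i s) → w[i]? = some Sym.var ∧
    ∃ b', b = b' + 1 ∧ (w[b']? = some Sym.start ∨ ∃ i' s', w[b']? = some (Sym.lit i' s'))

/-- `X` meets every wire in its hub centre or its target, and meets every fork. -/
structure Hits (w : List Sym) (X : Set (Vtx T)) : Prop where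
  wire : ∀ b i s, w[b]? = some (Sym.lit i s) → ∀ ν < τ.N, ∀ ρ ∈ ({0, 1, 2, 4, 5} : Finset ℕ),
    (b, ν, hubOf ρ, τ.c) ∈ X ∨ τ.tgt b i s ν ρ ∈ X
  fork : ∀ b < w.length, ∀ ν < τ.N, ∃ a ∈ τ.A, (b, ν, 3, a) ∈ X

open Classical in
/-- The vertices of `L - c - x` of each wire form a piece. -/
noncomputable def piece : Vtx T → Option (ℕ × ℕ × ℕ)
  | (b, ν, ρ, a) =>
    if ν < τ.N ∧ ρ ≠ 3 ∧ a ∈ τ.L ∧ a ≠ τ.c ∧ a ≠ τ.x then some (b, ν, ρ) else none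

theorem piece_eq_some {b ν ρ b' ν' ρ' : ℕ} {a : T} :
    τ.piece (b, ν, ρ, a) = some (b', ν', ρ') ↔
      (ν < τ.N ∧ ρ ≠ 3 ∧ a ∈ τ.L ∧ a ≠ τ.c ∧ a ≠ τ.x) ∧ b = b' ∧ ν = ν' ∧ ρ = ρ' := by
  simp only [piece]
  split_ifs with h <;> simp [h]

theorem piece_eq_none {b ν ρ : ℕ} {a : T} :
    τ.piece (b, ν, ρ, a) = none ↔ ¬ (ν < τ.N ∧ ρ ≠ 3 ∧ a ∈ τ.L ∧ a ≠ τ.c ∧ a ≠ τ.x) := by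
  simp only [piece]
  split_ifs with h <;> simp [h]

theorem piece_tgt {b i ν ρ : ℕ} {s : Bool} (hρ : ρ ∈ ({0, 1, 2, 4, 5} : Finset ℕ)) :
    τ.piece (τ.tgt b i s ν ρ) = none := by
  fin_cases hρ <;> simp [tgt, piece]

/-- The neighbours of a piece. -/
theorem EdgeRel.of_piece {w : List Sym} {p r : Vtx T} (h : τ.EdgeRel w p r) {b ν ρ : ℕ}
    (hp : τ.piece p = some (b, ν, ρ)) :
    ∃ i s, w[b]? = some (Sym.lit i s) ∧ ν < τ.N ∧ ρ ∈ ({0, 1, 2, 4, 5} : Finset ℕ) ∧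
      (τ.piece r = some (b, ν, ρ) ∨ r = (b, ν, hubOf ρ, τ.c) ∨ r = τ.tgt b i s ν ρ) := by
  cases h with
  | fork h1 h2 h3 h4 h5 => simp [piece_eq_some] at hp
  | extra h1 h2 h3 h4 h5 => simp [piece_eq_some] at hp
  | @wire b' i s ν' ρ' a a' h1 h2 h3 h4 h5 h6 =>
    have ha : a ≠ τ.x := by
      rintro rfl
      rw [wire_x, τ.piece_tgt h3] at hp
      cases hp
    by_cases hl : a ∈ τ.L ∧ a ≠ τ.c
    swap
    · have hl' : a ∉ τ.L ∨ a = τ.c := by tauto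
      rw [τ.wire_hub hl', piece_eq_some] at hp
      tauto
    rw [τ.wire_leaf ha hl.1 hl.2, piece_eq_some] at hp
    obtain ⟨⟨hν, hρ3, -⟩, rfl, rfl, rfl⟩ := hp
    refine ⟨i, s, h1, h2, h3, ?_⟩
    have ha' := τ.sep a hl.1 hl.2 a' h5 h6
    by_cases hx : a' = τ.x
    · right; right; rw [hx, wire_x]
    · by_cases hc : a' = τ.c
      · right; left; rw [hc, wire_c]
      · left
        rw [τ.wire_leaf hx ha' hc, piece_eq_some]
        exact ⟨⟨hν, hρ3, ha', hc, hx⟩, rfl, rfl, rfl⟩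

/-- The labels that occur in the core part with the roles `ν`, `ρ`. -/
def good (ν ρ : ℕ) : Set T :=
  {a | (ν < τ.N ∧ ρ = 3 ∧ a ∈ τ.A) ∨ (ν < τ.N ∧ ρ ≠ 3 ∧ a ∈ τ.A ∧ (a ∉ τ.L ∨ a = τ.c)) ∨
    (τ.N ≤ ν ∧ a ∈ τ.Y)}

open Classical in
/-- The part of the core to which a vertex belongs; unused vertices form parts of their own. -/
noncomputable def part : Vtx T → ℕ × ℕ × ℕ × Option T
  | (b, ν, ρ, a) => (b, ν, ρ, if a ∈ τ.good ν ρ then none else some a)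

theorem hubOf_ne_three {ρ : ℕ} (h : ρ ∈ ({0, 1, 2, 4, 5} : Finset ℕ)) : hubOf ρ ≠ 3 := by
  fin_cases h <;> simp [hubOf]

/-- The edges of the core. -/
theorem EdgeRel.core {w : List Sym} {X : Set (Vtx T)} (hX : τ.Hits w X) {p r : Vtx T}
    (h : τ.EdgeRel w p r) (hpX : p ∉ X) (hrX : r ∉ X) (hp : τ.piece p = none)
    (hr : τ.piece r = none) :
    ∃ b ν ρ a a', p = (b, ν, ρ, a) ∧ r = (b, ν, ρ, a') ∧ a ∈ τ.good ν ρ ∧ a' ∈ τ.good ν ρ ∧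
      τ.M.Adj a a' ∧ b < w.length ∧ ν ≤ τ.N ∧ ρ < 6 + τ.q := by
  cases h with
  | @fork b ν a a' h1 h2 h3 h4 h5 =>
    exact ⟨b, ν, 3, a, a', rfl, rfl, Or.inl ⟨h2, rfl, h3⟩, Or.inl ⟨h2, rfl, h4⟩, h5, h1, h2.le,
      by omega⟩
  | @extra b j a a' h1 h2 h3 h4 h5 =>
    exact ⟨b, τ.N, j, a, a', rfl, rfl, Or.inr (Or.inr ⟨le_rfl, h3⟩), Or.inr (Or.inr ⟨le_rfl, h4⟩),
      h5, h1, le_rfl, by omega⟩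
  | @wire b i s ν ρ a a' h1 h2 h3 h4 h5 h6 =>
    have hρ3 : ρ ≠ 3 := by rintro rfl; simp at h3
    -- a vertex of `L - c` of a wire that is in the core is the target, and then the hub is deleted
    have key : ∀ d d', d ∈ τ.A → d' ∈ τ.A → τ.M.Adj d d' →
        τ.wire b ν ρ (τ.tgt b i s ν ρ) d ∉ X → τ.wire b ν ρ (τ.tgt b i s ν ρ) d' ∉ X →
        τ.piece (τ.wire b ν ρ (τ.tgt b i s ν ρ) d) = none →
        τ.piece (τ.wire b ν ρ (τ.tgt b i s ν ρ) d') = none → d ∉ τ.L ∨ d = τ.c := by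
      intro d d' hd hd' hdd' hX1 hX2 hn hn'
      by_contra hcon
      push Not at hcon
      obtain ⟨hdL, hdc⟩ := hcon
      by_cases hdx : d = τ.x
      · subst hdx
        have hd'L := τ.sep _ hdL hdc d' hd' hdd'
        rw [wire_x] at hX1
        have hc := (hX.wire b i s h1 ν h2 ρ h3).resolve_right hX1
        have hd'c : d' ≠ τ.c := by
          rintro rfl
          rw [wire_c] at hX2
          exact hX2 hc
        rw [τ.wire_leaf hdd'.ne' hd'L hd'c, piece_eq_none] at hn'
        exact hn' ⟨h2, hρ3, hd'L, hd'c, hdd'.ne'⟩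
      · rw [τ.wire_leaf hdx hdL hdc, piece_eq_none] at hn
        exact hn ⟨h2, hρ3, hdL, hdc, hdx⟩
    have ha := key a a' h4 h5 h6 hpX hrX hp hr
    have ha' := key a' a h5 h4 h6.symm hrX hpX hr hp
    refine ⟨b, ν, hubOf ρ, a, a', τ.wire_hub ha, τ.wire_hub ha', ?_, ?_, h6,
      (List.getElem?_eq_some_iff.1 h1).1, h2.le, ?_⟩
    · exact Or.inr (Or.inl ⟨h2, hubOf_ne_three h3, h4, ha⟩)
    · exact Or.inr (Or.inl ⟨h2, hubOf_ne_three h3, h5, ha'⟩)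
    · fin_cases h3 <;> simp [hubOf] <;> omega

section Remaining

variable {U : Type*} {w : List Sym} {X : Set (Vtx T)} {G : SimpleGraph U}
  {dec : U → Vtx T}

/-- If `X` hits all wires, then the vertices of `L - c - x` in a wire have at most one neighbour
outside that survives: the centre of the hub or the target. -/
theorem isPendantLabelling [Finite U] [Finite T] (hX : τ.Hits w X) (hdec : Function.Injective dec)
    (hdX : ∀ u, dec u ∉ X) (hG : ∀ u v, G.Adj u v → τ.EdgeRel w (dec u) (dec v)) :
    IsPendantLabelling τ.L.ncard G (fun u => τ.piece (dec u)) where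
  small := by
    rintro ⟨b, ν, ρ⟩
    have h1 : {u | τ.piece (dec u) = some (b, ν, ρ)}.ncard ≤ ((τ.L \ {τ.c}) \ {τ.x}).ncard := by
      refine Set.ncard_le_ncard_of_injOn (fun u => (dec u).2.2.2) ?_ ?_ (Set.toFinite _)
      · intro u hu
        have hu' := τ.piece_eq_some.1 (show τ.piece (_, _, _, _) = _ from hu)
        exact ⟨⟨hu'.1.2.2.1, hu'.1.2.2.2.1⟩, hu'.1.2.2.2.2⟩
      · intro u hu v hv huv
        have hu' := τ.piece_eq_some.1 (show τ.piece (_, _, _, _) = _ from hu)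
        have hv' := τ.piece_eq_some.1 (show τ.piece (_, _, _, _) = _ from hv)
        apply hdec
        refine Prod.ext (hu'.2.1.trans hv'.2.1.symm) (Prod.ext (hu'.2.2.1.trans hv'.2.2.1.symm)
          (Prod.ext (hu'.2.2.2.trans hv'.2.2.2.symm) huv))
    have h2 := Set.ncard_sdiff_singleton_add_one (s := τ.L \ {τ.c}) (a := τ.x)
      ⟨τ.x_mem, τ.x_ne⟩ (Set.toFinite _)
    have h3 := Set.ncard_sdiff_singleton_add_one τ.c_mem (Set.toFinite _)
    omega
  attach := by
    rintro ⟨b, ν, ρ⟩ v ⟨hv, u, hu, huv⟩ v' ⟨hv', u', hu', huv'⟩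
    obtain ⟨i, s, h1, h2, h3, h4⟩ := (hG _ _ huv).of_piece τ hu
    obtain ⟨i', s', h1', -, -, h4'⟩ := (hG _ _ huv').of_piece τ hu'
    rw [h1] at h1'
    cases h1'
    have h4 := h4.resolve_left hv
    have h4' := h4'.resolve_left hv'
    have h5 := hX.wire b i s h1 ν h2 ρ h3
    apply hdec
    rcases h4 with h4 | h4 <;> rcases h4' with h4' | h4'
    · rw [h4, h4']
    · rw [← h4, ← h4'] at h5
      exact (h5.elim (hdX _) (hdX _)).elim
    · rw [← h4, ← h4'] at h5
      exact (h5.elim (hdX _) (hdX _)).elim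
    · rw [h4, h4']
  eq_of_adj := by
    rintro ⟨b, ν, ρ⟩ f u v hu hv huv
    obtain ⟨i, s, h1, h2, h3, h4⟩ := (hG _ _ huv).of_piece τ hu
    rcases h4 with h4 | h4 | h4
    · rw [h4] at hv
      exact Option.some.inj hv
    · rw [h4] at hv
      simp [piece] at hv
    · rw [h4, τ.piece_tgt h3] at hv
      cases hv

/-- Connected minors of the core are minors of `H` minus a vertex, of `M[Y]`, or of a single
unused vertex. -/
theorem isMinor_of_isMinor_core {V : Type*} {K : SimpleGraph V} (hK : K.Connected)
    (hX : τ.Hits w X) (hw : ∀ u, (dec u).1 < w.length)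
    (hdec : Function.Injective dec) (hdX : ∀ u, dec u ∉ X)
    (hG : ∀ u v, G.Adj u v → τ.EdgeRel w (dec u) (dec v))
    (h : IsMinor K (G.induce {u | τ.piece (dec u) = none})) :
    ∃ Z : Set T, IsMinor K (τ.M.induce Z) ∧
      ((∃ z ∈ τ.A, Z ⊆ τ.A \ {z}) ∨ Z ⊆ τ.Y ∨ Z.Subsingleton) := by
  obtain ⟨u, hu, hm⟩ := exists_label_of_isMinor_core hK h τ.M (fun u => τ.part (dec u))
    (fun u => (dec u).2.2.2) (fun u hu v hv huv => by
      obtain ⟨b, ν, ρ, a, a', h1, h2, h3, h4, h5, -⟩ :=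
        (hG u v huv).core τ hX (hdX u) (hdX v) hu hv
      simp only [h1, h2, part, h3, h4, if_true, h5, and_self])
    (fun l u hu v hv huv => by
      have h1 := hu.2.trans hv.2.symm
      simp only [part, Prod.mk.injEq] at h1
      exact hdec (Prod.ext h1.1 (Prod.ext h1.2.1 (Prod.ext h1.2.2.1 huv))))
  generalize hI : (fun u => (dec u).2.2.2) ''
    {v | v ∈ {u | τ.piece (dec u) = none} ∧ τ.part (dec v) = τ.part (dec u)} = I at hm
  refine ⟨I, hm, ?_⟩
  have hub := hw u
  have huX := hdX u
  rcases hd : dec u with ⟨b, ν, ρ, a⟩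
  simp only [hd] at hub
  have himg : ∀ d ∈ I,
      (b, ν, ρ, d) ∉ X ∧ τ.part (b, ν, ρ, d) = τ.part (b, ν, ρ, a) := by
    rw [← hI]
    rintro _ ⟨v, ⟨-, hv⟩, rfl⟩
    rw [hd] at hv
    have h1 := hv
    simp only [part, Prod.mk.injEq] at h1
    have : dec v = (b, ν, ρ, (dec v).2.2.2) :=
      Prod.ext h1.1 (Prod.ext h1.2.1 (Prod.ext h1.2.2.1 rfl))
    exact ⟨by rw [← this]; exact hdX v, by rw [← this]; exact hv⟩
  by_cases ha : a ∈ τ.good ν ρ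
  · have himg' : ∀ d ∈ I,
        (b, ν, ρ, d) ∉ X ∧ d ∈ τ.good ν ρ := by
      intro d hd'
      obtain ⟨h1, h2⟩ := himg d hd'
      refine ⟨h1, ?_⟩
      by_contra hdg
      simp [part, ha, hdg] at h2
    by_cases hν : ν < τ.N
    · left
      by_cases hρ : ρ = 3
      · subst hρ
        obtain ⟨z, hz, hzX⟩ := hX.fork b hub ν hν
        refine ⟨z, hz, fun d hd' => ?_⟩
        obtain ⟨h1, h2⟩ := himg' d hd'
        refine ⟨?_, ?_⟩
        · rcases h2 with h2 | h2 | h2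
          · exact h2.2.2
          · exact h2.2.2.1
          · omega
        · rintro rfl
          exact h1 hzX
      · refine ⟨τ.x, τ.L_sub τ.x_mem, fun d hd' => ?_⟩
        obtain ⟨-, h2⟩ := himg' d hd'
        rcases h2 with h2 | h2 | h2
        · exact absurd h2.2.1 hρ
        · refine ⟨h2.2.2.1, ?_⟩
          rintro rfl
          rcases h2.2.2.2 with h | h
          · exact h τ.x_mem
          · exact τ.x_ne h
        · omega
    · right; left
      intro d hd'
      obtain ⟨-, h2⟩ := himg' d hd'
      rcases h2 with h2 | h2 | h2
      · exact absurd h2.1 hν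
      · exact absurd h2.1 hν
      · exact h2.2
  · right; right
    have : ∀ d ∈ I, d = a := by
      intro d hd'
      obtain ⟨-, h2⟩ := himg d hd'
      simp only [part, ha, if_false, Prod.mk.injEq, true_and] at h2
      split_ifs at h2
      exact Option.some.inj h2
    intro d hd' d' hd''
    rw [this d hd', this d' hd'']

end Remaining

end Template

end Construction

namespace Template

/-! ### Treewidth of the constructed graph -/

section TreewidthBounds

variable {T : Type*} (τ : Template T)

/-- A bound for the treewidth of `G - X` from a way to assemble it along single vertices from
subgraphs of `M`. -/
theorem treewidth_le_of_pieces [Finite T] {U : Type*} [Finite U] {G : SimpleGraph U}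
    {dec : U → Vtx T} (hdec : Function.Injective dec) {w : List Sym}
    (hG : ∀ u v, G.Adj u v → τ.EdgeRel w (dec u) (dec v)) (X : Set (Vtx T))
    {J : Type*} (s : Finset J) (κ : J → T → Vtx T) (hκ : ∀ j, Function.Injective (κ j))
    (D : J → Set T) (rk : J → ℕ) (own : Vtx T → J) (spec : J → T)
    (hown : ∀ j, ∀ a ∈ D j, κ j a ∉ X →
      own (κ j a) = j ∨ (rk (own (κ j a)) < rk j ∧ a = spec j))
    (hE : ∀ p r, τ.EdgeRel w p r → p ∉ X → r ∉ X → ∃ j ∈ s, ∃ a ∈ D j, ∃ a' ∈ D j,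
      p = κ j a ∧ r = κ j a' ∧ τ.M.Adj a a') :
    treewidth (deleteVerts G (dec ⁻¹' X)) ≤ treewidth τ.M := by
  classical
  have hne : Nonempty T := ⟨τ.c⟩
  let B : J → Set U := fun j => {u | dec u ∉ X ∧ ∃ a ∈ D j, dec u = κ j a}
  let π : J → U → T := fun j u => Function.invFun (κ j) (dec u)
  have hπ : ∀ j u a, dec u = κ j a → π j u = a := fun j u a h => by
    simp only [π, h]
    exact Function.leftInverse_invFun (hκ j) a
  have h := partialTreeDecomposition_of_pieces τ.M s B π rk (fun u => own (dec u))
    (fun j u hu v hv huv => by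
      obtain ⟨-, a, ha, hua⟩ := hu
      obtain ⟨-, b, hb, hvb⟩ := hv
      rw [hπ j u a hua, hπ j v b hvb] at huv
      exact hdec (by rw [hua, hvb, huv]))
    (fun j u hu => by
      obtain ⟨huX, a, ha, hua⟩ := hu
      have := hown j a ha (hua ▸ huX)
      rw [← hua] at this
      exact this.imp_right And.left)
    (fun j u hu v hv => by
      obtain ⟨⟨huX, a, ha, hua⟩, hu⟩ := hu
      obtain ⟨⟨hvX, b, hb, hvb⟩, hv⟩ := hv
      have h1 := hown j a ha (hua ▸ huX)
      have h2 := hown j b hb (hvb ▸ hvX)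
      rw [← hua] at h1
      rw [← hvb] at h2
      exact hdec (by rw [hua, hvb, (h1.resolve_left hu).2, (h2.resolve_left hv).2]))
  have hsub : (⋃ j ∈ s, B j) ⊆ (dec ⁻¹' X)ᶜ := by
    intro u hu
    simp only [Set.mem_iUnion] at hu
    obtain ⟨j, -, hu, -⟩ := hu
    exact hu
  refine (h.extend hsub).treewidth_deleteVerts_le fun u hu v hv huv => ?_
  obtain ⟨j, hj, a, ha, a', ha', hua, hva', hadj⟩ := hE _ _ (hG u v huv) hu hv
  refine ⟨j, hj, ⟨hu, a, ha, hua⟩, ⟨hv, a', ha', hva'⟩, ?_⟩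
  rwa [hπ j u a hua, hπ j v a' hva']

theorem wire_injective {b i ν ρ : ℕ} {s : Bool} (hρ : ρ ∈ ({0, 1, 2, 4, 5} : Finset ℕ)) :
    Function.Injective (τ.wire b ν ρ (τ.tgt b i s ν ρ)) := by
  have hρ3 : ρ ≠ 3 := by rintro rfl; simp at hρ
  have h1 : ∀ a, a ≠ τ.x → τ.wire b ν ρ (τ.tgt b i s ν ρ) a ≠ τ.tgt b i s ν ρ := by
    intro a ha h
    have h2 := hubOf_ne_three hρ
    have h3 : (τ.wire b ν ρ (τ.tgt b i s ν ρ) a).2.2.1 = ρ ∨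
        (τ.wire b ν ρ (τ.tgt b i s ν ρ) a).2.2.1 = hubOf ρ := by
      by_cases hl : a ∈ τ.L ∧ a ≠ τ.c
      · simp [wire, ha, hl]
      · simp [wire, ha, hl]
    rw [h] at h3
    rcases τ.tgt_role hρ (b := b) (i := i) (ν := ν) (s := s) with h4 | ⟨h4, h5⟩
    · rw [h4] at h3
      rcases h3 with h3 | h3
      · exact hρ3 h3.symm
      · exact h2 h3.symm
    · rw [h5, h4] at h3
      simp [hubOf] at h3
  have h2 : ∀ a, a ≠ τ.x → (τ.wire b ν ρ (τ.tgt b i s ν ρ) a).2.2.2 = a := by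
    intro a ha
    by_cases hl : a ∈ τ.L ∧ a ≠ τ.c
    · simp [wire, ha, hl]
    · simp [wire, ha, hl]
  intro a a' h
  by_cases ha : a = τ.x
  · by_cases ha' : a' = τ.x
    · rw [ha, ha']
    · rw [ha, wire_x] at h
      exact absurd h.symm (h1 a' ha')
  · by_cases ha' : a' = τ.x
    · rw [ha', wire_x] at h
      exact absurd h (h1 a ha)
    · rw [← h2 a ha, h, h2 a' ha']

open Classical in
/-- The embedding of `H` as a wire with role `ρ` in the gadget of a literal of `w`. -/
noncomputable def wireOf (w : List Sym) (b ν ρ : ℕ) : T → Vtx T :=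
  match w[b]? with
  | some (Sym.lit i s) =>
    if ρ ∈ ({0, 1, 2, 4, 5} : Finset ℕ) then τ.wire b ν ρ (τ.tgt b i s ν ρ)
    else fun a => (b, ν, ρ, a)
  | _ => fun a => (b, ν, ρ, a)

theorem wireOf_eq {w : List Sym} {b i ν ρ : ℕ} {s : Bool} (h : w[b]? = some (Sym.lit i s))
    (hρ : ρ ∈ ({0, 1, 2, 4, 5} : Finset ℕ)) :
    τ.wireOf w b ν ρ = τ.wire b ν ρ (τ.tgt b i s ν ρ) := by
  simp only [wireOf, h, if_pos hρ]

theorem wireOf_injective (w : List Sym) (b ν ρ : ℕ) : Function.Injective (τ.wireOf w b ν ρ) := by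
  have : Function.Injective fun a : T => ((b, ν, ρ, a) : Vtx T) := fun a a' h => by simpa using h
  unfold wireOf
  split
  · split_ifs with h
    · exact τ.wire_injective h
    · exact this
  · exact this

/-- Each edge of `H` lies in `L` or in the rest of `H`. -/
theorem edge_cases {a a' : T} (ha : a ∈ τ.A) (ha' : a' ∈ τ.A) (h : τ.M.Adj a a') :
    ((a ∉ τ.L ∨ a = τ.c) ∧ (a' ∉ τ.L ∨ a' = τ.c)) ∨ (a ∈ τ.L ∧ a' ∈ τ.L) := by
  by_cases h1 : a ∉ τ.L ∨ a = τ.c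
  · by_cases h2 : a' ∉ τ.L ∨ a' = τ.c
    · exact Or.inl ⟨h1, h2⟩
    · push Not at h2
      exact Or.inr ⟨τ.sep a' h2.1 h2.2 a ha h.symm, h2.1⟩
  · push Not at h1
    exact Or.inr ⟨h1.1, τ.sep a h1.1 h1.2 a' ha' h⟩

variable {U : Type*} [Finite T] [Finite U] {w : List Sym} {X : Set (Vtx T)} {G : SimpleGraph U}
  {dec : U → Vtx T}

theorem mem_index {b ν ρ q N l : ℕ} (hb : b < l) (hν : ν ≤ N) (hρ : ρ < 6 + q) :
    (b, ν, ρ) ∈ Finset.range l ×ˢ Finset.range (N + 1) ×ˢ Finset.range (6 + q) := by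
  simp only [Finset.mem_product, Finset.mem_range]
  omega

/-- If `X` hits all wires and forks, then `G - X` arises from disjoint subgraphs of `M` by
attaching copies of subgraphs of `L` at single vertices. -/
theorem treewidth_le_of_hits (hdec : Function.Injective dec)
    (hG : ∀ u v, G.Adj u v → τ.EdgeRel w (dec u) (dec v)) (hX : τ.Hits w X) :
    treewidth (deleteVerts G (dec ⁻¹' X)) ≤ treewidth τ.M := by
  classical
  refine τ.treewidth_le_of_pieces hdec hG X (J := (ℕ × ℕ × ℕ) × Bool)
    ((Finset.range w.length ×ˢ Finset.range (τ.N + 1) ×ˢ Finset.range (6 + τ.q)) ×ˢ Finset.univ)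
    (fun j => if j.2 then τ.wireOf w j.1.1 j.1.2.1 j.1.2.2
      else fun a => (j.1.1, j.1.2.1, j.1.2.2, a))
    (fun j => ?_)
    (fun j => if j.2 then {a | a ∈ τ.L ∧ j.1.2.1 < τ.N ∧ j.1.2.2 ∈ ({0, 1, 2, 4, 5} : Finset ℕ) ∧
      ∃ i s, w[j.1.1]? = some (Sym.lit i s)} else τ.good j.1.2.1 j.1.2.2)
    (fun j => if j.2 then 1 else 0)
    -- the part of a wire in `L` is added after the hubs and forks; it introduces the vertices of
    -- its piece, and shares only the centre of its hub or its target with them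
    (fun p => match τ.piece p with
      | some e => (e, true)
      | none => ((p.1, p.2.1, p.2.2.1), false))
    (fun j => if τ.wireOf w j.1.1 j.1.2.1 j.1.2.2 τ.x ∈ X then τ.c else τ.x) ?_ ?_
  · split_ifs with h
    · exact τ.wireOf_injective w _ _ _
    · exact fun a a' h => by simpa using h
  · rintro ⟨⟨b, ν, ρ⟩, t⟩ a ha haX
    cases t with
    | false =>
      left
      simp only [Bool.false_eq_true, if_false] at ha ⊢
      have : τ.piece (b, ν, ρ, a) = none := by
        rw [piece_eq_none]
        rintro ⟨h1, h2, h3, h4, -⟩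
        rcases ha with h | h | h
        · exact h2 h.2.1
        · exact h.2.2.2.elim (fun h => h h3) h4
        · omega
      rw [this]
    | true =>
      simp only [if_true] at ha haX ⊢
      obtain ⟨haL, hν, hρ, i, s, hlit⟩ := ha
      rw [τ.wireOf_eq hlit hρ] at haX ⊢
      rw [wire_x]
      by_cases hx : a = τ.x
      · right
        rw [hx, wire_x] at haX ⊢
        rw [τ.piece_tgt hρ]
        simp [haX]
      · by_cases hc : a = τ.c
        · right
          rw [hc, wire_c] at haX ⊢
          have h1 := (hX.wire b i s hlit ν hν ρ hρ).resolve_left haX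
          have h2 : τ.piece (b, ν, hubOf ρ, τ.c) = none := by simp [piece]
          rw [h2]
          simp [h1]
        · left
          have h1 : τ.piece (b, ν, ρ, a) = some (b, ν, ρ) :=
            τ.piece_eq_some.2 ⟨⟨hν, by rintro rfl; simp at hρ, haL, hc, hx⟩, rfl, rfl, rfl⟩
          rw [τ.wire_leaf hx haL hc, h1]
  · intro p r h hp hr
    cases h with
    | @fork b ν a a' h1 h2 h3 h4 h5 =>
      refine ⟨((b, ν, 3), false), ?_, a, Or.inl ⟨h2, rfl, h3⟩, a', Or.inl ⟨h2, rfl, h4⟩, rfl, rfl,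
        h5⟩
      exact Finset.mem_product.2 ⟨mem_index h1 h2.le (by omega), Finset.mem_univ _⟩
    | @extra b j a a' h1 h2 h3 h4 h5 =>
      refine ⟨((b, τ.N, j), false), ?_, a, Or.inr (Or.inr ⟨le_rfl, h3⟩), a',
        Or.inr (Or.inr ⟨le_rfl, h4⟩), rfl, rfl, h5⟩
      exact Finset.mem_product.2 ⟨mem_index h1 le_rfl (by omega), Finset.mem_univ _⟩
    | @wire b i s ν ρ a a' h1 h2 h3 h4 h5 h6 =>
      have hb := (List.getElem?_eq_some_iff.1 h1).1
      rcases τ.edge_cases h4 h5 h6 with ⟨ha, ha'⟩ | ⟨ha, ha'⟩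
      · refine ⟨((b, ν, hubOf ρ), false), ?_, a,
          Or.inr (Or.inl ⟨h2, hubOf_ne_three h3, h4, ha⟩), a',
          Or.inr (Or.inl ⟨h2, hubOf_ne_three h3, h5, ha'⟩), τ.wire_hub ha, τ.wire_hub ha', h6⟩
        refine Finset.mem_product.2 ⟨mem_index hb h2.le ?_, Finset.mem_univ _⟩
        fin_cases h3 <;> simp [hubOf] <;> omega
      · refine ⟨((b, ν, ρ), true), ?_, a, ⟨ha, h2, h3, i, s, h1⟩, a', ⟨ha', h2, h3, i, s, h1⟩,
          ?_, ?_, h6⟩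
        · refine Finset.mem_product.2 ⟨mem_index hb h2.le ?_, Finset.mem_univ _⟩
          fin_cases h3 <;> omega
        · simp only [if_true, τ.wireOf_eq h1 h3]
        · simp only [if_true, τ.wireOf_eq h1 h3]

/-- The modulator: the vertices of the variable gadgets that represent literals. -/
def modulator (w : List Sym) : Set (Vtx T) :=
  {p | ∃ i ν a, p = (i, ν, 3, a) ∧ ν < τ.N ∧ w[i]? = some Sym.var ∧ (a = τ.y₀ ∨ a = τ.y₁)}

/-- The `b`-th symbol is a literal. -/
def IsLit (w : List Sym) (b : ℕ) : Prop := ∃ i s, w[b]? = some (Sym.lit i s)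

/-- Without the modulator, the gadgets of a clause form a chain: the copies of `H` are added in
the order of their positions and roles, and each of them shares at most one vertex with the
preceding ones. -/
theorem treewidth_le_of_modulator (hw : WellFormed w) (hdec : Function.Injective dec)
    (hG : ∀ u v, G.Adj u v → τ.EdgeRel w (dec u) (dec v)) :
    treewidth (deleteVerts G (dec ⁻¹' τ.modulator w)) ≤ treewidth τ.M := by
  classical
  refine τ.treewidth_le_of_pieces hdec hG _ (J := ℕ × ℕ × ℕ)
    (Finset.range w.length ×ˢ Finset.range (τ.N + 1) ×ˢ Finset.range (6 + τ.q))
    (fun j => if j.2.2 = 3 ∨ τ.N ≤ j.2.1 then fun a => (j.1, j.2.1, j.2.2, a)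
      else τ.wireOf w j.1 j.2.1 j.2.2)
    (fun j => ?_)
    (fun j => if j.2.2 = 3 ∨ τ.N ≤ j.2.1 then Set.univ
      else {a | j.2.2 ∈ ({0, 1, 2, 4, 5} : Finset ℕ) ∧
        IsLit w j.1 ∧ (hubOf j.2.2 = j.2.2 ∨ a ∈ τ.L)})
    (fun j => 6 * j.1 + j.2.2)
    -- a vertex is introduced by the copy of its own role, except that the centre of the hub `2`
    -- is the target of the wire `1`, and `y₂` is the target of the wire `2`
    (fun p => if p.2.1 < τ.N ∧ p.2.2.1 = 2 ∧ p.2.2.2 = τ.c then (p.1, p.2.1, 1)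
      else if p.2.1 < τ.N ∧ p.2.2.1 = 3 ∧ p.2.2.2 = τ.y₂ ∧ IsLit w p.1
        then (p.1, p.2.1, 2)
      else (p.1, p.2.1, p.2.2.1))
    -- the vertex that a copy shares with the preceding ones
    (fun j => match j.2.2 with
      | 0 => τ.x
      | 1 => τ.c
      | 2 => τ.c
      | 3 => τ.y₂
      | 4 => τ.x
      | _ => τ.c) ?_ ?_
  · split_ifs with h
    · exact fun a a' h => by simpa using h
    · exact τ.wireOf_injective w _ _ _
  · rintro ⟨b, ν, ρ⟩ a ha haX
    by_cases hc : ρ = 3 ∨ τ.N ≤ ν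
    · simp only [if_pos hc] at haX ⊢
      by_cases hν : ν < τ.N
      · have hρ : ρ = 3 := hc.resolve_right (by omega)
        subst hρ
        by_cases hy : a = τ.y₂ ∧ IsLit w b
        · right
          simp [hν, hy]
        · left
          simp only [hν, true_and, if_neg hy]
          simp
      · left
        simp [hν]
    · simp only [if_neg hc] at ha haX ⊢
      push Not at hc
      obtain ⟨hρ, ⟨i, s, hlit⟩, hor⟩ := ha
      rw [τ.wireOf_eq hlit hρ] at haX ⊢
      obtain ⟨hi, b', hb', -⟩ := hw b i s hlit
      have hν := hc.2
      have hex : IsLit w b := ⟨i, s, hlit⟩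
      by_cases hx : a = τ.x
      · rw [hx, wire_x] at haX ⊢
        fin_cases hρ
        · right
          have : b - 1 + 1 = b := by omega
          simp only [tgt, hν, true_and]
          simp [τ.y₀₂]
          omega
        · left; simp [tgt, hν]
        · left
          simp [tgt, hν, hex]
        · right
          simp [tgt, τ.y₁₂]
        · exfalso
          refine haX ⟨i, ν, _, rfl, hν, hi, ?_⟩
          cases s <;> simp
      · by_cases hl : a ∈ τ.L ∧ a ≠ τ.c
        · left
          rw [τ.wire_leaf hx hl.1 hl.2]
          simp [hl.2, hc.1]
        · have hl' : a ∉ τ.L ∨ a = τ.c := by tauto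
          rw [τ.wire_hub hl'] at haX ⊢
          have hc' : hubOf ρ ≠ ρ → a = τ.c := fun h => hl'.resolve_left fun h' =>
            h' (hor.resolve_left h)
          fin_cases hρ
          · left; simp [hubOf]
          · right
            have := hc' (by simp [hubOf])
            simp [hubOf, this]
          · by_cases hac : a = τ.c
            · right; simp [hubOf, hac, hν]
            · left; simp [hubOf, hac]
          · left; simp [hubOf]
          · right
            have := hc' (by simp [hubOf])
            simp [hubOf, this]
  · intro p r h hp hr
    cases h with
    | @fork b ν a a' h1 h2 h3 h4 h5 =>
      refine ⟨(b, ν, 3), mem_index h1 h2.le (by omega), a, ?_, a', ?_, ?_, ?_, h5⟩ <;> simp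
    | @extra b j a a' h1 h2 h3 h4 h5 =>
      refine ⟨(b, τ.N, j), mem_index h1 le_rfl (by omega), a, ?_, a', ?_, ?_, ?_, h5⟩ <;> simp
    | @wire b i s ν ρ a a' h1 h2 h3 h4 h5 h6 =>
      have hb := (List.getElem?_eq_some_iff.1 h1).1
      have hρ3 : ρ ≠ 3 := by rintro rfl; simp at h3
      have hex : IsLit w b := ⟨i, s, h1⟩
      have hρ6 : ρ < 6 ∧ hubOf ρ < 6 := by fin_cases h3 <;> simp [hubOf]
      have hmem : hubOf ρ ∈ ({0, 1, 2, 4, 5} : Finset ℕ) := by fin_cases h3 <;> simp [hubOf]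
      have hhub : hubOf (hubOf ρ) = hubOf ρ := by fin_cases h3 <;> simp [hubOf]
      rcases τ.edge_cases h4 h5 h6 with ⟨ha, ha'⟩ | ⟨ha, ha'⟩
      · have hcond : ¬ (hubOf ρ = 3 ∨ τ.N ≤ ν) := by
          rintro (h | h)
          · exact hubOf_ne_three h3 h
          · omega
        refine ⟨(b, ν, hubOf ρ), mem_index hb h2.le (by omega), a, ?_, a', ?_, ?_, ?_, h6⟩
        · simp only [if_neg hcond]
          exact ⟨hmem, hex, Or.inl hhub⟩
        · simp only [if_neg hcond]
          exact ⟨hmem, hex, Or.inl hhub⟩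
        · simp only [if_neg hcond, τ.wireOf_eq h1 hmem]
          rw [τ.wire_hub ha, τ.wire_hub ha, hhub]
        · simp only [if_neg hcond, τ.wireOf_eq h1 hmem]
          rw [τ.wire_hub ha', τ.wire_hub ha', hhub]
      · have hcond : ¬ (ρ = 3 ∨ τ.N ≤ ν) := by omega
        refine ⟨(b, ν, ρ), mem_index hb h2.le (by omega), a, ?_, a', ?_, ?_, ?_, h6⟩
        · simp only [if_neg hcond]
          exact ⟨h3, hex, Or.inr ha⟩
        · simp only [if_neg hcond]
          exact ⟨h3, hex, Or.inr ha'⟩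
        · simp only [if_neg hcond, τ.wireOf_eq h1 h3]
        · simp only [if_neg hcond, τ.wireOf_eq h1 h3]

end TreewidthBounds

end Template

namespace Template

/-! ### Satisfying assignments and small hitting sets -/

section Hitting

variable {T : Type*} (τ : Template T)

/-- Whether a literal made true by `α` occurs before position `b` in the clause which is open
there. -/
def seen (w : List Sym) (α : ℕ → Bool) : ℕ → Bool
  | 0 => false
  | b + 1 => match w[b]? with
    | some (Sym.lit i s) => seen w α b || (α i == s)
    | _ => false

/-- Every clause of the word contains a literal made true by `α`: a clause does not end before
such a literal has been seen. -/
def WordSat (w : List Sym) (α : ℕ → Bool) : Prop :=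
  ∀ b < w.length, w[b]? ≠ some Sym.var → seen w α (b + 1) = false → IsLit w (b + 1)

/-- The roles of the copies of `H` in the `b`-th gadget that belong to the packing. -/
def packRoles (w : List Sym) (b : ℕ) : Finset ℕ :=
  match w[b]? with
  | some Sym.var => {3}
  | some (Sym.lit _ _) => {0, 2, 4}
  | _ => ∅

/-- The number of copies of `H` in the packing, for each of the `N` copies of the gadgets. -/
def cost (w : List Sym) : ℕ := ∑ b ∈ Finset.range w.length, (packRoles w b).card

/-- The positions and roles of the copies of `H` in the packing. -/
def packIndex (w : List Sym) : Finset (Σ _ : ℕ, ℕ) :=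
  (Finset.range w.length).sigma (packRoles w)

theorem card_packIndex (w : List Sym) : (packIndex w).card = cost w := Finset.card_sigma _ _

theorem mem_packIndex {w : List Sym} {b k : ℕ} : (⟨b, k⟩ : Σ _ : ℕ, ℕ) ∈ packIndex w ↔
    (w[b]? = some Sym.var ∧ k = 3) ∨ (IsLit w b ∧ k ∈ ({0, 2, 4} : Finset ℕ)) := by
  simp only [packIndex, Finset.mem_sigma, Finset.mem_range, packRoles, IsLit]
  constructor
  · rintro ⟨hb, hk⟩
    split at hk
    · left
      rename_i h
      exact ⟨h, Finset.mem_singleton.1 hk⟩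
    · right
      rename_i i s h
      exact ⟨⟨i, s, h⟩, hk⟩
    · simp at hk
  · rintro (⟨h, rfl⟩ | ⟨⟨i, s, h⟩, hk⟩)
    · exact ⟨(List.getElem?_eq_some_iff.1 h).1, by simp [h]⟩
    · exact ⟨(List.getElem?_eq_some_iff.1 h).1, by simpa only [h] using hk⟩

/-- The copies of `H` in the packing. -/
noncomputable def packCopy (w : List Sym) (b ν k : ℕ) : T → Vtx T :=
  if k = 3 then fun a => (b, ν, 3, a) else τ.wireOf w b ν k

open Classical in
/-- The copy of `H` in the packing that contains a given vertex, if there is one. -/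
noncomputable def packOwner (w : List Sym) (p : Vtx T) : ℕ × ℕ × ℕ :=
  if p.2.2.1 = 3 ∧ w[p.1]? ≠ some Sym.var then
    if p.2.2.2 = τ.y₀ then (p.1 + 1, p.2.1, 0)
    else if p.2.2.2 = τ.y₂ then (p.1, p.2.1, 2) else (p.1, p.2.1, 4)
  else (p.1, p.2.1, p.2.2.1)

theorem packCopy_cases {w : List Sym} {b ν k : ℕ} (h : (⟨b, k⟩ : Σ _ : ℕ, ℕ) ∈ packIndex w)
    (a : T) :
    (w[b]? = some Sym.var ∧ k = 3 ∧ τ.packCopy w b ν k a = (b, ν, 3, a)) ∨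
    (IsLit w b ∧ k ∈ ({0, 2, 4} : Finset ℕ) ∧ a ≠ τ.x ∧ τ.packCopy w b ν k a = (b, ν, k, a)) ∨
    (IsLit w b ∧ a = τ.x ∧ k = 0 ∧ τ.packCopy w b ν k a = (b - 1, ν, 3, τ.y₀)) ∨
    (IsLit w b ∧ a = τ.x ∧ k = 2 ∧ τ.packCopy w b ν k a = (b, ν, 3, τ.y₂)) ∨
    (IsLit w b ∧ a = τ.x ∧ k = 4 ∧ τ.packCopy w b ν k a = (b, ν, 3, τ.y₁)) := by
  rcases mem_packIndex.1 h with ⟨h1, rfl⟩ | ⟨h1, h2⟩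
  · left; simp [h1, packCopy]
  · right
    obtain ⟨i, s, hlit⟩ := id h1
    have h3 : k ≠ 3 := by rintro rfl; simp at h2
    have h4 : k ∈ ({0, 1, 2, 4, 5} : Finset ℕ) := by fin_cases h2 <;> simp
    have h5 : hubOf k = k := by fin_cases h2 <;> rfl
    simp only [packCopy, if_neg h3, τ.wireOf_eq hlit h4]
    by_cases hx : a = τ.x
    · right
      rw [hx, wire_x]
      fin_cases h2 <;> simp [tgt, h1]
    · left
      refine ⟨h1, h2, hx, ?_⟩
      by_cases hl : a ∈ τ.L ∧ a ≠ τ.c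
      · rw [τ.wire_leaf hx hl.1 hl.2]
      · rw [τ.wire_hub (by tauto), h5]

theorem packOwner_packCopy {w : List Sym} (hw : WellFormed w) {b ν k : ℕ}
    (h : (⟨b, k⟩ : Σ _ : ℕ, ℕ) ∈ packIndex w) (a : T) :
    τ.packOwner w (τ.packCopy w b ν k a) = (b, ν, k) := by
  have hlit : IsLit w b → w[b]? ≠ some Sym.var ∧ w[b - 1]? ≠ some Sym.var ∧ b - 1 + 1 = b := by
    rintro ⟨i, s, h⟩
    obtain ⟨-, b', rfl, h'⟩ := hw b i s h
    refine ⟨by simp [h], ?_, rfl⟩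
    rcases h' with h' | ⟨i', s', h'⟩ <;> simp [h']
  rcases τ.packCopy_cases (ν := ν) h a with ⟨h1, rfl, h2⟩ | ⟨h1, h2, -, h3⟩ | ⟨h1, -, rfl, h2⟩ |
    ⟨h1, -, rfl, h2⟩ | ⟨h1, -, rfl, h2⟩
  · rw [h2]; simp [packOwner, h1]
  · have h4 : k ≠ 3 := by rintro rfl; simp at h2
    rw [h3]; simp [packOwner, h4]
  · rw [h2]; simp [packOwner, hlit h1]
  · rw [h2]; simp [packOwner, hlit h1, τ.y₀₂.symm]
  · rw [h2]; simp [packOwner, hlit h1, τ.y₀₁.symm, τ.y₁₂]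

theorem packCopy_injective (w : List Sym) (b ν k : ℕ) : Function.Injective (τ.packCopy w b ν k) := by
  unfold packCopy
  split_ifs
  · exact fun a a' h => by simpa using h
  · exact τ.wireOf_injective w _ _ _

/-! ### A small hitting set from a satisfying assignment -/

/-- The vertex of a copy of `H` in the packing that is deleted for the assignment `α`. The fork of
a variable is hit at the literal made true. A wire of a literal is hit at its target or at the
centre of its hub: the fork before the literal is hit at `y₀` if no true literal has been seen,
its own fork at `y₂` if one has been seen before, and at `y₁` if it is the first one. -/
def pick (w : List Sym) (α : ℕ → Bool) (b ν k : ℕ) : Vtx T :=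
  match w[b]? with
  | some (Sym.lit i s) =>
    if k = 0 then if seen w α b then (b, ν, 0, τ.c) else (b - 1, ν, 3, τ.y₀)
    else if k = 2 then if seen w α b then (b, ν, 3, τ.y₂) else (b, ν, 2, τ.c)
    else if !seen w α b && (α i == s) then (b, ν, 3, τ.y₁) else (b, ν, 4, τ.c)
  | _ => (b, ν, 3, if α b then τ.y₀ else τ.y₁)

/-- The set of vertices that are deleted for the assignment `α`. -/
def deletion (w : List Sym) (α : ℕ → Bool) : Set (Vtx T) :=
  (fun e : ℕ × Σ _ : ℕ, ℕ => τ.pick w α e.2.1 e.1 e.2.2) ''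
    ((Finset.range τ.N ×ˢ packIndex w : Finset (ℕ × Σ _ : ℕ, ℕ)) : Set (ℕ × Σ _ : ℕ, ℕ))

theorem deletion_finite (w : List Sym) (α : ℕ → Bool) : (τ.deletion w α).Finite :=
  (Finset.finite_toSet _).image _

theorem ncard_deletion_le (w : List Sym) (α : ℕ → Bool) :
    (τ.deletion w α).ncard ≤ τ.N * cost w := by
  refine (Set.ncard_image_le (Finset.finite_toSet _)).trans ?_
  rw [Set.ncard_coe_finset, Finset.card_product, Finset.card_range, card_packIndex]

theorem pick_mem_deletion {w : List Sym} (α : ℕ → Bool) {b ν k : ℕ} (hν : ν < τ.N)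
    (h : (⟨b, k⟩ : Σ _ : ℕ, ℕ) ∈ packIndex w) : τ.pick w α b ν k ∈ τ.deletion w α :=
  ⟨(ν, ⟨b, k⟩), by simp [hν, h], rfl⟩

/-- If the clauses are satisfied, the wires and forks outside the packing are hit as well. -/
theorem hits_deletion {w : List Sym} (hw : WellFormed w) {α : ℕ → Bool} (h : WordSat w α) :
    τ.Hits w (τ.deletion w α) := by
  have hlit : ∀ b, IsLit w b → ∀ ν < τ.N, ∀ k ∈ ({0, 2, 4} : Finset ℕ),
      τ.pick w α b ν k ∈ τ.deletion w α := fun b hb ν hν k hk =>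
    τ.pick_mem_deletion α hν (mem_packIndex.2 (Or.inr ⟨hb, hk⟩))
  refine ⟨fun b i s hb ν hν ρ hρ => ?_, fun b hb ν hν => ?_⟩
  · have h0 := hlit b ⟨i, s, hb⟩ ν hν 0 (by simp)
    have h2 := hlit b ⟨i, s, hb⟩ ν hν 2 (by simp)
    have h4 := hlit b ⟨i, s, hb⟩ ν hν 4 (by simp)
    simp only [pick, hb] at h0 h2 h4
    fin_cases hρ
    · simp only [hubOf, tgt]
      cases hs : seen w α b
      · right; simpa [hs] using h0
      · left; simpa [hs] using h0
    · simp only [hubOf, tgt]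
      cases hs : seen w α b
      · right; simpa [hs] using h2
      · left; simpa [hs] using h0
    · simp only [hubOf, tgt]
      cases hs : seen w α b
      · left; simpa [hs] using h2
      · right; simpa [hs] using h2
    · simp only [hubOf, tgt]
      cases hs : !seen w α b && (α i == s)
      · left; simpa [hs] using h4
      · right; simpa [hs] using h4
    · simp only [hubOf, tgt]
      cases hs : !seen w α b && (α i == s)
      · left; simpa [hs] using h4
      · right
        have h5 : α i = s := by
          simp only [Bool.and_eq_true, beq_iff_eq] at hs
          exact hs.2
        have hi := (hw b i s hb).1
        have := τ.pick_mem_deletion α hν (mem_packIndex.2 (Or.inl ⟨hi, rfl⟩))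
        simpa only [pick, hi, h5] using this
  · by_cases hvar : w[b]? = some Sym.var
    · have := τ.pick_mem_deletion α hν (mem_packIndex.2 (Or.inl ⟨hvar, rfl⟩))
      simp only [pick, hvar] at this
      refine ⟨_, ?_, this⟩
      split_ifs
      · exact τ.y₀_mem
      · exact τ.y₁_mem
    · cases hs : seen w α (b + 1) with
      | false =>
        have hl := h b hb hvar hs
        have := hlit (b + 1) hl ν hν 0 (by simp)
        obtain ⟨i, s, hl⟩ := hl
        refine ⟨τ.y₀, τ.y₀_mem, ?_⟩
        simpa [pick, hl, hs] using this
      | true =>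
        simp only [seen] at hs
        split at hs
        · rename_i i s hl
          cases hsb : seen w α b with
          | true =>
            refine ⟨τ.y₂, τ.y₂_mem, ?_⟩
            have := hlit b ⟨i, s, hl⟩ ν hν 2 (by simp)
            simpa [pick, hl, hsb] using this
          | false =>
            refine ⟨τ.y₁, τ.y₁_mem, ?_⟩
            have := hlit b ⟨i, s, hl⟩ ν hν 4 (by simp)
            have h5 : α i = s := by simpa [hsb] using hs
            simpa [pick, hl, hsb, h5] using this
        · cases hs

/-! ### A satisfying assignment from a small hitting set -/

/-- `κ` is one of the copies of `H`, a wire or a fork, among the `ν`-th copies of the gadgets. -/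
def IsHCopy (w : List Sym) (ν : ℕ) (κ : T → Vtx T) : Prop :=
  (∃ b < w.length, κ = fun a => (b, ν, 3, a)) ∨
    ∃ b ρ, IsLit w b ∧ ρ ∈ ({0, 1, 2, 4, 5} : Finset ℕ) ∧ κ = τ.wireOf w b ν ρ

theorem IsHCopy.injective {w : List Sym} {ν : ℕ} {κ : T → Vtx T} (h : τ.IsHCopy w ν κ) :
    Function.Injective κ := by
  rcases h with ⟨b, -, rfl⟩ | ⟨b, ρ, -, -, rfl⟩
  · exact fun a a' h => by simpa using h
  · exact τ.wireOf_injective w _ _ _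

theorem IsHCopy.edgeRel {w : List Sym} {ν : ℕ} {κ : T → Vtx T} (h : τ.IsHCopy w ν κ)
    (hν : ν < τ.N) {a a' : T} (ha : a ∈ τ.A) (ha' : a' ∈ τ.A) (haa' : τ.M.Adj a a') :
    τ.EdgeRel w (κ a) (κ a') := by
  rcases h with ⟨b, hb, rfl⟩ | ⟨b, ρ, ⟨i, s, hl⟩, hρ, rfl⟩
  · exact .fork hb hν ha ha' haa'
  · rw [τ.wireOf_eq hl hρ]
    exact .wire hl hν hρ ha ha' haa'

theorem IsHCopy.valid {w : List Sym} (hw : WellFormed w) {ν : ℕ} {κ : T → Vtx T}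
    (h : τ.IsHCopy w ν κ) (a : T) :
    (κ a).1 < w.length ∧ (κ a).2.1 = ν ∧ (κ a).2.2.1 < 6 := by
  rcases h with ⟨b, hb, rfl⟩ | ⟨b, ρ, ⟨i, s, hl⟩, hρ, rfl⟩
  · exact ⟨hb, rfl, by simp⟩
  · rw [τ.wireOf_eq hl hρ]
    have hb := (List.getElem?_eq_some_iff.1 hl).1
    have hi := (List.getElem?_eq_some_iff.1 (hw b i s hl).1).1
    by_cases hx : a = τ.x
    · rw [hx, wire_x]
      fin_cases hρ <;> simp [tgt] <;> omega
    · have : hubOf ρ < 6 ∧ ρ < 6 := by fin_cases hρ <;> simp [hubOf]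
      by_cases hl : a ∈ τ.L ∧ a ≠ τ.c
      · rw [τ.wire_leaf hx hl.1 hl.2]; exact ⟨hb, rfl, this.2⟩
      · rw [τ.wire_hub (by tauto)]; exact ⟨hb, rfl, this.1⟩

theorem isHCopy_packCopy {w : List Sym} {b k : ℕ} (ν : ℕ)
    (h : (⟨b, k⟩ : Σ _ : ℕ, ℕ) ∈ packIndex w) : τ.IsHCopy w ν (τ.packCopy w b ν k) := by
  rcases mem_packIndex.1 h with ⟨h1, rfl⟩ | ⟨h1, h2⟩
  · exact Or.inl ⟨b, (List.getElem?_eq_some_iff.1 h1).1, by simp [packCopy]⟩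
  · refine Or.inr ⟨b, k, h1, by fin_cases h2 <;> simp, ?_⟩
    have h3 : k ≠ 3 := by rintro rfl; simp at h2
    simp [packCopy, h3]

/-- A hitting set whose size is that of the packing hits every copy in the packing exactly once,
and contains no other vertices. The conditions imposed by the remaining copies are propagated
along each clause. -/
theorem wordSat_of_hitting {w : List Sym} (hw : WellFormed w) {ν : ℕ} {X : Set (Vtx T)}
    (hfin : X.Finite) (hcard : {p ∈ X | p.2.1 = ν}.ncard ≤ cost w)
    (hX : ∀ κ, τ.IsHCopy w ν κ → ∃ a ∈ τ.A, κ a ∈ X) : ∃ α, WordSat w α := by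
  classical
  set Xν := {p ∈ X | p.2.1 = ν} with hXν
  have hXνfin : Xν.Finite := hfin.subset fun p hp => hp.1
  have hpick : ∀ e : packIndex w, ∃ a ∈ τ.A, τ.packCopy w e.1.1 ν e.1.2 a ∈ X := fun e =>
    hX _ (τ.isHCopy_packCopy ν e.2)
  choose f hfA hfX using hpick
  let g : packIndex w → Xν := fun e => ⟨_, hfX e, ((τ.isHCopy_packCopy ν e.2).valid τ hw _).2.1⟩
  have hginj : Function.Injective g := by
    intro e e' h
    have h1 : τ.packCopy w e.1.1 ν e.1.2 (f e) = τ.packCopy w e'.1.1 ν e'.1.2 (f e') :=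
      congrArg Subtype.val h
    have h2 := τ.packOwner_packCopy hw (ν := ν) e.2 (f e)
    rw [h1, τ.packOwner_packCopy hw e'.2] at h2
    simp only [Prod.mk.injEq, true_and] at h2
    exact Subtype.ext (Sigma.ext h2.1.symm (heq_of_eq h2.2.symm))
  have hgsurj : Function.Surjective g := by
    have : Finite Xν := hXνfin
    refine ((Nat.bijective_iff_injective_and_card g).2 ⟨hginj, ?_⟩).2
    refine le_antisymm (Nat.card_le_card_of_injective g hginj) ?_
    rw [Nat.card_coe_set_eq]
    refine hcard.trans ?_
    rw [← card_packIndex]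
    simp
  -- every vertex of `X` lies in a copy of the packing, and no copy contains two of them
  have E1 : ∀ p ∈ X, p.2.1 = ν → ∃ b k, (⟨b, k⟩ : Σ _ : ℕ, ℕ) ∈ packIndex w ∧
      ∃ a ∈ τ.A, p = τ.packCopy w b ν k a := by
    intro p hp hpν
    obtain ⟨e, he⟩ := hgsurj ⟨p, hp, hpν⟩
    exact ⟨e.1.1, e.1.2, e.2, f e, hfA e, (congrArg Subtype.val he).symm⟩
  have E2 : ∀ b k, (⟨b, k⟩ : Σ _ : ℕ, ℕ) ∈ packIndex w → ∀ a a', τ.packCopy w b ν k a ∈ X →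
      τ.packCopy w b ν k a' ∈ X → a = a' := by
    have key : ∀ b k (h : (⟨b, k⟩ : Σ _ : ℕ, ℕ) ∈ packIndex w) a, τ.packCopy w b ν k a ∈ X →
        a = f ⟨⟨b, k⟩, h⟩ := by
      intro b k h a ha
      have hv := ((τ.isHCopy_packCopy ν h).valid τ hw a).2.1
      obtain ⟨e, he⟩ := hgsurj ⟨_, ha, hv⟩
      have h1 : τ.packCopy w e.1.1 ν e.1.2 (f e) = τ.packCopy w b ν k a := congrArg Subtype.val he
      have h2 := τ.packOwner_packCopy hw (ν := ν) e.2 (f e)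
      rw [h1, τ.packOwner_packCopy hw h] at h2
      simp only [Prod.mk.injEq, true_and] at h2
      have h3 : e = ⟨⟨b, k⟩, h⟩ := Subtype.ext (Sigma.ext h2.1.symm (heq_of_eq h2.2.symm))
      subst h3
      exact (τ.packCopy_injective w b ν k h1).symm
    intro b k h a a' ha ha'
    rw [key b k h a ha, key b k h a' ha']
  -- the vertices of a fork of a clause that can be deleted
  have hfork : ∀ b a, w[b]? ≠ some Sym.var → (b, ν, 3, a) ∈ X →
      (a = τ.y₀ ∧ IsLit w (b + 1)) ∨ (a = τ.y₂ ∧ IsLit w b) ∨ (a = τ.y₁ ∧ IsLit w b) := by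
    intro b a hb ha
    obtain ⟨b', k, hbk, a', -, heq⟩ := E1 _ ha rfl
    rcases τ.packCopy_cases (ν := ν) hbk a' with ⟨h1, rfl, h2⟩ | ⟨h1, h2, -, h3⟩ |
      ⟨h1, -, rfl, h2⟩ | ⟨h1, -, rfl, h2⟩ | ⟨h1, -, rfl, h2⟩
    · rw [h2] at heq
      simp only [Prod.mk.injEq] at heq
      exact absurd (heq.1 ▸ h1) hb
    · rw [h3] at heq
      simp only [Prod.mk.injEq] at heq
      rw [← heq.2.2.1] at h2
      simp at h2
    · rw [h2] at heq
      simp only [Prod.mk.injEq, true_and] at heq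
      obtain ⟨i, s, h1⟩ := h1
      obtain ⟨-, b'', rfl, -⟩ := hw b' i s h1
      exact Or.inl ⟨heq.2, i, s, by simpa [heq.1] using h1⟩
    · rw [h2] at heq
      simp only [Prod.mk.injEq, true_and] at heq
      exact Or.inr (Or.inl ⟨heq.2, heq.1 ▸ h1⟩)
    · rw [h2] at heq
      simp only [Prod.mk.injEq, true_and] at heq
      exact Or.inr (Or.inr ⟨heq.2, heq.1 ▸ h1⟩)
  -- private vertices of the wires that are not in the packing cannot be deleted
  have hleaf : ∀ b ρ a, ρ = 1 ∨ ρ = 5 → (b, ν, ρ, a) ∉ X := by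
    intro b ρ a hρ ha
    obtain ⟨b', k, hbk, a', -, heq⟩ := E1 _ ha rfl
    rcases τ.packCopy_cases (ν := ν) hbk a' with ⟨h1, rfl, h2⟩ | ⟨h1, h2, -, h3⟩ |
      ⟨h1, -, rfl, h2⟩ | ⟨h1, -, rfl, h2⟩ | ⟨h1, -, rfl, h2⟩
    · rw [h2] at heq; simp only [Prod.mk.injEq] at heq; omega
    · rw [h3] at heq
      simp only [Prod.mk.injEq] at heq
      rw [← heq.2.2.1] at h2
      rcases hρ with rfl | rfl <;> simp at h2
    · rw [h2] at heq; simp only [Prod.mk.injEq] at heq; omega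
    · rw [h2] at heq; simp only [Prod.mk.injEq] at heq; omega
    · rw [h2] at heq; simp only [Prod.mk.injEq] at heq; omega
  -- a wire outside the packing whose target survives is hit in its hub, so the target of the
  -- wire of the packing with the same hub survives
  have hwire : ∀ b i s ρ, w[b]? = some (Sym.lit i s) → ρ = 1 ∨ ρ = 5 →
      τ.tgt b i s ν ρ ∉ X → τ.tgt b i s ν (hubOf ρ) ∉ X := by
    intro b i s ρ hb hρ hX1 hX2
    have hρ' : ρ ∈ ({0, 1, 2, 4, 5} : Finset ℕ) := by rcases hρ with rfl | rfl <;> simp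
    have hk : hubOf ρ ∈ ({0, 2, 4} : Finset ℕ) := by rcases hρ with rfl | rfl <;> simp [hubOf]
    have hk' : hubOf ρ ∈ ({0, 1, 2, 4, 5} : Finset ℕ) := by
      rcases hρ with rfl | rfl <;> simp [hubOf]
    have hh : hubOf (hubOf ρ) = hubOf ρ := by rcases hρ with rfl | rfl <;> simp [hubOf]
    have hidx : (⟨b, hubOf ρ⟩ : Σ _ : ℕ, ℕ) ∈ packIndex w :=
      mem_packIndex.2 (Or.inr ⟨⟨i, s, hb⟩, hk⟩)
    obtain ⟨a, haA, ha⟩ := hX _ (Or.inr ⟨b, ρ, ⟨i, s, hb⟩, hρ', rfl⟩)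
    rw [τ.wireOf_eq hb hρ'] at ha
    have hax : a ≠ τ.x := by
      rintro rfl
      rw [wire_x] at ha
      exact hX1 ha
    have hpc : τ.packCopy w b ν (hubOf ρ) = τ.wire b ν (hubOf ρ) (τ.tgt b i s ν (hubOf ρ)) := by
      rw [packCopy, if_neg (hubOf_ne_three hρ'), τ.wireOf_eq hb hk']
    by_cases hl : a ∈ τ.L ∧ a ≠ τ.c
    · rw [τ.wire_leaf hax hl.1 hl.2] at ha
      exact hleaf _ _ _ hρ ha
    · have hl' : a ∉ τ.L ∨ a = τ.c := by tauto
      rw [τ.wire_hub hl'] at ha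
      refine hax (E2 b (hubOf ρ) hidx a τ.x ?_ ?_)
      · rw [hpc, τ.wire_hub hl', hh]; exact ha
      · rw [hpc, wire_x]; exact hX2
  -- as long as no true literal has been seen, the fork can only be hit at `y₀`, since the wires
  -- prevent the other two possibilities; and `y₀` can be in `X` only if a further literal follows
  set α : ℕ → Bool := fun i => decide ((i, ν, 3, τ.y₀) ∈ X) with hα
  have claim : ∀ b < w.length, w[b]? ≠ some Sym.var → seen w α (b + 1) = false →
      (b, ν, 3, τ.y₀) ∈ X := by
    intro b
    induction b with
    | zero =>
      intro hb hvar _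
      obtain ⟨a, haA, ha⟩ := hX _ (Or.inl ⟨0, hb, rfl⟩)
      have hnl : ¬ IsLit w 0 := by
        rintro ⟨i, s, h⟩
        obtain ⟨-, b', h0, -⟩ := hw 0 i s h
        omega
      rcases hfork 0 a hvar ha with ⟨rfl, -⟩ | ⟨-, h⟩ | ⟨-, h⟩
      · exact ha
      · exact absurd h hnl
      · exact absurd h hnl
    | succ b ih =>
      intro hb hvar hseen
      obtain ⟨a, haA, ha⟩ := hX _ (Or.inl ⟨b + 1, hb, rfl⟩)
      by_cases hl : IsLit w (b + 1)
      swap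
      · rcases hfork (b + 1) a hvar ha with ⟨rfl, -⟩ | ⟨-, h⟩ | ⟨-, h⟩
        · exact ha
        · exact absurd h hl
        · exact absurd h hl
      obtain ⟨i, s, hlit⟩ := id hl
      obtain ⟨hi, b', hb', hprev⟩ := hw (b + 1) i s hlit
      obtain rfl : b = b' := by omega
      have hs : seen w α (b + 1) = false ∧ (α i == s) = false := by
        rw [seen] at hseen
        simpa only [hlit, Bool.or_eq_false_iff] using hseen
      have h0 : (b, ν, 3, τ.y₀) ∈ X := ih (by omega) (by
        rcases hprev with h | ⟨i', s', h⟩ <;> simp [h]) hs.1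
      have h2 : (b + 1, ν, 2, τ.c) ∈ X := by
        by_contra h
        exact hwire (b + 1) i s 1 hlit (Or.inl rfl) h (by simpa [tgt, hubOf] using h0)
      have hR : (b + 1, ν, 3, τ.y₂) ∉ X := by
        intro h
        have hidx : (⟨b + 1, 2⟩ : Σ _ : ℕ, ℕ) ∈ packIndex w :=
          mem_packIndex.2 (Or.inr ⟨hl, by simp⟩)
        have hpc : τ.packCopy w (b + 1) ν 2 = τ.wire (b + 1) ν 2 (τ.tgt (b + 1) i s ν 2) := by
          rw [packCopy, if_neg (by norm_num), τ.wireOf_eq hlit (by simp)]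
        refine τ.x_ne (E2 (b + 1) 2 hidx τ.x τ.c ?_ ?_)
        · rw [hpc, wire_x]; exact h
        · rw [hpc, wire_c]; exact h2
      have hv : τ.tgt (b + 1) i s ν 5 ∉ X := by
        intro h
        have hidx : (⟨i, 3⟩ : Σ _ : ℕ, ℕ) ∈ packIndex w := mem_packIndex.2 (Or.inl ⟨hi, rfl⟩)
        have hs2 := hs.2
        simp only [tgt] at h
        cases s with
        | true =>
          simp only [if_true] at h
          simp [hα, h] at hs2
        | false =>
          simp only [Bool.false_eq_true, if_false] at h
          have h' : (i, ν, 3, τ.y₀) ∈ X := by simpa [hα] using hs2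
          refine τ.y₀₁ (E2 i 3 hidx _ _ ?_ ?_)
          · simpa [packCopy] using h'
          · simpa [packCopy] using h
      have hU : (b + 1, ν, 3, τ.y₁) ∉ X := hwire (b + 1) i s 5 hlit (Or.inr rfl) hv
      rcases hfork (b + 1) a hvar ha with ⟨rfl, -⟩ | ⟨rfl, -⟩ | ⟨rfl, -⟩
      · exact ha
      · exact absurd ha hR
      · exact absurd ha hU
  refine ⟨α, fun b hb hvar hseen => ?_⟩
  rcases hfork b _ hvar (claim b hb hvar hseen) with ⟨-, h⟩ | ⟨h, -⟩ | ⟨h, -⟩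
  · exact h
  · exact absurd h τ.y₀₂
  · exact absurd h τ.y₀₁

end Hitting

end Template

namespace Template

/-! ### Disjoint copies that survive -/

section Packing

variable {T : Type*} (τ : Template T)

theorem packCopy_ne {w : List Sym} (hw : WellFormed w) {ν ν' : ℕ} {e e' : Σ _ : ℕ, ℕ}
    (he : e ∈ packIndex w) (he' : e' ∈ packIndex w) (hne : (ν, e) ≠ (ν', e')) (a a' : T) :
    τ.packCopy w e.1 ν e.2 a ≠ τ.packCopy w e'.1 ν' e'.2 a' := by
  intro h
  have h2 := τ.packOwner_packCopy hw (ν := ν) he a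
  rw [h, τ.packOwner_packCopy hw he'] at h2
  simp only [Prod.mk.injEq] at h2
  exact hne (Prod.ext h2.2.1.symm (Sigma.ext h2.1.symm (heq_of_eq h2.2.2.symm)))

/-- If no assignment satisfies the word, a set of vertices that is not larger than the packing
misses `m` disjoint copies of `H`, provided there are at least `2 m - 1` copies of the gadgets:
either `m` copies `ν` of the gadgets contain few deleted vertices, and each of them has a
surviving copy of `H`, or many copies contain too many deleted vertices, and then at least `m`
members of the packing are missed in the others. -/
theorem exists_disjoint_copies {w : List Sym} (hw : WellFormed w) (hunsat : ∀ α, ¬ WordSat w α)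
    {X : Set (Vtx T)} (hfin : X.Finite) (hcard : X.ncard ≤ τ.N * cost w) {m : ℕ}
    (hN : 2 * m ≤ τ.N + 1) :
    ∃ κ : Fin m → T → Vtx T, (∀ i, ∃ ν < τ.N, τ.IsHCopy w ν (κ i)) ∧
      (∀ i, ∀ a ∈ τ.A, κ i a ∉ X) ∧
      ∀ i j, i ≠ j → ∀ a ∈ τ.A, ∀ a' ∈ τ.A, κ i a ≠ κ j a' := by
  classical
  have : Nonempty T := ⟨τ.c⟩
  set XF := hfin.toFinset with hXF
  have hXcard : XF.card ≤ τ.N * cost w := by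
    rwa [Set.ncard_eq_toFinset_card X hfin] at hcard
  let count : ℕ → ℕ := fun ν => (XF.filter fun p => p.2.1 = ν).card
  have hcount : ∀ ν, {p ∈ X | p.2.1 = ν}.ncard = count ν := by
    intro ν
    change _ = (XF.filter fun p => p.2.1 = ν).card
    rw [← Set.ncard_coe_finset]
    congr 1
    ext p
    simp [hXF]
  set Gd := (Finset.range τ.N).filter fun ν => count ν ≤ cost w with hGd
  set Bd := (Finset.range τ.N).filter fun ν => ¬ count ν ≤ cost w with hBd
  have hGB : Gd.card + Bd.card = τ.N := by
    rw [hGd, hBd, Finset.card_filter_add_card_filter_not, Finset.card_range]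
  by_cases hm : m ≤ Gd.card
  · -- one surviving copy for each `ν`
    have hsurv : ∀ ν ∈ Gd, ∃ κ, τ.IsHCopy w ν κ ∧ ∀ a ∈ τ.A, κ a ∉ X := by
      intro ν hν
      by_contra hno
      push Not at hno
      obtain ⟨α, hα⟩ := τ.wordSat_of_hitting hw (ν := ν) hfin
        (by rw [hcount]; exact (Finset.mem_filter.1 hν).2) hno
      exact hunsat α hα
    choose! κ hκ hκX using hsurv
    obtain ⟨F⟩ : Nonempty (Fin m ↪ Gd) :=
      Function.Embedding.nonempty_of_card_le (by simpa using hm)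
    refine ⟨fun i => κ (F i), fun i => ⟨F i, ?_, hκ _ (F i).2⟩, fun i => hκX _ (F i).2,
      fun i j hij a _ a' _ h => hij (F.injective (Subtype.ext ?_))⟩
    · exact Finset.mem_range.1 (Finset.mem_filter.1 (F i).2).1
    · change κ (F i) a = κ (F j) a' at h
      rw [← ((hκ _ (F i).2).valid τ hw a).2.1, h, ((hκ _ (F j).2).valid τ hw a').2.1]
  · -- many untouched members of the packing
    let miss : ℕ × (Σ _ : ℕ, ℕ) → Prop := fun e => ∀ a ∈ τ.A, τ.packCopy w e.2.1 e.1 e.2.2 a ∉ X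
    set I := Gd ×ˢ packIndex w with hI
    have h1 : (I.filter miss).card + (I.filter fun e => ¬ miss e).card = Gd.card * cost w := by
      rw [Finset.card_filter_add_card_filter_not, hI, Finset.card_product, card_packIndex]
    set XG := XF.filter fun p => p.2.1 ∈ Gd with hXG
    have h2 : (I.filter fun e => ¬ miss e).card ≤ XG.card := by
      have hex : ∀ e ∈ I.filter fun e => ¬ miss e, ∃ a ∈ τ.A,
          τ.packCopy w e.2.1 e.1 e.2.2 a ∈ X := by
        intro e he
        have := (Finset.mem_filter.1 he).2
        simp only [miss] at this
        push Not at this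
        exact this
      choose! f hfA hfX using hex
      refine Finset.card_le_card_of_injOn (fun e => τ.packCopy w e.2.1 e.1 e.2.2 (f e)) ?_ ?_
      · intro e he
        have he' := Finset.mem_product.1 (Finset.mem_filter.1 he).1
        have hv := ((τ.isHCopy_packCopy e.1 he'.2).valid τ hw (f e)).2.1
        refine Finset.mem_coe.2 (Finset.mem_filter.2 ⟨?_, ?_⟩)
        · simpa [hXF] using hfX e he
        · rw [hv]; exact he'.1
      · intro e he e' he' h
        have h3 := Finset.mem_product.1 (Finset.mem_filter.1 he).1
        have h4 := Finset.mem_product.1 (Finset.mem_filter.1 he').1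
        by_contra hne
        exact τ.packCopy_ne hw h3.2 h4.2 hne _ _ h
    have h3 : XG.card + Bd.card * (cost w + 1) ≤ XF.card := by
      have hle : Bd.card * (cost w + 1) ≤ (XF.filter fun p => p.2.1 ∈ Bd).card := by
        rw [Finset.card_eq_sum_card_fiberwise (s := XF.filter fun p => p.2.1 ∈ Bd) (t := Bd)
          (f := fun p => p.2.1) (fun p hp => (Finset.mem_filter.1 hp).2), ← smul_eq_mul]
        refine Finset.card_nsmul_le_sum _ _ _ fun ν hν => ?_
        have : count ν ≥ cost w + 1 := by
          have := (Finset.mem_filter.1 hν).2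
          omega
        refine this.le.trans (Finset.card_le_card fun p hp => ?_)
        have hp' := Finset.mem_filter.1 hp
        exact Finset.mem_filter.2 ⟨Finset.mem_filter.2 ⟨hp'.1, hp'.2 ▸ hν⟩, hp'.2⟩
      have hdisj : Disjoint XG (XF.filter fun p => p.2.1 ∈ Bd) := by
        rw [Finset.disjoint_left]
        intro p hp hp'
        have h5 := (Finset.mem_filter.1 (Finset.mem_filter.1 hp).2).2
        exact (Finset.mem_filter.1 (Finset.mem_filter.1 hp').2).2 h5
      refine (Nat.add_le_add_left hle _).trans ?_
      rw [← Finset.card_union_of_disjoint hdisj]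
      exact Finset.card_le_card (Finset.union_subset (Finset.filter_subset _ _)
        (Finset.filter_subset _ _))
    have h4 : m ≤ (I.filter miss).card := by
      have h5 : τ.N * cost w = Gd.card * cost w + Bd.card * cost w := by rw [← hGB, add_mul]
      have h6 : Bd.card * (cost w + 1) = Bd.card * cost w + Bd.card := by ring
      omega
    obtain ⟨F⟩ : Nonempty (Fin m ↪ (I.filter miss : Finset _)) :=
      Function.Embedding.nonempty_of_card_le (by simpa using h4)
    have hF : ∀ i, (F i).1.1 ∈ Gd ∧ (F i).1.2 ∈ packIndex w := fun i =>
      Finset.mem_product.1 (Finset.mem_filter.1 (F i).2).1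
    refine ⟨fun i => τ.packCopy w (F i).1.2.1 (F i).1.1 (F i).1.2.2, fun i => ⟨(F i).1.1,
      Finset.mem_range.1 (Finset.mem_filter.1 (hF i).1).1, τ.isHCopy_packCopy _ (hF i).2⟩,
      fun i => (Finset.mem_filter.1 (F i).2).2, fun i j hij a _ a' _ => ?_⟩
    exact τ.packCopy_ne hw (hF i).2 (hF j).2
      (fun h => hij (F.injective (Subtype.ext (Prod.ext (congrArg Prod.fst h)
        (congrArg Prod.snd h))))) a a'

/-- The copies of `H` in the packing are disjoint. -/
theorem exists_packing {w : List Sym} (hw : WellFormed w) :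
    ∃ κ : Fin (τ.N * cost w) → T → Vtx T, (∀ i, ∃ ν < τ.N, τ.IsHCopy w ν (κ i)) ∧
      ∀ i j, i ≠ j → ∀ a a', κ i a ≠ κ j a' := by
  classical
  set I := Finset.range τ.N ×ˢ packIndex w with hI
  have hcard : I.card = τ.N * cost w := by
    rw [hI, Finset.card_product, card_packIndex, Finset.card_range]
  let F := (I.equivFinOfCardEq hcard).symm
  have hF : ∀ i, (F i).1.1 ∈ Finset.range τ.N ∧ (F i).1.2 ∈ packIndex w := fun i =>
    Finset.mem_product.1 (F i).2
  refine ⟨fun i => τ.packCopy w (F i).1.2.1 (F i).1.1 (F i).1.2.2, fun i => ⟨(F i).1.1,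
      Finset.mem_range.1 (hF i).1, τ.isHCopy_packCopy _ (hF i).2⟩, fun i j hij a a' => ?_⟩
  exact τ.packCopy_ne hw (hF i).2 (hF j).2
      (fun h => hij (F.injective (Subtype.ext (Prod.ext (congrArg Prod.fst h)
        (congrArg Prod.snd h))))) a a'

/-- A set with fewer vertices than there are copies of `M[Y]` misses one of these copies. -/
theorem exists_extra_copy {w : List Sym} {X : Set (Vtx T)} (hfin : X.Finite)
    (hcard : X.ncard < w.length * τ.q) :
    ∃ b < w.length, ∃ j < τ.q, ∀ a, (b, τ.N, j, a) ∉ X := by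
  classical
  by_contra hno
  push Not at hno
  refine absurd hcard (not_lt.2 ?_)
  have h1 : ((fun p : Vtx T => (p.1, p.2.2.1)) '' X).ncard ≤ X.ncard := Set.ncard_image_le hfin
  refine le_trans ?_ h1
  have h2 : ((Finset.range w.length ×ˢ Finset.range τ.q : Finset (ℕ × ℕ)) : Set (ℕ × ℕ)) ⊆
      (fun p : Vtx T => (p.1, p.2.2.1)) '' X := by
    rintro ⟨b, j⟩ h
    simp only [Finset.coe_product, Set.mem_prod, Finset.mem_coe, Finset.mem_range] at h
    obtain ⟨a, ha⟩ := hno b h.1 j h.2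
    exact ⟨_, ha, rfl⟩
  have h3 := Set.ncard_le_ncard h2 (hfin.image _)
  rwa [Set.ncard_coe_finset, Finset.card_product, Finset.card_range, Finset.card_range] at h3

theorem cost_le (w : List Sym) : cost w ≤ 3 * w.length := by
  have : ∀ b ∈ Finset.range w.length, (packRoles w b).card ≤ 3 := by
    intro b _
    unfold packRoles
    split <;> simp
  have := Finset.sum_le_card_nsmul _ _ 3 this
  rw [Finset.card_range, smul_eq_mul] at this
  rw [cost]
  omega

end Packing

end Template

/-! ### Formulas as words -/

section Words

/-- The symbols of a list of clauses. -/
def clauseSyms (cs : List (List (ℕ × Bool))) : List Sym :=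
  cs.flatMap fun c => Sym.start :: c.map fun l => Sym.lit l.1 l.2

/-- The word of a formula with `k` variables: the variables, followed by the clauses. -/
def formulaWord (k : ℕ) (cs : List (List (ℕ × Bool))) : List Sym :=
  List.replicate k Sym.var ++ clauseSyms cs

/-- The clauses of a formula. -/
def clauseList {k : ℕ} (Φ : CNF (Fin k)) : List (List (ℕ × Bool)) :=
  Φ.clauses.toList.map fun C => C.map fun l => ((l.1 : ℕ), l.2)

/-- The word of a formula. -/
def cnfWord {k : ℕ} (Φ : CNF (Fin k)) : List Sym := formulaWord k (clauseList Φ)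

theorem clauseSyms_cons (c : List (ℕ × Bool)) (cs : List (List (ℕ × Bool))) :
    clauseSyms (c :: cs) = Sym.start :: c.map (fun l => Sym.lit l.1 l.2) ++ clauseSyms cs := by
  simp [clauseSyms]

theorem clauseSyms_append (cs cs' : List (List (ℕ × Bool))) :
    clauseSyms (cs ++ cs') = clauseSyms cs ++ clauseSyms cs' := by
  simp [clauseSyms]

theorem head?_clauseSyms (cs : List (List (ℕ × Bool))) (i : ℕ) (s : Bool) :
    (clauseSyms cs).head? ≠ some (Sym.lit i s) := by
  cases cs <;> simp [clauseSyms]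

/-- A literal does not follow a variable of the formula. -/
theorem isChain_clauseSyms (cs : List (List (ℕ × Bool))) (y : Sym) :
    List.IsChain (fun y z => ∀ i s, z = Sym.lit i s → y ≠ Sym.var) (y :: clauseSyms cs) := by
  induction cs generalizing y with
  | nil => simp [clauseSyms]
  | cons c cs ih =>
    rw [clauseSyms_cons, List.cons_append, List.isChain_cons_cons]
    refine ⟨by simp, ?_⟩
    have : ∀ y, y ≠ Sym.var → List.IsChain (fun y z => ∀ i s, z = Sym.lit i s → y ≠ Sym.var)
        (y :: (c.map (fun l => Sym.lit l.1 l.2) ++ clauseSyms cs)) := by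
      induction c with
      | nil => exact fun y _ => by simpa using ih y
      | cons l c ihc =>
        intro y hy
        rw [List.map_cons, List.cons_append, List.isChain_cons_cons]
        exact ⟨fun _ _ _ => hy, ihc _ (by simp)⟩
    exact this _ (by simp)

theorem isChain_formulaWord (k : ℕ) (cs : List (List (ℕ × Bool))) (y : Sym) :
    List.IsChain (fun y z => ∀ i s, z = Sym.lit i s → y ≠ Sym.var) (y :: formulaWord k cs) := by
  induction k generalizing y with
  | zero => simpa [formulaWord] using isChain_clauseSyms cs y
  | succ k ih =>
    have : formulaWord (k + 1) cs = Sym.var :: formulaWord k cs := by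
      simp [formulaWord, List.replicate_succ]
    rw [this, List.isChain_cons_cons]
    exact ⟨by simp, ih _⟩

theorem formulaWord_var {k i : ℕ} (cs : List (List (ℕ × Bool))) :
    (formulaWord k cs)[i]? = some Sym.var ↔ i < k := by
  constructor
  · intro h
    by_contra hi
    rw [formulaWord, List.getElem?_append_right (by simpa using hi)] at h
    have := List.mem_of_getElem? h
    simp [clauseSyms] at this
  · intro h
    rw [formulaWord, List.getElem?_append_left (by simpa using h)]
    simp [h]

theorem wellFormed_formulaWord {k : ℕ} {cs : List (List (ℕ × Bool))}
    (h : ∀ c ∈ cs, ∀ l ∈ c, l.1 < k) : Template.WellFormed (formulaWord k cs) := by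
  intro b i s hb
  refine ⟨(formulaWord_var cs).2 ?_, ?_⟩
  · have := List.mem_of_getElem? hb
    simp only [formulaWord, clauseSyms, List.mem_append, List.mem_replicate, List.mem_flatMap,
      List.mem_cons, List.mem_map] at this
    rcases this with h1 | ⟨c, hc, h1 | ⟨l, hl, h1⟩⟩
    · exact absurd h1.2 (by simp)
    · cases h1
    · cases h1
      exact h c hc l hl
  · have hchain := List.isChain_iff_getElem.1 (isChain_formulaWord k cs Sym.var)
    obtain ⟨hlen, hb'⟩ := List.getElem?_eq_some_iff.1 hb
    have h1 := hchain b (by simpa using hlen) i s (by simpa using hb')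
    cases b with
    | zero => simp at h1
    | succ b =>
      refine ⟨b, rfl, ?_⟩
      have h2 : b < (formulaWord k cs).length := by omega
      rw [List.getElem_cons_succ] at h1
      rw [List.getElem?_eq_getElem h2]
      cases h3 : (formulaWord k cs)[b] with
      | var => exact absurd h3 h1
      | start => simp
      | lit i' s' => simp

open Template

/-- Inside a clause, `seen` tells whether one of the literals read so far is true. -/
theorem seen_clause {α : ℕ → Bool} (pre post : List Sym) (C : List (ℕ × Bool)) {j : ℕ}
    (hj : j ≤ C.length) :
    seen (pre ++ Sym.start :: C.map (fun l => Sym.lit l.1 l.2) ++ post) α (pre.length + 1 + j) =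
      (C.take j).any fun l => α l.1 == l.2 := by
  induction j with
  | zero => simp [seen]
  | succ j ih =>
    have h1 : (pre ++ Sym.start :: C.map (fun l => Sym.lit l.1 l.2) ++ post)[pre.length + 1 + j]? =
        some (Sym.lit C[j].1 C[j].2) := by
      rw [List.append_assoc, List.getElem?_append_right (by omega),
        show pre.length + 1 + j - pre.length = j + 1 by omega, List.cons_append,
        List.getElem?_cons_succ, List.getElem?_append_left (by simpa using hj)]
      simp [List.getElem?_eq_getElem (show j < C.length by omega)]
    rw [← add_assoc, seen, h1]
    simp only [ih (by omega)]
    rw [List.take_add_one, List.any_append, List.getElem?_eq_getElem (show j < C.length by omega)]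
    simp

/-- Each position after the variables lies in a clause. -/
theorem exists_clause {cs : List (List (ℕ × Bool))} (pre : List Sym) {b : ℕ}
    (h1 : pre.length ≤ b) (h2 : b < (pre ++ clauseSyms cs).length) :
    ∃ pre' c cs', c ∈ cs ∧ pre ++ clauseSyms cs =
      pre' ++ Sym.start :: c.map (fun l => Sym.lit l.1 l.2) ++ clauseSyms cs' ∧
      pre'.length ≤ b ∧ b ≤ pre'.length + c.length := by
  induction cs generalizing pre with
  | nil => simp [clauseSyms] at h2; omega
  | cons c cs ih =>
    by_cases hb : b ≤ pre.length + c.length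
    · exact ⟨pre, c, cs, by simp, by rw [clauseSyms_cons, List.append_assoc], h1, hb⟩
    · have h3 : pre ++ clauseSyms (c :: cs) =
          (pre ++ Sym.start :: c.map (fun l => Sym.lit l.1 l.2)) ++ clauseSyms cs := by
        rw [clauseSyms_cons, List.append_assoc]
      rw [h3] at h2 ⊢
      obtain ⟨pre', c', cs', hc, h⟩ := ih _ (by simp; omega) h2
      exact ⟨pre', c', cs', List.mem_cons_of_mem _ hc, h⟩

theorem isLit_clause_end {pre : List Sym} {c : List (ℕ × Bool)} {cs : List (List (ℕ × Bool))} :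
    ¬ IsLit (pre ++ Sym.start :: c.map (fun l => Sym.lit l.1 l.2) ++ clauseSyms cs)
      (pre.length + 1 + c.length) := by
  rintro ⟨i, s, h⟩
  rw [List.getElem?_append_right (by simp; omega)] at h
  rw [show pre.length + 1 + c.length - (pre ++ Sym.start :: c.map fun l =>
    Sym.lit l.1 l.2).length = 0 by simp; omega, ← List.head?_eq_getElem?] at h
  exact head?_clauseSyms cs i s h

theorem wordSat_formulaWord {k : ℕ} {cs : List (List (ℕ × Bool))} {α : ℕ → Bool} :
    WordSat (formulaWord k cs) α ↔ ∀ C ∈ cs, (C.any fun l => α l.1 == l.2) = true := by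
  constructor
  · intro h C hc
    obtain ⟨cs₁, cs₂, rfl⟩ := List.append_of_mem hc
    have hw : formulaWord k (cs₁ ++ C :: cs₂) = (List.replicate k Sym.var ++ clauseSyms cs₁) ++
        Sym.start :: C.map (fun l => Sym.lit l.1 l.2) ++ clauseSyms cs₂ := by
      simp [formulaWord, clauseSyms_append, clauseSyms_cons]
    generalize List.replicate k Sym.var ++ clauseSyms cs₁ = pre at hw
    rw [hw] at h
    by_contra hno
    have h1 := seen_clause (α := α) pre (clauseSyms cs₂) C le_rfl
    rw [List.take_length, Bool.eq_false_iff.2 hno,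
      show pre.length + 1 + C.length = pre.length + C.length + 1 by omega] at h1
    have h2 := h (pre.length + C.length) (by simp) ?_ h1
    · rw [show pre.length + C.length + 1 = pre.length + 1 + C.length by omega] at h2
      exact isLit_clause_end h2
    · rw [List.append_assoc, List.getElem?_append_right (by omega), Nat.add_sub_cancel_left,
        List.getElem?_append_left (by simp)]
      intro h3
      have := List.mem_of_getElem? h3
      simp at this
  · intro h b hb hvar hseen
    have hkb : k ≤ b := by
      by_contra hk
      exact hvar ((formulaWord_var cs).2 (by omega))
    obtain ⟨pre, C, cs', hc, hw, h1, h2⟩ := exists_clause (cs := cs) (List.replicate k Sym.var)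
      (b := b) (by simpa using hkb) hb
    have hw : formulaWord k cs = _ := hw
    rw [hw] at hseen ⊢
    obtain ⟨j, rfl⟩ := Nat.exists_eq_add_of_le h1
    have hj : j ≤ C.length := by omega
    rw [show pre.length + j + 1 = pre.length + 1 + j by omega] at hseen ⊢
    rw [seen_clause pre _ C hj] at hseen
    rcases hj.lt_or_eq with hj | rfl
    · refine ⟨C[j].1, C[j].2, ?_⟩
      rw [List.append_assoc, List.getElem?_append_right (by omega),
        show pre.length + 1 + j - pre.length = j + 1 by omega, List.cons_append,
        List.getElem?_cons_succ, List.getElem?_append_left (by simpa using hj)]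
      simp [List.getElem?_eq_getElem hj]
    · rw [List.take_length, h C hc] at hseen
      cases hseen

theorem wellFormed_cnfWord {k : ℕ} (Φ : CNF (Fin k)) : WellFormed (cnfWord Φ) := by
  refine wellFormed_formulaWord fun c hc l hl => ?_
  simp only [clauseList, List.mem_map] at hc
  obtain ⟨C, -, rfl⟩ := hc
  obtain ⟨l', -, rfl⟩ := List.mem_map.1 hl
  exact l'.1.2

theorem satisfiable_iff {k : ℕ} (Φ : CNF (Fin k)) :
    Satisfiable Φ ↔ ∃ α, WordSat (cnfWord Φ) α := by
  have key : ∀ α : ℕ → Bool, WordSat (cnfWord Φ) α ↔ CNF.Sat (fun i : Fin k => α i) Φ := by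
    intro α
    simp only [cnfWord, wordSat_formulaWord, clauseList, List.mem_map, forall_exists_index,
      and_imp, forall_apply_eq_imp_iff₂, CNF.Sat, CNF.eval, CNF.Clause.eval, List.any_map,
      Array.all_eq_true_iff_forall_mem, Array.mem_toList_iff]
    rfl
  constructor
  · rintro ⟨a, ha⟩
    refine ⟨fun i => if h : i < k then a ⟨i, h⟩ else false, (key _).2 ?_⟩
    simpa using ha
  · rintro ⟨α, hα⟩
    exact ⟨_, (key α).1 hα⟩

/-- The contribution of a symbol to the size of the packing. -/
def Sym.weight : Sym → ℕ
  | .var => 1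
  | .start => 0
  | .lit _ _ => 3

theorem cost_eq_sum (w : List Sym) : cost w = (w.map Sym.weight).sum := by
  induction w with
  | nil => simp [cost]
  | cons y w ih =>
    rw [List.map_cons, List.sum_cons, ← ih, cost, List.length_cons, Finset.sum_range_succ',
      add_comm]
    congr 1
    cases y <;> rfl

end Words

/-! ### Numbering the vertices -/

namespace Template

section Numbering

variable {T : Type*} (τ : Template T)

/-- The number of parts of a gadget: the role `ρ` of the `ν`-th copy is the part `6 ν + ρ`, and
the copies of `M[Y]` are the parts from `6 N` on. -/
def partCount : ℕ := 6 * τ.N + τ.q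

/-- The number of vertices of a gadget. -/
noncomputable def step : ℕ := τ.partCount * Nat.card T

/-- The position of a vertex within its gadget. -/
noncomputable def offset [Finite T] (p : ℕ × ℕ × T) : ℕ :=
  (6 * p.1 + p.2.1) * Nat.card T + Finite.equivFin T p.2.2

/-- The number of a vertex. -/
noncomputable def number [Finite T] (p : Vtx T) : ℕ := p.1 * τ.step + offset p.2

/-- The vertices of the constructed graph: for `ν < N` there are six roles, and for `ν = N` there
is a role for each of the `q` copies of `M[Y]`. Not all of them have edges. -/
def Valid (w : List Sym) (p : Vtx T) : Prop :=
  p.1 < w.length ∧ (p.2.1 < τ.N ∧ p.2.2.1 < 6 ∨ p.2.1 = τ.N ∧ p.2.2.1 < τ.q)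

/-- The vertex with a given number; the minimum with `N` takes care of the copies of `M[Y]`, whose
roles are not limited to six. -/
noncomputable def vertex [Finite T] (τ : Template T) (u : ℕ) : Vtx T :=
  (u / Nat.card T / τ.partCount,
    min (u / Nat.card T % τ.partCount / 6) τ.N,
    u / Nat.card T % τ.partCount - 6 * min (u / Nat.card T % τ.partCount / 6) τ.N,
    (Finite.equivFin T).symm
      ⟨u % Nat.card T, Nat.mod_lt _ (Nat.card_pos_iff.2 ⟨⟨τ.c⟩, inferInstance⟩)⟩)

theorem EdgeRel.valid {w : List Sym} (hw : WellFormed w) {p r : Vtx T} (h : τ.EdgeRel w p r) :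
    τ.Valid w p ∧ τ.Valid w r := by
  cases h with
  | fork h1 h2 h3 h4 h5 =>
    exact ⟨⟨h1, Or.inl ⟨h2, by simp⟩⟩, ⟨h1, Or.inl ⟨h2, by simp⟩⟩⟩
  | extra h1 h2 h3 h4 h5 => exact ⟨⟨h1, Or.inr ⟨rfl, h2⟩⟩, ⟨h1, Or.inr ⟨rfl, h2⟩⟩⟩
  | @wire b i s ν ρ a a' h1 h2 h3 h4 h5 h6 =>
    have hc : τ.IsHCopy w ν (τ.wireOf w b ν ρ) := Or.inr ⟨b, ρ, ⟨i, s, h1⟩, h3, rfl⟩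
    rw [τ.wireOf_eq h1 h3] at hc
    have := fun a => hc.valid τ hw a
    exact ⟨⟨(this a).1, Or.inl ⟨by rw [(this a).2.1]; exact h2, (this a).2.2⟩⟩,
      ⟨(this a').1, Or.inl ⟨by rw [(this a').2.1]; exact h2, (this a').2.2⟩⟩⟩

theorem EdgeRel.ne {w : List Sym} {p r : Vtx T} (h : τ.EdgeRel w p r) : p ≠ r := by
  cases h with
  | fork h1 h2 h3 h4 h5 => exact fun h => h5.ne (by simpa using h)
  | extra h1 h2 h3 h4 h5 => exact fun h => h5.ne (by simpa using h)
  | @wire b i s ν ρ a a' h1 h2 h3 h4 h5 h6 => exact fun h => h6.ne (τ.wire_injective h3 h)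

variable [Finite T]

theorem number_eq (p : Vtx T) : τ.number p =
    (p.1 * τ.partCount + (6 * p.2.1 + p.2.2.1)) * Nat.card T + Finite.equivFin T p.2.2.2 := by
  simp only [number, offset, step]
  ring

theorem card_pos (_ : Template T) : 0 < Nat.card T := Nat.card_pos_iff.2 ⟨⟨c ‹_›⟩, inferInstance⟩

theorem number_vertex (u : ℕ) : τ.number (τ.vertex u) = u := by
  rw [number_eq]
  simp only [vertex, Equiv.apply_symm_apply]
  have h1 : 6 * min (u / Nat.card T % τ.partCount / 6) τ.N +
      (u / Nat.card T % τ.partCount - 6 * min (u / Nat.card T % τ.partCount / 6) τ.N) =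
      u / Nat.card T % τ.partCount := by omega
  rw [h1, Nat.div_add_mod', Nat.div_add_mod']

theorem vertex_number {w : List Sym} {p : Vtx T} (hp : τ.Valid w p) :
    τ.vertex (τ.number p) = p := by
  obtain ⟨b, ν, ρ, a⟩ := p
  have hlt := (Finite.equivFin T a).2
  have h1 : τ.number (b, ν, ρ, a) / Nat.card T = b * τ.partCount + (6 * ν + ρ) := by
    rw [number_eq, Nat.add_div_of_dvd_right (Dvd.intro_left _ rfl), Nat.mul_div_cancel _ τ.card_pos,
      Nat.div_eq_of_lt hlt, add_zero]
  have h2 : τ.number (b, ν, ρ, a) % Nat.card T = Finite.equivFin T a := by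
    rw [number_eq, Nat.mul_add_mod_self_right, Nat.mod_eq_of_lt hlt]
  have h3 : 6 * ν + ρ < τ.partCount := by
    have := hp.2
    simp only [partCount] at this ⊢
    omega
  have h4 : (b * τ.partCount + (6 * ν + ρ)) % τ.partCount = 6 * ν + ρ := by
    rw [Nat.mul_add_mod_self_right, Nat.mod_eq_of_lt h3]
  have h5 : (b * τ.partCount + (6 * ν + ρ)) / τ.partCount = b := by
    rw [Nat.add_div_of_dvd_right (Dvd.intro_left _ rfl), Nat.mul_div_cancel _ (by omega),
      Nat.div_eq_of_lt h3, add_zero]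
  have h6 : min ((6 * ν + ρ) / 6) τ.N = ν := by
    have := hp.2
    simp only at this
    omega
  simp only [vertex, h1, h2, h4, h5, h6, Fin.eta, Equiv.symm_apply_apply, Nat.add_sub_cancel_left]

theorem number_lt {w : List Sym} {p : Vtx T} (hp : τ.Valid w p) :
    τ.number p < w.length * τ.step := by
  obtain ⟨b, ν, ρ, a⟩ := p
  have hlt := (Finite.equivFin T a).2
  have h3 : 6 * ν + ρ < τ.partCount := by
    have := hp.2
    simp only [partCount] at this ⊢
    omega
  have hb : b + 1 ≤ w.length := hp.1
  calc τ.number (b, ν, ρ, a) < b * τ.step + (6 * ν + ρ + 1) * Nat.card T := by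
        rw [add_mul (6 * ν + ρ) 1, one_mul]
        simp only [number, offset]
        omega
    _ ≤ b * τ.step + τ.partCount * Nat.card T :=
        Nat.add_le_add_left (Nat.mul_le_mul_right _ h3) _
    _ = (b + 1) * τ.step := by rw [step]; ring
    _ ≤ _ := Nat.mul_le_mul_right _ hb

theorem vertex_injective : Function.Injective (τ.vertex (T := T)) :=
  Function.LeftInverse.injective τ.number_vertex

theorem vertex_fst_lt {w : List Sym} {u : ℕ} (hu : u < w.length * τ.step) :
    (τ.vertex u).1 < w.length := by
  simp only [vertex]
  rw [Nat.div_div_eq_div_mul, mul_comm, ← step]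
  exact Nat.div_lt_of_lt_mul (by rwa [mul_comm])

/-- The constructed graph. -/
def graph (w : List Sym) : SimpleGraph (Fin (w.length * τ.step)) where
  Adj u v := τ.EdgeRel w (τ.vertex u) (τ.vertex v)
  symm := ⟨fun _ _ h => h.symm⟩
  loopless := ⟨fun _ h => h.ne τ rfl⟩

end Numbering

end Template

/-! ### The list of edges -/

section EdgeList

/-- The sign of a literal. -/
def Sym.sign : Sym → Option Bool
  | .lit _ s => some s
  | _ => none

/-- The variable of a literal. -/
def Sym.index : Sym → ℕ
  | .lit i _ => i
  | _ => 0

namespace Template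

variable {T : Type*} (τ : Template T)

/-- Replace the symbolic positions `0`, `1`, `2` by the position before `b`, the position `b` and
the position `i`. -/
def place (b i : ℕ) : Vtx T → Vtx T
  | (0, p) => (b - 1, p)
  | (1, p) => (b, p)
  | (_ + 2, p) => (i, p)

/-- The edges of the gadget of a symbol with sign `s`, with symbolic positions: `1` stands for the
position of the symbol, `0` for the position before it, and `2` for the position of its
variable. -/
inductive GadgetRel (s : Option Bool) : Vtx T → Vtx T → Prop
  | fork {ν : ℕ} {a a' : T} : ν < τ.N → a ∈ τ.A → a' ∈ τ.A → τ.M.Adj a a' →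
      GadgetRel s (1, ν, 3, a) (1, ν, 3, a')
  | wire {t : Bool} {ν ρ : ℕ} {a a' : T} : s = some t → ν < τ.N →
      ρ ∈ ({0, 1, 2, 4, 5} : Finset ℕ) → a ∈ τ.A → a' ∈ τ.A → τ.M.Adj a a' →
      GadgetRel s (τ.wire 1 ν ρ (τ.tgt 1 2 t ν ρ) a) (τ.wire 1 ν ρ (τ.tgt 1 2 t ν ρ) a')
  | extra {j : ℕ} {a a' : T} : j < τ.q → a ∈ τ.Y → a' ∈ τ.Y → τ.M.Adj a a' →
      GadgetRel s (1, τ.N, j, a) (1, τ.N, j, a')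

theorem place_wire {b i ν ρ : ℕ} {s : Bool} {a : T} (hρ : ρ ∈ ({0, 1, 2, 4, 5} : Finset ℕ)) :
    place b i (τ.wire 1 ν ρ (τ.tgt 1 2 s ν ρ) a) = τ.wire b ν ρ (τ.tgt b i s ν ρ) a := by
  unfold wire
  split_ifs
  · fin_cases hρ <;> rfl
  · rfl
  · rfl

theorem edgeRel_iff {w : List Sym} {p r : Vtx T} : τ.EdgeRel w p r ↔ ∃ b y, w[b]? = some y ∧
    ∃ p' r', τ.GadgetRel y.sign p' r' ∧ p = place b y.index p' ∧ r = place b y.index r' := by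
  constructor
  · intro h
    cases h with
    | @fork b ν a a' h1 h2 h3 h4 h5 =>
      exact ⟨b, w[b], List.getElem?_eq_getElem h1, _, _, .fork h2 h3 h4 h5, rfl, rfl⟩
    | @extra b j a a' h1 h2 h3 h4 h5 =>
      exact ⟨b, w[b], List.getElem?_eq_getElem h1, _, _, .extra h2 h3 h4 h5, rfl, rfl⟩
    | @wire b i s ν ρ a a' h1 h2 h3 h4 h5 h6 =>
      exact ⟨b, _, h1, _, _, .wire rfl h2 h3 h4 h5 h6, (τ.place_wire h3).symm,
        (τ.place_wire h3).symm⟩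
  · rintro ⟨b, y, hy, p', r', h, rfl, rfl⟩
    have hb := (List.getElem?_eq_some_iff.1 hy).1
    cases h with
    | fork h2 h3 h4 h5 => exact .fork hb h2 h3 h4 h5
    | extra h2 h3 h4 h5 => exact .extra hb h2 h3 h4 h5
    | wire h1 h2 h3 h4 h5 h6 =>
      cases y with
      | var => cases h1
      | start => cases h1
      | lit i s =>
        cases h1
        rw [τ.place_wire h3, τ.place_wire h3]
        exact .wire hy h2 h3 h4 h5 h6

theorem exists_gadgetEdges [Finite T] (s : Option Bool) :
    ∃ E : List (Vtx T × Vtx T), ∀ p r, (p, r) ∈ E ↔ τ.GadgetRel s p r := by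
  have hbd : ∀ ν ρ (t : Bool) (a : T), ν < τ.N → ρ ∈ ({0, 1, 2, 4, 5} : Finset ℕ) →
      τ.wire 1 ν ρ (τ.tgt 1 2 t ν ρ) a ∈
        Set.Iic 2 ×ˢ Set.Iic τ.N ×ˢ Set.Iic (6 + τ.q) ×ˢ (Set.univ : Set T) := by
    intro ν ρ t a hν hρ
    unfold wire
    split_ifs <;> fin_cases hρ <;> simp [tgt, hubOf] <;> omega
  have hfin : {e : Vtx T × Vtx T | τ.GadgetRel s e.1 e.2}.Finite := by
    have hbox : (Set.Iic 2 ×ˢ Set.Iic τ.N ×ˢ Set.Iic (6 + τ.q) ×ˢ (Set.univ : Set T)).Finite :=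
      (Set.finite_Iic _).prod ((Set.finite_Iic _).prod ((Set.finite_Iic _).prod Set.finite_univ))
    refine (hbox.prod hbox).subset ?_
    rintro ⟨p, r⟩ h
    cases h with
    | fork h2 h3 h4 h5 => simp; omega
    | extra h2 h3 h4 h5 => simp; omega
    | wire h1 h2 h3 h4 h5 h6 => exact ⟨hbd _ _ _ _ h2 h3, hbd _ _ _ _ h2 h3⟩
  exact ⟨hfin.toFinset.toList, by simp⟩

variable [Finite T]

/-- The list of edges of the gadget of a symbol with sign `s`, with symbolic positions. -/
noncomputable def gadgetEdges (s : Option Bool) : List (Vtx T × Vtx T) :=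
  (τ.exists_gadgetEdges s).choose

theorem mem_gadgetEdges {s : Option Bool} {e : Vtx T × Vtx T} :
    e ∈ τ.gadgetEdges s ↔ τ.GadgetRel s e.1 e.2 := (τ.exists_gadgetEdges s).choose_spec _ _

theorem fst_le_of_mem_gadgetEdges {s : Option Bool} {e : Vtx T × Vtx T}
    (h : e ∈ τ.gadgetEdges s) : e.1.1 ≤ 2 ∧ e.2.1 ≤ 2 := by
  obtain ⟨p, r⟩ := e
  have hbd : ∀ ν ρ (t : Bool) (a : T), (τ.wire 1 ν ρ (τ.tgt 1 2 t ν ρ) a).1 ≤ 2 := by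
    intro ν ρ t a
    unfold wire tgt
    split_ifs <;> (try split) <;> simp
  cases τ.mem_gadgetEdges.1 h with
  | fork h2 h3 h4 h5 => simp
  | extra h2 h3 h4 h5 => simp
  | wire h1 h2 h3 h4 h5 h6 => exact ⟨hbd _ _ _ _, hbd _ _ _ _⟩

/-- The edges of the gadget of the symbol `y` at the position `b`. -/
noncomputable def symEdges (b : ℕ) (y : Sym) : List (Vtx T × Vtx T) :=
  (τ.gadgetEdges y.sign).map (Prod.map (place b y.index) (place b y.index))

/-- The edges of the constructed graph. -/
noncomputable def edges (w : List Sym) : List (Vtx T × Vtx T) :=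
  w.zipIdx.flatMap fun e => τ.symEdges e.2 e.1

theorem edges_append_singleton (w : List Sym) (y : Sym) :
    τ.edges (w ++ [y]) = τ.edges w ++ τ.symEdges w.length y := by
  simp [edges, List.zipIdx_append]

theorem mem_edges {w : List Sym} {p r : Vtx T} : (p, r) ∈ τ.edges w ↔ τ.EdgeRel w p r := by
  rw [edges, List.mem_flatMap, edgeRel_iff]
  constructor
  · rintro ⟨⟨y, b⟩, hy, h⟩
    obtain ⟨⟨p', r'⟩, h, h'⟩ := List.mem_map.1 h
    simp only [Prod.map_apply, Prod.mk.injEq] at h'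
    exact ⟨b, y, List.mk_mem_zipIdx_iff_getElem?.1 hy, p', r', τ.mem_gadgetEdges.1 h, h'.1.symm,
      h'.2.symm⟩
  · rintro ⟨b, y, hy, p', r', h, rfl, rfl⟩
    exact ⟨(y, b), List.mk_mem_zipIdx_iff_getElem?.2 hy,
      List.mem_map.2 ⟨(p', r'), τ.mem_gadgetEdges.2 h, rfl⟩⟩

/-- The numbers of the ends of the edges in a list. -/
noncomputable def endNumbers (E : List (Vtx T × Vtx T)) : List ℕ :=
  E.flatMap fun e => [τ.number e.1, τ.number e.2]

theorem describes_graph {w : List Sym} (hw : WellFormed w) (ℓ : ℕ) :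
    Describes (τ.endNumbers (τ.edges w) ++ [w.length * τ.step, ℓ]) (τ.graph w) ℓ := by
  have hlift : ∀ E : List (Vtx T × Vtx T), (∀ e ∈ E, τ.Valid w e.1 ∧ τ.Valid w e.2) →
      ∃ E' : List (Fin (w.length * τ.step) × Fin (w.length * τ.step)),
        E = E'.map fun u => (τ.vertex u.1, τ.vertex u.2) := by
    intro E
    induction E with
    | nil => exact fun _ => ⟨[], rfl⟩
    | cons e E ih =>
      intro h
      obtain ⟨E', hE'⟩ := ih fun e he => h e (List.mem_cons_of_mem _ he)
      have h1 := h e List.mem_cons_self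
      refine ⟨(⟨_, τ.number_lt h1.1⟩, ⟨_, τ.number_lt h1.2⟩) :: E', ?_⟩
      rw [List.map_cons, ← hE', τ.vertex_number h1.1, τ.vertex_number h1.2]
  obtain ⟨E, hE⟩ := hlift (τ.edges w) fun e he => EdgeRel.valid τ hw (τ.mem_edges.1 he)
  have hmem : ∀ u v, (u, v) ∈ E ↔ (τ.graph w).Adj u v := by
    intro u v
    change _ ↔ τ.EdgeRel w (τ.vertex u) (τ.vertex v)
    rw [← mem_edges, hE, List.mem_map]
    constructor
    · exact fun h => ⟨_, h, rfl⟩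
    · rintro ⟨⟨u', v'⟩, h, h'⟩
      have h1 : u' = u := Fin.ext (τ.vertex_injective (congrArg Prod.fst h'))
      have h2 : v' = v := Fin.ext (τ.vertex_injective (congrArg Prod.snd h'))
      rwa [← h1, ← h2]
  refine ⟨E, fun u v => ?_, ?_⟩
  · rw [hmem, hmem, SimpleGraph.adj_comm _ v u, or_self]
  · rw [hE, endNumbers, List.flatMap_map]
    simp only [number_vertex]

end Template

end EdgeList

/-! ### The program -/

section Machine

/-- The program `p` leads from the state `s` to the state `s'` in at most `T` steps. -/
def Runs (p : Prog) (s : State) (T : ℕ) (s' : State) : Prop := ∃ t ≤ T, Exec p s t s'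

theorem Runs.mono {p : Prog} {s s' : State} {T T' : ℕ} (h : Runs p s T s') (hT : T ≤ T') :
    Runs p s T' s' := by
  obtain ⟨t, ht, h⟩ := h
  exact ⟨t, ht.trans hT, h⟩

theorem Runs.seq {p q : Prog} {s s₁ s₂ : State} {T₁ T₂ : ℕ} (h₁ : Runs p s T₁ s₁)
    (h₂ : Runs q s₁ T₂ s₂) : Runs (.seq p q) s (T₁ + T₂) s₂ := by
  obtain ⟨t₁, ht₁, h₁⟩ := h₁
  obtain ⟨t₂, ht₂, h₂⟩ := h₂
  exact ⟨_, Nat.add_le_add ht₁ ht₂, .seq h₁ h₂⟩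

theorem Runs.instr (c : Instr) (s : State) : Runs (.instr c) s 1 (c.run s) :=
  ⟨1, le_rfl, .instr c s⟩

theorem Runs.instr_seq {c : Instr} {p : Prog} {s s' : State} {T : ℕ} (h : Runs p (c.run s) T s') :
    Runs (.seq (.instr c) p) s (1 + T) s' := (Runs.instr c s).seq h

theorem Runs.while_pos {i : ℕ} {p : Prog} {s s₁ s₂ : State} {T₁ T₂ : ℕ} (hi : 0 < s.reg i)
    (h₁ : Runs p s T₁ s₁) (h₂ : Runs (.whilePos i p) s₁ T₂ s₂) :
    Runs (.whilePos i p) s (T₁ + T₂ + 1) s₂ := by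
  obtain ⟨t₁, ht₁, h₁⟩ := h₁
  obtain ⟨t₂, ht₂, h₂⟩ := h₂
  exact ⟨_, by omega, .while_pos hi h₁ h₂⟩

theorem Runs.while_zero {i : ℕ} {p : Prog} {s : State} (hi : s.reg i = 0) :
    Runs (.whilePos i p) s 1 s := ⟨1, le_rfl, .while_zero hi⟩

/-- Print the numbers `R p.1 + p.2` for the pairs `p` in a list. -/
def emit : List (ℕ × ℕ) → Prog
  | [] => .skip
  | p :: l => .seq (.instr (.const 13 p.2)) (.seq (.instr (.add 13 13 p.1))
      (.seq (.instr (.print 13)) (emit l)))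

theorem runs_emit (l : List (ℕ × ℕ)) (hl : ∀ p ∈ l, p.1 ≠ 13) (s : State) :
    ∃ s', Runs (emit l) s (3 * l.length + 1) s' ∧ s'.input = s.input ∧
      s'.output = s.output ++ l.map (fun p => s.reg p.1 + p.2) ∧
      ∀ r, r ≠ 13 → s'.reg r = s.reg r := by
  induction l generalizing s with
  | nil => exact ⟨s, ⟨1, by simp, .skip s⟩, rfl, by simp, fun _ _ => rfl⟩
  | cons p l ih =>
    have hp : p.1 ≠ 13 := hl p List.mem_cons_self
    obtain ⟨s', h1, h2, h3, h4⟩ := ih (fun p hp => hl p (List.mem_cons_of_mem _ hp))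
      ((Instr.print 13).run ((Instr.add 13 13 p.1).run ((Instr.const 13 p.2).run s)))
    refine ⟨s', (Runs.instr_seq (Runs.instr_seq (Runs.instr_seq h1))).mono
      (by rw [List.length_cons]; omega), h2, ?_, fun r hr => ?_⟩
    · rw [h3]
      simp only [Instr.run, State.set, List.map_cons, List.append_assoc, List.cons_append,
        List.nil_append, Function.update_self, Function.update_of_ne hp, Function.update_idem]
      rw [add_comm p.2]
      congr 2
      refine List.map_congr_left fun p hp => ?_
      rw [Function.update_of_ne (hl p (List.mem_cons_of_mem _ hp))]
    · rw [h4 r hr]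
      simp [Instr.run, State.set, Function.update_of_ne hr]

/-- `R 2 := R 2 + R 11 * R 3`, where `R 4` contains `1`. -/
def mulLoop : Prog := .whilePos 11 (.seq (.instr (.add 2 2 3)) (.instr (.sub 11 11 4)))

theorem runs_mulLoop (i : ℕ) (s : State) (h4 : s.reg 4 = 1) (h11 : s.reg 11 = i) :
    ∃ s', Runs mulLoop s (3 * i + 1) s' ∧ s'.input = s.input ∧ s'.output = s.output ∧
      s'.reg 2 = s.reg 2 + i * s.reg 3 ∧ ∀ r, r ≠ 2 → r ≠ 11 → s'.reg r = s.reg r := by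
  induction i generalizing s with
  | zero => exact ⟨s, Runs.while_zero h11, rfl, rfl, by simp, fun _ _ _ => rfl⟩
  | succ i ih =>
    obtain ⟨s', h1, h2, h3, h5, h6⟩ := ih ((Instr.sub 11 11 4).run ((Instr.add 2 2 3).run s))
      (by simp [Instr.run, State.set, h4]) (by simp [Instr.run, State.set, h4, h11])
    refine ⟨s', (Runs.while_pos (by omega) (Runs.instr_seq (Runs.instr _ _)) h1).mono (by omega),
      h2, h3, ?_, fun r hr hr' => ?_⟩
    · rw [h5]
      simp [Instr.run, State.set]
      ring
    · rw [h6 r hr hr']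
      simp [Instr.run, State.set, hr, hr']

namespace Template

variable {T : Type*} [Finite T] (τ : Template T)

/-- The edges of the gadget of a symbol with sign `s`, each end given by a register, which holds
the number of the first vertex of a gadget, and an offset. -/
noncomputable def gadgetCode (s : Option Bool) : List (ℕ × ℕ) :=
  (τ.gadgetEdges s).flatMap fun e => [(e.1.1, offset e.1.2), (e.2.1, offset e.2.2)]

/-- Print the edges of a gadget, add `R r` to the size of the packing, and advance by one
gadget. -/
noncomputable def gadgetProg (s : Option Bool) (r : ℕ) : Prog :=
  .seq (emit (τ.gadgetCode s)) (.seq (.instr (.add 6 6 r)) (.seq (.instr (.add 0 1 15))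
    (.instr (.add 1 1 3))))

/-- A bound for the time needed to print the edges of a gadget. -/
noncomputable def gadgetTime : ℕ :=
  3 * ((τ.gadgetCode none).length + (τ.gadgetCode (some true)).length +
    (τ.gadgetCode (some false)).length) + 5

/-- The invariant of the program: the gadgets of the symbols of `v` have been printed, the loop
counters have the values `x`, `y` and `z`, and the list `inp` has not been read yet. -/
structure Ready (v : List Sym) (x y z : ℕ) (inp : List ℕ) (s : State) : Prop where
  prev : s.reg 0 = (v.length - 1) * τ.step
  cur : s.reg 1 = v.length * τ.step
  step : s.reg 3 = τ.step
  one : s.reg 4 = 1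
  vars : s.reg 5 = x
  packing : s.reg 6 = τ.N * (v.map Sym.weight).sum
  weight_var : s.reg 7 = τ.N
  weight_lit : s.reg 8 = 3 * τ.N
  clauses : s.reg 9 = y
  lits : s.reg 10 = z
  zero : s.reg 15 = 0
  input : s.input = inp
  output : s.output = τ.endNumbers (τ.edges v)

/-- The offsets in the code of a gadget refer to the positions in the registers `0`, `1`, `2`. -/
theorem code_output {s : State} {b i : ℕ} (h0 : s.reg 0 = (b - 1) * τ.step)
    (h1 : s.reg 1 = b * τ.step) (h2 : s.reg 2 = i * τ.step) (t : Option Bool) :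
    (τ.gadgetCode t).map (fun p => s.reg p.1 + p.2) =
      τ.endNumbers ((τ.gadgetEdges t).map (Prod.map (place b i) (place b i))) := by
  have hplace : ∀ p : Vtx T, p.1 ≤ 2 → s.reg p.1 + offset p.2 = τ.number (place b i p) := by
    rintro ⟨k, p⟩ hk
    simp only at hk
    interval_cases k
    · simp [place, number, h0]
    · simp [place, number, h1]
    · simp [place, number, h2]
  rw [gadgetCode, endNumbers, List.map_flatMap, List.flatMap_map]
  refine List.flatMap_congr fun e he => ?_
  have := τ.fst_le_of_mem_gadgetEdges he
  simp [hplace _ this.1, hplace _ this.2]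

theorem gadgetCode_length_le (y : Sym) :
    3 * (τ.gadgetCode y.sign).length + 5 ≤ τ.gadgetTime := by
  unfold gadgetTime
  rcases y with _ | _ | ⟨i, _ | _⟩ <;> simp only [Sym.sign] <;> omega

theorem runs_gadgetProg {v : List Sym} {x y z : ℕ} {inp : List ℕ} {s : State}
    (h : τ.Ready v x y z inp s) (a : Sym) {r : ℕ} (hr : s.reg r = τ.N * a.weight) (hr' : r ≠ 13)
    (h2 : s.reg 2 = a.index * τ.step) :
    ∃ s', Runs (τ.gadgetProg a.sign r) s τ.gadgetTime s' ∧ τ.Ready (v ++ [a]) x y z inp s' := by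
  have hslot : ∀ p ∈ τ.gadgetCode a.sign, p.1 ≠ 13 := by
    intro p hp
    obtain ⟨e, he, hp⟩ := List.mem_flatMap.1 hp
    have := τ.fst_le_of_mem_gadgetEdges he
    simp only [List.mem_cons, List.not_mem_nil, or_false] at hp
    rcases hp with rfl | rfl <;> simp only <;> omega
  obtain ⟨s', h3, h4, h5, h6⟩ := runs_emit _ hslot s
  rw [τ.code_output h.prev h.cur h2] at h5
  refine ⟨_, (h3.seq (Runs.instr_seq (Runs.instr_seq (Runs.instr _ _)))).mono
    ((by omega : _ ≤ _ + 5).trans (τ.gadgetCode_length_le a)), ?_⟩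
  have e0 := h6 0 (by simp)
  have e1 := h6 1 (by simp)
  have e3 := h6 3 (by simp)
  have e4 := h6 4 (by simp)
  have e5 := h6 5 (by simp)
  have e6 := h6 6 (by simp)
  have e7 := h6 7 (by simp)
  have e8 := h6 8 (by simp)
  have e9 := h6 9 (by simp)
  have e10 := h6 10 (by simp)
  have e15 := h6 15 (by simp)
  have er := h6 r hr'
  constructor
  · simp [Instr.run, State.set, e1, e15, h.cur, h.zero]
  · simp [Instr.run, State.set, e1, e3, h.cur, h.step]
    ring
  · simp [Instr.run, State.set, e3, h.step]
  · simp [Instr.run, State.set, e4, h.one]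
  · simp [Instr.run, State.set, e5, h.vars]
  · simp [Instr.run, State.set, e6, er, h.packing, hr]
    ring
  · simp [Instr.run, State.set, e7, h.weight_var]
  · simp [Instr.run, State.set, e8, h.weight_lit]
  · simp [Instr.run, State.set, e9, h.clauses]
  · simp [Instr.run, State.set, e10, h.lits]
  · simp [Instr.run, State.set, e15, h.zero]
  · simp [Instr.run, State.set, h4, h.input]
  · simp only [Instr.run, State.set, h5, h.output, edges_append_singleton, endNumbers,
      List.flatMap_append]
    rfl

/-- The loop that prints the gadgets of the variables. -/
noncomputable def varLoop : Prog :=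
  .whilePos 5 (.seq (.instr (.sub 5 5 4)) (.seq (.instr (.const 2 0)) (τ.gadgetProg none 7)))

theorem runs_varLoop (x : ℕ) {v : List Sym} {y z : ℕ} {inp : List ℕ} {s : State}
    (h : τ.Ready v x y z inp s) :
    ∃ s', Runs τ.varLoop s (x * (τ.gadgetTime + 3) + 1) s' ∧
      τ.Ready (v ++ List.replicate x Sym.var) 0 y z inp s' := by
  induction x generalizing v s with
  | zero => exact ⟨s, (Runs.while_zero h.vars).mono (by omega), by simpa using h⟩
  | succ x ih =>
    have h1 : τ.Ready v x y z inp ((Instr.const 2 0).run ((Instr.sub 5 5 4).run s)) := by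
      constructor <;> simp [Instr.run, State.set, h.prev, h.cur, h.step, h.one, h.vars, h.packing,
        h.weight_var, h.weight_lit, h.clauses, h.lits, h.zero, h.input, h.output]
    obtain ⟨s₁, h2, h3⟩ := τ.runs_gadgetProg h1 Sym.var (r := 7)
      (by simp [Sym.weight, h1.weight_var]) (by simp)
      (by simp [Instr.run, State.set, Sym.index])
    obtain ⟨s₂, h4, h5⟩ := ih h3
    refine ⟨s₂, (Runs.while_pos (by rw [h.vars]; omega)
      (Runs.instr_seq (Runs.instr_seq h2)) h4).mono ?_, ?_⟩
    · rw [add_mul x 1]; omega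
    · rwa [List.append_assoc, List.singleton_append, ← List.replicate_succ] at h5

/-- Read a literal and print its gadget. -/
noncomputable def litProg : Prog :=
  .seq (.instr (.sub 10 10 4)) (.seq (.instr (.read 11)) (.seq (.instr (.const 2 0))
    (.seq mulLoop (.seq (.instr (.read 12))
      (.ifPos 12 (τ.gadgetProg (some true) 8) (τ.gadgetProg (some false) 8))))))

theorem runs_litProg {v : List Sym} {x y z i : ℕ} {t : Bool} {inp : List ℕ} {s : State}
    (h : τ.Ready v x y (z + 1) (i :: (if t then 1 else 0) :: inp) s) :
    ∃ s', Runs τ.litProg s (τ.gadgetTime + 3 * i + 6) s' ∧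
      τ.Ready (v ++ [Sym.lit i t]) x y z inp s' := by
  set s₁ := (Instr.const 2 0).run ((Instr.read 11).run ((Instr.sub 10 10 4).run s)) with hs₁
  have h1 : τ.Ready v x y z ((if t then 1 else 0) :: inp) s₁ := by
    constructor <;> simp [hs₁, Instr.run, State.set, h.prev, h.cur, h.step, h.one, h.vars,
      h.packing, h.weight_var, h.weight_lit, h.clauses, h.lits, h.zero, h.input, h.output]
  have h11 : s₁.reg 11 = i := by simp [hs₁, Instr.run, State.set, h.input]
  obtain ⟨s₂, h2, h3, h4, h5, h6⟩ := runs_mulLoop i s₁ h1.one h11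
  have h7 : s₂.reg 2 = i * τ.step := by
    rw [h5, h1.step]
    simp [hs₁, Instr.run, State.set]
  set s₃ := (Instr.read 12).run s₂ with hs₃
  have h8 : τ.Ready v x y z inp s₃ := by
    constructor <;> simp [hs₃, Instr.run, State.set, h6, h1.prev, h1.cur, h1.step, h1.one,
      h1.vars, h1.packing, h1.weight_var, h1.weight_lit, h1.clauses, h1.lits, h1.zero, h3, h4,
      h1.input, h1.output]
  obtain ⟨s₄, ⟨T, hT, h9⟩, h10⟩ := τ.runs_gadgetProg h8 (Sym.lit i t) (r := 8)
    (by rw [h8.weight_lit, Sym.weight, mul_comm]) (by simp)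
    (by simp [hs₃, Instr.run, State.set, Sym.index, h7])
  have h12 : s₃.reg 12 = if t then 1 else 0 := by
    simp [hs₃, Instr.run, State.set, h3, h1.input]
  have h13 : Runs (.ifPos 12 (τ.gadgetProg (some true) 8) (τ.gadgetProg (some false) 8)) s₃
      (τ.gadgetTime + 1) s₄ := by
    refine ⟨T + 1, by omega, ?_⟩
    cases t
    · exact .ifPos_zero (by simpa using h12) h9
    · exact .ifPos_pos (by simp [h12]) h9
  exact ⟨s₄, (Runs.instr_seq (Runs.instr_seq (Runs.instr_seq (h2.seq
    (Runs.instr_seq h13))))).mono (by omega), h10⟩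

theorem runs_litLoop {m : ℕ} (C : List (ℕ × Bool)) (hC : ∀ l ∈ C, l.1 ≤ m) {v : List Sym}
    {x y : ℕ} {inp : List ℕ} {s : State}
    (h : τ.Ready v x y C.length ((C.flatMap fun l => [l.1, if l.2 then 1 else 0]) ++ inp) s) :
    ∃ s', Runs (.whilePos 10 τ.litProg) s (C.length * (τ.gadgetTime + 3 * m + 7) + 1) s' ∧
      τ.Ready (v ++ C.map fun l => Sym.lit l.1 l.2) x y 0 inp s' := by
  induction C generalizing v s with
  | nil => exact ⟨s, (Runs.while_zero h.lits).mono (by omega), by simpa using h⟩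
  | cons l C ih =>
    obtain ⟨s₁, h1, h2⟩ := τ.runs_litProg (t := l.2) h
    obtain ⟨s₂, h3, h4⟩ := ih (fun l hl => hC l (List.mem_cons_of_mem _ hl)) h2
    refine ⟨s₂, (Runs.while_pos (by rw [h.lits]; simp) h1 h3).mono ?_, ?_⟩
    · have := hC l List.mem_cons_self
      rw [List.length_cons, add_mul _ 1]
      omega
    · simpa using h4

/-- Read a clause and print the gadgets of its symbols. -/
noncomputable def clauseProg : Prog :=
  .seq (.instr (.sub 9 9 4)) (.seq (.instr (.read 10)) (.seq (.instr (.const 2 0))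
    (.seq (τ.gadgetProg none 15) (.whilePos 10 τ.litProg))))

theorem runs_clauseLoop {m : ℕ} (cs : List (List (ℕ × Bool))) (hcs : ∀ C ∈ cs, ∀ l ∈ C, l.1 ≤ m)
    {v : List Sym} {x : ℕ} {inp : List ℕ} {s : State}
    (h : τ.Ready v x cs.length 0
      ((cs.flatMap fun C => C.length :: C.flatMap fun l => [l.1, if l.2 then 1 else 0]) ++ inp) s) :
    ∃ s', Runs (.whilePos 9 τ.clauseProg) s
      ((clauseSyms cs).length * (τ.gadgetTime + 3 * m + 7) + 1) s' ∧
      τ.Ready (v ++ clauseSyms cs) x 0 0 inp s' := by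
  induction cs generalizing v s with
  | nil => exact ⟨s, (Runs.while_zero h.clauses).mono (by omega), by simpa [clauseSyms] using h⟩
  | cons C cs ih =>
    set s₁ := (Instr.const 2 0).run ((Instr.read 10).run ((Instr.sub 9 9 4).run s)) with hs₁
    have h1 : τ.Ready v x cs.length C.length ((C.flatMap fun l => [l.1, if l.2 then 1 else 0]) ++
        ((cs.flatMap fun C => C.length :: C.flatMap fun l => [l.1, if l.2 then 1 else 0]) ++
          inp)) s₁ := by
      constructor <;> simp [hs₁, Instr.run, State.set, h.prev, h.cur, h.step, h.one, h.vars,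
        h.packing, h.weight_var, h.weight_lit, h.clauses, h.zero, h.input, h.output]
    obtain ⟨s₂, h2, h3⟩ := τ.runs_gadgetProg h1 Sym.start (r := 15)
      (by simp [Sym.weight, h1.zero]) (by simp) (by simp [hs₁, Instr.run, State.set, Sym.index])
    obtain ⟨s₃, h4, h5⟩ := τ.runs_litLoop C (hcs C List.mem_cons_self) h3
    obtain ⟨s₄, h6, h7⟩ := ih (fun C hC => hcs C (List.mem_cons_of_mem _ hC)) h5
    refine ⟨s₄, (Runs.while_pos (by rw [h.clauses]; simp) (Runs.instr_seq (Runs.instr_seq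
      (Runs.instr_seq (Runs.seq h2 h4)))) h6).mono ?_, ?_⟩
    · have : (clauseSyms (C :: cs)).length = 1 + C.length + (clauseSyms cs).length := by
        rw [clauseSyms_cons]; simp; omega
      rw [this, add_mul, add_mul 1]
      omega
    · rw [clauseSyms_cons]
      simpa using h7

/-- The program that prints the constructed graph and the size of the packing. The registers `0`,
`1` and `2` hold the numbers of the first vertices of the preceding gadget, the current gadget and
the gadget of the current variable; `3`, `4`, `7` and `8` hold constants, `5`, `9`, `10` and `11`
count the remaining iterations of the loops, `6` holds the size of the packing of the gadgets
printed so far, `12` holds the sign of a literal, `13` is used for printing, and `15` is never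
assigned, so it holds `0`. -/
noncomputable def program : Prog :=
  .seq (.instr (.const 3 τ.step)) (.seq (.instr (.const 4 1)) (.seq (.instr (.const 7 τ.N))
    (.seq (.instr (.const 8 (3 * τ.N))) (.seq (.instr (.read 5)) (.seq τ.varLoop
      (.seq (.instr (.read 9)) (.seq (.whilePos 9 τ.clauseProg)
        (.seq (.instr (.print 1)) (.instr (.print 6))))))))))

/-- The running time of the program. -/
noncomputable def timeBound : Polynomial ℕ :=
  Polynomial.X * (Polynomial.C (τ.gadgetTime + 7) + 3 * Polynomial.X) + 10

theorem encodeCNF_eq {k : ℕ} (Φ : CNF (Fin k)) : encodeCNF Φ = k :: (clauseList Φ).length ::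
    (clauseList Φ).flatMap fun C => C.length :: C.flatMap fun l => [l.1, if l.2 then 1 else 0] := by
  simp only [encodeCNF, clauseList, List.length_map, Array.length_toList, List.flatMap_map]
  rfl

theorem length_cnfWord_le {k : ℕ} (Φ : CNF (Fin k)) : (cnfWord Φ).length ≤ inputSize Φ := by
  have : ∀ cs : List (List (ℕ × Bool)), (clauseSyms cs).length ≤
      (cs.flatMap fun C => C.length ::
        C.flatMap fun l => [l.1, if l.2 then 1 else 0]).length := by
    intro cs
    induction cs with
    | nil => simp [clauseSyms]
    | cons C cs ih =>
      rw [clauseSyms_cons, List.flatMap_cons, List.length_append, List.length_append]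
      refine Nat.add_le_add ?_ ih
      simp only [List.length_cons, List.length_map, List.length_flatMap]
      simp
      omega
  have h := this (clauseList Φ)
  rw [inputSize, encodeCNF_eq, cnfWord, formulaWord, List.length_append, List.length_replicate]
  simp only [List.length_cons]
  omega

theorem outputs_program {k : ℕ} (Φ : CNF (Fin k)) :
    Outputs τ.program Φ (τ.timeBound.eval (inputSize Φ)) (τ.graph (cnfWord Φ))
      (τ.N * cost (cnfWord Φ)) := by
  set cs := clauseList Φ with hcs
  have hlt : ∀ C ∈ cs, ∀ l ∈ C, l.1 ≤ k := by
    intro C hC l hl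
    simp only [hcs, clauseList, List.mem_map] at hC
    obtain ⟨C', -, rfl⟩ := hC
    obtain ⟨l', -, rfl⟩ := List.mem_map.1 hl
    exact l'.1.2.le
  set s₁ := (Instr.read 5).run ((Instr.const 8 (3 * τ.N)).run ((Instr.const 7 τ.N).run
    ((Instr.const 4 1).run ((Instr.const 3 τ.step).run (State.init (encodeCNF Φ)))))) with hs₁
  have h1 : τ.Ready [] k 0 0 (cs.length ::
      cs.flatMap fun C => C.length :: C.flatMap fun l => [l.1, if l.2 then 1 else 0]) s₁ := by
    constructor <;> simp [hs₁, Instr.run, State.set, State.init, encodeCNF_eq, hcs, edges,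
      endNumbers]
  obtain ⟨s₂, h2, h3⟩ := τ.runs_varLoop k h1
  rw [List.nil_append] at h3
  have h4 : τ.Ready (List.replicate k Sym.var) 0 cs.length 0
      ((cs.flatMap fun C => C.length :: C.flatMap fun l => [l.1, if l.2 then 1 else 0]) ++ [])
      ((Instr.read 9).run s₂) := by
    constructor <;> simp [Instr.run, State.set, h3.prev, h3.cur, h3.step, h3.one, h3.vars,
        h3.packing, h3.weight_var, h3.weight_lit, h3.lits, h3.zero, h3.input, h3.output]
  obtain ⟨s₃, h5, h6⟩ := τ.runs_clauseLoop cs hlt h4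
  have h6 : τ.Ready (cnfWord Φ) 0 0 0 [] s₃ := h6
  have hrun : Runs τ.program (State.init (encodeCNF Φ)) (τ.timeBound.eval (inputSize Φ))
      ((Instr.print 6).run ((Instr.print 1).run s₃)) := by
    refine (Runs.instr_seq (Runs.instr_seq (Runs.instr_seq (Runs.instr_seq (Runs.instr_seq
      (h2.seq (Runs.instr_seq (h5.seq (Runs.instr_seq (Runs.instr _ _)))))))))).mono ?_
    have h7 : k + (clauseSyms cs).length ≤ inputSize Φ := by
      have := length_cnfWord_le Φ
      rwa [cnfWord, formulaWord, List.length_append, List.length_replicate] at this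
    have h8 : τ.timeBound.eval (inputSize Φ) =
        inputSize Φ * (τ.gadgetTime + 7 + 3 * inputSize Φ) + 10 := by
      simp [timeBound]
    have h9 : k * (τ.gadgetTime + 3) ≤ k * (τ.gadgetTime + 7 + 3 * inputSize Φ) :=
      Nat.mul_le_mul_left _ (by omega)
    have h10 : (clauseSyms cs).length * (τ.gadgetTime + 3 * k + 7) ≤
        (clauseSyms cs).length * (τ.gadgetTime + 7 + 3 * inputSize Φ) :=
      Nat.mul_le_mul_left _ (by omega)
    have h11 := Nat.mul_le_mul_right (τ.gadgetTime + 7 + 3 * inputSize Φ) h7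
    rw [add_mul] at h11
    rw [h8]
    omega
  obtain ⟨t, ht, h⟩ := hrun
  refine ⟨t, ht, _, h, ?_⟩
  have hout : ((Instr.print 6).run ((Instr.print 1).run s₃)).output =
      τ.endNumbers (τ.edges (cnfWord Φ)) ++
        [(cnfWord Φ).length * τ.step, τ.N * cost (cnfWord Φ)] := by
    simp [Instr.run, h6.output, h6.cur, h6.packing, cost_eq_sum]
  rw [hout]
  exact τ.describes_graph (wellFormed_cnfWord Φ) _

end Template

end Machine

/-! ### Properties of the constructed graph -/

section Reduction

namespace Template

variable {T : Type*} [Finite T] (τ : Template T)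

theorem vertex_val_injective (w : List Sym) :
    Function.Injective fun u : Fin (w.length * τ.step) => τ.vertex (u : ℕ) :=
  τ.vertex_injective.comp Fin.val_injective

theorem exists_modulator {k : ℕ} (Φ : CNF (Fin k)) :
    ∃ S : Set (Fin ((cnfWord Φ).length * τ.step)), S.ncard ≤ 2 * τ.N * k ∧
      treewidth (deleteVerts (τ.graph (cnfWord Φ)) S) ≤ treewidth τ.M := by
  classical
  refine ⟨_, ?_, τ.treewidth_le_of_modulator (wellFormed_cnfWord Φ) (τ.vertex_val_injective _)
    (fun u v h => h)⟩
  have h1 : τ.modulator (cnfWord Φ) ⊆ (fun e : ℕ × ℕ × Bool =>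
      ((e.1, e.2.1, 3, if e.2.2 then τ.y₀ else τ.y₁) : Vtx T)) ''
      ((Finset.range k ×ˢ Finset.range τ.N ×ˢ Finset.univ : Finset (ℕ × ℕ × Bool)) :
        Set (ℕ × ℕ × Bool)) := by
    rintro _ ⟨i, ν, a, rfl, hν, hi, ha⟩
    have hi := (formulaWord_var _).1 hi
    rcases ha with rfl | rfl
    · exact ⟨(i, ν, true), by simp [hi, hν], by simp⟩
    · exact ⟨(i, ν, false), by simp [hi, hν], by simp⟩
  have h2 := (Set.ncard_le_ncard h1 ((Finset.finite_toSet _).image _)).trans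
    (Set.ncard_image_le (Finset.finite_toSet _))
  rw [Set.ncard_coe_finset] at h2
  simp only [Finset.card_product, Finset.card_range, Finset.card_univ, Fintype.card_bool] at h2
  refine (Set.ncard_le_ncard_of_injOn (fun u : Fin _ => τ.vertex (u : ℕ)) (fun u hu => hu)
    ((τ.vertex_val_injective (cnfWord Φ)).injOn) (((Finset.finite_toSet _).image _).subset
      h1)).trans (h2.trans (le_of_eq ?_))
  ring

theorem IsHCopy.exists_fin {w : List Sym} (hw : WellFormed w) {ν : ℕ} (hν : ν < τ.N)
    {κ : T → Vtx T} (h : τ.IsHCopy w ν κ) :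
    ∃ f : T → Fin (w.length * τ.step), ∀ a, τ.vertex (f a) = κ a := by
  have hv : ∀ a, τ.Valid w (κ a) := fun a =>
    ⟨(h.valid τ hw a).1, Or.inl ⟨(h.valid τ hw a).2.1.trans_lt hν, (h.valid τ hw a).2.2⟩⟩
  exact ⟨fun a => ⟨_, τ.number_lt (hv a)⟩, fun a => τ.vertex_number (hv a)⟩

/-- `f` embeds `M[B]` into the constructed graph. -/
def IsEmbeddingOf (B : Set T) {U : Type*} (G : SimpleGraph U) (f : T → U) : Prop :=
  Function.Injective f ∧ ∀ a ∈ B, ∀ a' ∈ B, τ.M.Adj a a' → G.Adj (f a) (f a')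

theorem IsHCopy.isEmbeddingOf {w : List Sym} {ν : ℕ} (hν : ν < τ.N)
    {κ : T → Vtx T} (h : τ.IsHCopy w ν κ) {f : T → Fin (w.length * τ.step)}
    (hf : ∀ a, τ.vertex (f a) = κ a) : τ.IsEmbeddingOf τ.A (τ.graph w) f := by
  refine ⟨fun a a' haa' => h.injective τ ?_, fun a ha a' ha' haa' => ?_⟩
  · rw [← hf, ← hf, haa']
  · change τ.EdgeRel w _ _
    rw [hf, hf]
    exact h.edgeRel τ hν ha ha' haa'

theorem exists_packing_graph {w : List Sym} (hw : WellFormed w) :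
    ∃ f : Fin (τ.N * cost w) → T → Fin (w.length * τ.step),
      (∀ i, τ.IsEmbeddingOf τ.A (τ.graph w) (f i)) ∧ ∀ i j, i ≠ j → ∀ a a', f i a ≠ f j a' := by
  obtain ⟨κ, hκ, hdisj⟩ := τ.exists_packing hw
  choose ν hν hκ using hκ
  choose f hf using fun i => (hκ i).exists_fin τ hw (hν i)
  refine ⟨f, fun i => (hκ i).isEmbeddingOf τ (hν i) (hf i), fun i j hij a a' h => ?_⟩
  refine hdisj i j hij a a' ?_
  rw [← hf, ← hf, h]

/-- If the formula is not satisfiable, then a set of vertices that is not larger than the packing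
misses many disjoint copies of `H` and a further copy of `M[Y]`. -/
theorem exists_avoiding {k : ℕ} {Φ : CNF (Fin k)} (hΦ : ¬ Satisfiable Φ) {m : ℕ}
    (hN : 2 * m ≤ τ.N + 1) (hq : 3 * τ.N < τ.q)
    {X : Set (Fin ((cnfWord Φ).length * τ.step))} (hX : X.ncard ≤ τ.N * cost (cnfWord Φ)) :
    ∃ (f : Fin m → T → Fin ((cnfWord Φ).length * τ.step))
      (g : T → Fin ((cnfWord Φ).length * τ.step)),
      (∀ i, τ.IsEmbeddingOf τ.A (τ.graph (cnfWord Φ)) (f i)) ∧ (∀ i, ∀ a ∈ τ.A, f i a ∉ X) ∧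
      (∀ i j, i ≠ j → ∀ a ∈ τ.A, ∀ a' ∈ τ.A, f i a ≠ f j a') ∧
      τ.IsEmbeddingOf τ.Y (τ.graph (cnfWord Φ)) g ∧ (∀ a, g a ∉ X) ∧ ∀ i a a', f i a ≠ g a' := by
  have hw : WellFormed (cnfWord Φ) := wellFormed_cnfWord Φ
  have hunsat : ∀ α, ¬ WordSat (cnfWord Φ) α := fun α hα => hΦ ((satisfiable_iff Φ).2 ⟨α, hα⟩)
  revert X
  generalize cnfWord Φ = w at hw hunsat ⊢
  intro X hX
  have hlen : 0 < w.length := by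
    by_contra h
    exact hunsat (fun _ => true) fun b hb => absurd hb (by omega)
  set X' : Set (Vtx T) := (fun u : Fin (w.length * τ.step) => τ.vertex (u : ℕ)) '' X with hX'
  have hfin : X'.Finite := (Set.toFinite X).image _
  have hcard : X'.ncard ≤ τ.N * cost w := (Set.ncard_image_le (Set.toFinite X)).trans hX
  obtain ⟨κ, hκ, hκX, hdisj⟩ := τ.exists_disjoint_copies hw hunsat hfin hcard hN
  obtain ⟨b, hb, j, hj, hjX⟩ := τ.exists_extra_copy (w := w) hfin (by
    have h1 := Nat.mul_le_mul_left τ.N (cost_le w)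
    have h2 := Nat.mul_lt_mul_of_pos_left hq hlen
    have h3 : τ.N * (3 * w.length) = w.length * (3 * τ.N) := by ring
    omega)
  choose ν hν hκ using hκ
  choose f hf using fun i => (hκ i).exists_fin τ hw (hν i)
  have hval : ∀ a, τ.Valid w (b, τ.N, j, a) := fun a => ⟨hb, Or.inr ⟨rfl, hj⟩⟩
  let g : T → Fin (w.length * τ.step) := fun a => ⟨_, τ.number_lt (hval a)⟩
  have hg : ∀ a, τ.vertex (g a) = (b, τ.N, j, a) := fun a => τ.vertex_number (hval a)
  refine ⟨f, g, fun i => (hκ i).isEmbeddingOf τ (hν i) (hf i), fun i a ha h => ?_,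
    fun i j hij a ha a' ha' h => ?_, ⟨fun a a' h => ?_, fun a ha a' ha' haa' => ?_⟩,
    fun a h => ?_, fun i a a' h => ?_⟩
  · exact hκX i a ha (hf i a ▸ Set.mem_image_of_mem _ h)
  · refine hdisj i j hij a ha a' ha' ?_
    rw [← hf, ← hf, h]
  · have := (hg a).symm.trans ((congrArg (fun u : Fin _ => τ.vertex (u : ℕ)) h).trans (hg a'))
    simpa using this
  · change τ.EdgeRel w _ _
    rw [hg, hg]
    exact .extra hb hj ha ha' haa'
  · exact hjX a (hg a ▸ Set.mem_image_of_mem _ h)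
  · have h1 := ((hκ i).valid τ hw a).2.1
    rw [← hf, h, hg] at h1
    exact (hν i).ne h1.symm

/-- The sets of vertices of `M` that can carry the connected minors that survive the deletion for
a satisfying assignment. -/
def Small (Z : Set T) : Prop := (∃ z ∈ τ.A, Z ⊆ τ.A \ {z}) ∨ Z ⊆ τ.Y ∨ Z.Subsingleton

theorem exists_deletion {k : ℕ} {Φ : CNF (Fin k)} (hΦ : Satisfiable Φ) :
    ∃ X : Set (Fin ((cnfWord Φ).length * τ.step)), X.ncard ≤ τ.N * cost (cnfWord Φ) ∧
      treewidth (deleteVerts (τ.graph (cnfWord Φ)) X) ≤ treewidth τ.M ∧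
      (∀ C : (prune τ.L.ncard (deleteVerts (τ.graph (cnfWord Φ)) X)).coe.ConnectedComponent,
        ∃ Z, τ.Small Z ∧ IsMinor C.toSimpleGraph (τ.M.induce Z)) ∧
      ∀ {V : Type*} [Finite V] (K : SimpleGraph V), K.Connected → SetRobust τ.L.ncard K →
        IsMinor K (deleteVerts (τ.graph (cnfWord Φ)) X) →
        ∃ Z, τ.Small Z ∧ IsMinor K (τ.M.induce Z) := by
  obtain ⟨α, hα⟩ := (satisfiable_iff Φ).1 hΦ
  set w := cnfWord Φ with hwdef
  have hw : WellFormed w := wellFormed_cnfWord Φ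
  have hhits := τ.hits_deletion hw hα
  set X : Set (Fin (w.length * τ.step)) := (fun u => τ.vertex (u : ℕ)) ⁻¹' τ.deletion w α with hX
  set G := deleteVerts (τ.graph w) X with hG
  let dec : (Xᶜ : Set (Fin (w.length * τ.step))) → Vtx T := fun u => τ.vertex (u.1 : ℕ)
  have hdec : Function.Injective dec := (τ.vertex_val_injective w).comp Subtype.val_injective
  have hdX : ∀ u, dec u ∉ τ.deletion w α := fun u => u.2
  have hGE : ∀ u v, G.Adj u v → τ.EdgeRel w (dec u) (dec v) := fun u v h => h
  have hlt : ∀ u, (dec u).1 < w.length := fun u => τ.vertex_fst_lt u.1.2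
  have hpend := τ.isPendantLabelling hhits hdec hdX hGE
  refine ⟨X, ?_, τ.treewidth_le_of_hits (τ.vertex_val_injective w) (fun u v h => h) hhits,
    fun C => ?_, fun K hK hrob hmin => ?_⟩
  · exact (Set.ncard_le_ncard_of_injOn (fun u : Fin _ => τ.vertex (u : ℕ)) (fun u hu => hu)
      (τ.vertex_val_injective w).injOn (τ.deletion_finite w α)).trans (τ.ncard_deletion_le w α)
  · have hcore : IsMinor C.toSimpleGraph (G.induce {u | τ.piece (dec u) = none}) := by
      refine isMinor_of_injective_hom
        (fun c => ⟨c.1.1, hpend.prune_verts c.1.1 c.1.2⟩) (fun c c' h => ?_) fun c c' h => ?_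
      · exact Subtype.ext (Subtype.ext (Subtype.mk.inj h))
      · exact (prune τ.L.ncard G).adj_sub h
    obtain ⟨Z, h1, h2⟩ := τ.isMinor_of_isMinor_core C.connected_toSimpleGraph hhits hlt hdec hdX
      hGE hcore
    exact ⟨Z, h2, h1⟩
  · obtain ⟨Z, h1, h2⟩ := τ.isMinor_of_isMinor_core hK hhits hlt hdec hdX hGE
      (hpend.isMinor_core hrob hmin)
    exact ⟨Z, h2, h1⟩

end Template

/-- The part of the theorem about a single graph, with the graph itself as the template and one
copy of each gadget. -/
theorem exists_reduction_of_connected {V : Type*} [Finite V] (H : SimpleGraph V)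
    (hH : H.Connected) (h3 : 3 ≤ Nat.card V) :
    ∃ (alg : Prog) (time : Polynomial ℕ),
      ∀ (k : ℕ) (Φ : Std.Sat.CNF (Fin k)),
        ∃ (n : ℕ) (G : SimpleGraph (Fin n)) (ℓ : ℕ),
          Outputs alg Φ (time.eval (inputSize Φ)) G ℓ ∧
          (∃ S : Set (Fin n), S.ncard ≤ 2 * k ∧ treewidth (deleteVerts G S) ≤ treewidth H) ∧
          HasPacking H G ℓ ∧
          (¬ Satisfiable Φ →
            ¬ ∃ X : Set (Fin n), X.ncard ≤ ℓ ∧ H.Free (deleteVerts G X)) ∧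
          (Satisfiable Φ →
            ∃ X : Set (Fin n), X.ncard ≤ ℓ ∧ ¬ IsMinor H (deleteVerts G X) ∧
              IsComponentwiseMinor (prune (slb H) (deleteVerts G X)).coe H ∧
              treewidth (deleteVerts G X) ≤ treewidth H) := by
  obtain ⟨L, c, x, hc, hx, hxc, hL, hsep, hrob⟩ := exists_smallest_leafBlock hH (by omega)
  have : Fintype V := Fintype.ofFinite V
  obtain ⟨y₀, y₁, y₂, h01, h02, h12⟩ := Fintype.two_lt_card_iff.1
    (by rw [← Nat.card_eq_fintype_card]; omega : 2 < Fintype.card V)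
  let τ : Template V :=
    { M := H, A := Set.univ, Y := ∅, L := L, c := c, x := x, y₀ := y₀, y₁ := y₁, y₂ := y₂
      N := 1, q := 4, L_sub := Set.subset_univ _, c_mem := hc, x_mem := hx, x_ne := hxc
      y₀_mem := trivial, y₁_mem := trivial, y₂_mem := trivial, y₀₁ := h01, y₀₂ := h02
      y₁₂ := h12, sep := fun a ha hac b _ hab => hsep a ha hac b hab }
  have hrobust : SetRobust τ.L.ncard H := by
    change SetRobust L.ncard H
    refine ⟨Set.ncard_le_card L, fun v D hD => hL ▸ hrob v D hD⟩
  have hsmall : ∀ Z, τ.Small Z → ∃ z, Z ⊆ {z}ᶜ := by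
    rintro Z (⟨z, -, hz⟩ | hZ | hZ)
    · exact ⟨z, fun a ha => (hz ha).2⟩
    · exact ⟨c, fun a ha => absurd (hZ ha) (Set.notMem_empty a)⟩
    · rcases hZ.eq_empty_or_singleton with rfl | ⟨z, rfl⟩
      · exact ⟨c, Set.empty_subset _⟩
      · by_cases hz : z = c
        · exact ⟨x, by simpa [hz] using hxc⟩
        · exact ⟨c, by simpa using Ne.symm hz⟩
  refine ⟨τ.program, τ.timeBound, fun k Φ => ⟨_, τ.graph (cnfWord Φ), _, τ.outputs_program Φ,
    ?_, ?_, fun hΦ => ?_, fun hΦ => ?_⟩⟩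
  · exact τ.exists_modulator Φ
  · obtain ⟨f, hf, hdisj⟩ := τ.exists_packing_graph (wellFormed_cnfWord Φ)
    refine ⟨fun i => ⟨⟨f i, fun h => (hf i).2 _ trivial _ trivial h⟩, (hf i).1⟩,
      fun i j hij => ?_⟩
    rw [Set.disjoint_left]
    rintro _ ⟨a, rfl⟩ ⟨a', h⟩
    exact hdisj i j hij a a' h.symm
  · rintro ⟨X, hX, hfree⟩
    obtain ⟨f, -, hf, hfX, -⟩ := τ.exists_avoiding hΦ (m := 1) le_rfl (by simp [τ]) hX
    exact hfree ⟨⟨⟨fun a => ⟨f 0 a, hfX 0 a trivial⟩, fun h => (hf 0).2 _ trivial _ trivial h⟩,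
      fun a a' h => (hf 0).1 (congrArg Subtype.val h)⟩⟩
  · obtain ⟨X, hX, htw, hprune, hmin⟩ := τ.exists_deletion hΦ
    rw [show τ.L.ncard = slb H from hL] at hprune
    refine ⟨X, hX, fun h => ?_, fun C => ?_, htw⟩
    · obtain ⟨Z, hZ, hm⟩ := hmin H hH hrobust h
      obtain ⟨z, hz⟩ := hsmall Z hZ
      have h1 := hm.card_le
      have h2 : Z.ncard ≤ ({z}ᶜ : Set V).ncard := Set.ncard_le_ncard hz
      rw [Nat.card_coe_set_eq] at h1
      have h4 := Set.ncard_add_ncard_compl ({z} : Set V)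
      rw [Set.ncard_singleton] at h4
      omega
    · obtain ⟨Z, -, hm⟩ := hprune C
      exact hm.trans (isMinor_induce Z)

end Reduction

/-! ### Component-wise minors -/

section Components

variable {V : Type*} {W : Type*} {U : Type*}

theorem IsComponentwiseMinor.isMinor_of_connected {K : SimpleGraph U} {G : SimpleGraph V}
    {G' : SimpleGraph W} (hK : K.Connected) (h : IsMinor K G) (h' : IsComponentwiseMinor G G') :
    IsMinor K G' := by
  obtain ⟨C, hC⟩ := h.exists_connectedComponent hK
  exact hC.trans (h' C)

theorem isMinor_of_component (G : SimpleGraph V) (C : G.ConnectedComponent) :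
    IsMinor C.toSimpleGraph G := isMinor_induce _

theorem IsComponentwiseMinor.trans {G : SimpleGraph V} {G' : SimpleGraph W} {G'' : SimpleGraph U}
    (h : IsComponentwiseMinor G G') (h' : IsComponentwiseMinor G' G'') :
    IsComponentwiseMinor G G'' :=
  fun C => h'.isMinor_of_connected C.connected_toSimpleGraph (h C)

/-- The connected minors of a graph, up to isomorphism. -/
def connectedMinors (G : SimpleGraph V) : Set (Σ n, SimpleGraph (Fin n)) :=
  {K | K.2.Connected ∧ IsMinor K.2 G}

theorem connectedMinors_finite [Finite V] (G : SimpleGraph V) : (connectedMinors G).Finite := by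
  refine ((Set.finite_Iic (Nat.card V)).biUnion
    (t := fun n => Set.range fun K : SimpleGraph (Fin n) => (⟨n, K⟩ : Σ n, SimpleGraph (Fin n)))
    fun n _ => Set.finite_range _).subset ?_
  rintro ⟨n, K⟩ ⟨-, hK⟩
  have := hK.card_le
  rw [Nat.card_fin] at this
  exact Set.mem_biUnion this ⟨K, rfl⟩

theorem connectedMinors_subset_iff [Finite V] {G : SimpleGraph V} {G' : SimpleGraph W} :
    connectedMinors G ⊆ connectedMinors G' ↔ IsComponentwiseMinor G G' := by
  constructor
  · intro h C
    let e := Finite.equivFin C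
    let φ : C.toSimpleGraph ≃g C.toSimpleGraph.map e.toEmbedding :=
      SimpleGraph.Iso.map e C.toSimpleGraph
    have h1 : IsMinor C.toSimpleGraph (C.toSimpleGraph.map e.toEmbedding) :=
      isMinor_of_injective_hom φ φ.injective fun _ _ h => φ.map_adj_iff.2 h
    have h2 : IsMinor (C.toSimpleGraph.map e.toEmbedding) C.toSimpleGraph :=
      isMinor_of_injective_hom φ.symm φ.symm.injective fun _ _ h => φ.symm.map_adj_iff.2 h
    have h3 : (⟨_, C.toSimpleGraph.map e.toEmbedding⟩ : Σ n, SimpleGraph (Fin n)) ∈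
        connectedMinors G :=
      ⟨φ.connected_iff.1 C.connected_toSimpleGraph, h2.trans (isMinor_of_component G C)⟩
    exact h1.trans (h h3).2
  · rintro h K ⟨h1, h2⟩
    exact ⟨h1, h.isMinor_of_connected h1 h2⟩

/-- Each set of finite graphs has a component-wise minimal element below any given one. -/
theorem exists_isComponentwiseMinor_minimal {ι : Type*} {V : ι → Type*} [∀ i, Finite (V i)]
    (F : ∀ i, SimpleGraph (V i)) (I : Set ι) {j : ι} (hj : j ∈ I) :
    ∃ i ∈ I, IsComponentwiseMinor (F i) (F j) ∧
      ∀ k ∈ I, IsComponentwiseMinor (F k) (F i) → IsComponentwiseMinor (F i) (F k) := by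
  obtain ⟨i, ⟨hi, hij⟩, hmin⟩ := (measure fun i => (connectedMinors (F i)).ncard).wf.has_min
    {i | i ∈ I ∧ IsComponentwiseMinor (F i) (F j)} ⟨j, hj, isMinor_of_component _⟩
  refine ⟨i, hi, hij, fun k hk hki => ?_⟩
  have h1 := hmin k ⟨hk, hki.trans hij⟩
  have h2 : (connectedMinors (F i)).ncard ≤ (connectedMinors (F k)).ncard := not_lt.1 h1
  rw [← connectedMinors_subset_iff] at hki ⊢
  exact (Set.eq_of_subset_of_ncard_le hki h2 (connectedMinors_finite _)).ge

/-- A connected component that is maximal for the minor order. -/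
def IsMaxComponent (G : SimpleGraph V) (C : G.ConnectedComponent) : Prop :=
  ∀ D : G.ConnectedComponent, IsMinor C.toSimpleGraph D.toSimpleGraph →
    IsMinor D.toSimpleGraph C.toSimpleGraph

theorem exists_isMaxComponent [Finite V] (G : SimpleGraph V) (C : G.ConnectedComponent) :
    ∃ D, IsMinor C.toSimpleGraph D.toSimpleGraph ∧ IsMaxComponent G D := by
  let _ : Preorder G.ConnectedComponent :=
    { le := fun C D => IsMinor C.toSimpleGraph D.toSimpleGraph
      le_refl := fun _ => IsMinor.refl _
      le_trans := fun _ _ _ h h' => h.trans h' }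
  obtain ⟨D, hCD, hD⟩ := Finite.exists_le_maximal (p := fun _ : G.ConnectedComponent => True)
    (a := C) trivial
  exact ⟨D, hCD, fun E hE => hD.2 trivial hE⟩

theorem natCard_component (G : SimpleGraph V) (C : G.ConnectedComponent) :
    Nat.card C = C.supp.ncard := Nat.card_coe_set_eq _

/-- A graph on at most two vertices is a minor of every connected graph with an edge. -/
theorem isMinor_of_card_le_two [Finite V] [Finite W] {G : SimpleGraph V} {K : SimpleGraph W}
    (hV : Nat.card V ≤ 2) (hK : K.Connected) (hW : 2 ≤ Nat.card W) : IsMinor G K := by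
  have : Nontrivial W := (Finite.one_lt_card_iff_nontrivial).1 hW
  obtain ⟨u⟩ := hK.nonempty
  obtain ⟨v, huv⟩ := hK.preconnected.exists_adj_of_nontrivial u
  let e : V → Fin 2 := fun a => Fin.castLE hV (Finite.equivFin V a)
  have he : Function.Injective e :=
    (Fin.castLE_injective hV).comp (Finite.equivFin V).injective
  have hf : Function.Injective ![u, v] := by
    intro a b h
    fin_cases a <;> fin_cases b <;> simp_all [huv.ne, huv.ne']
  refine isMinor_of_injective_hom (![u, v] ∘ e) (hf.comp he) fun a b hab => ?_
  have hne : e a ≠ e b := fun h => hab.ne (he h)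
  simp only [Function.comp]
  generalize e a = a' at hne
  generalize e b = b' at hne
  fin_cases a' <;> fin_cases b' <;> simp_all [huv.symm]

/-- A component with at most two vertices is not maximal next to one with at least three. -/
theorem IsMaxComponent.three_le [Finite V] {G : SimpleGraph V} {C : G.ConnectedComponent}
    (hC : IsMaxComponent G C) (h : ∃ D : G.ConnectedComponent, 3 ≤ D.supp.ncard) :
    3 ≤ Nat.card C := by
  obtain ⟨D, hD⟩ := h
  rw [← natCard_component] at hD
  by_contra hlt
  have h1 := (hC D (isMinor_of_card_le_two (by omega) D.connected_toSimpleGraph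
    (by omega))).card_le
  omega

end Components

/-! ### Families of graphs -/

section Family

/-- The template in which `H` is a connected component of `M` with at least three vertices and
`M[Y]` consists of the components of which `H` is not a minor. If `m` is the number of the other
components, `2 m - 1` copies of the gadgets suffice to retain `m` disjoint copies of `H`, and
`3 N + 1` copies of `M[Y]` per symbol are more than a set of the size of the packing can meet. -/
theorem exists_template {V : Type*} [Finite V] (M : SimpleGraph V) (C : M.ConnectedComponent)
    (h3 : 3 ≤ Nat.card C) (m : ℕ) :
    ∃ τ : Template V, τ.M = M ∧ τ.A = C.supp ∧
      τ.Y = {v | ¬ IsMinor C.toSimpleGraph (M.connectedComponentMk v).toSimpleGraph} ∧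
      τ.L.ncard = slb C.toSimpleGraph ∧ τ.N = 2 * m - 1 ∧ τ.q = 3 * τ.N + 1 := by
  obtain ⟨L, c, x, hc, hx, hxc, hL, hsep, -⟩ :=
    exists_smallest_leafBlock C.connected_toSimpleGraph (by omega)
  have : Fintype C := Fintype.ofFinite C
  obtain ⟨y₀, y₁, y₂, h01, h02, h12⟩ := Fintype.two_lt_card_iff.1
    (by rw [← Nat.card_eq_fintype_card]; omega : 2 < Fintype.card C)
  refine ⟨{ M := M, A := C.supp,
            Y := {v | ¬ IsMinor C.toSimpleGraph (M.connectedComponentMk v).toSimpleGraph},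
            L := Subtype.val '' L, c := c, x := x, y₀ := y₀, y₁ := y₁, y₂ := y₂
            N := 2 * m - 1, q := 3 * (2 * m - 1) + 1, L_sub := ?_
            c_mem := ⟨c, hc, rfl⟩, x_mem := ⟨x, hx, rfl⟩, x_ne := Subtype.coe_ne_coe.2 hxc
            y₀_mem := y₀.2, y₁_mem := y₁.2, y₂_mem := y₂.2, y₀₁ := Subtype.coe_ne_coe.2 h01
            y₀₂ := Subtype.coe_ne_coe.2 h02, y₁₂ := Subtype.coe_ne_coe.2 h12, sep := ?_ },
    rfl, rfl, rfl, ?_, rfl, rfl⟩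
  · rintro _ ⟨a, -, rfl⟩
    exact a.2
  · rintro _ ⟨a, ha, rfl⟩ hac b hb hab
    exact ⟨⟨b, hb⟩, hsep a ha (fun h => hac (congrArg Subtype.val h)) ⟨b, hb⟩ hab, rfl⟩
  · rw [← hL]
    exact Set.ncard_image_of_injective L Subtype.val_injective

/-- If `H` is a maximal component of `M`, the components of `M` that have `H` as a minor are
subgraphs of `H`. Hence disjoint copies of `H`, one for each of them, and a copy of `M[Y]` form a
copy of `M`. -/
theorem nonempty_copy {V U : Type*} [Finite V] {M : SimpleGraph V} {C : M.ConnectedComponent}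
    (hmax : IsMaxComponent M C) {τ : Template V} (hM : τ.M = M) (hA : τ.A = C.supp)
    (hY : τ.Y = {v | ¬ IsMinor C.toSimpleGraph (M.connectedComponentMk v).toSimpleGraph})
    {G : SimpleGraph U} {X : Set U}
    (f : {D : M.ConnectedComponent // IsMinor C.toSimpleGraph D.toSimpleGraph} → V → U) (g : V → U)
    (hf : ∀ i, τ.IsEmbeddingOf τ.A G (f i)) (hfX : ∀ i, ∀ a ∈ τ.A, f i a ∉ X)
    (hff : ∀ i j, i ≠ j → ∀ a ∈ τ.A, ∀ a' ∈ τ.A, f i a ≠ f j a')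
    (hg : τ.IsEmbeddingOf τ.Y G g) (hgX : ∀ a, g a ∉ X) (hfg : ∀ i a a', f i a ≠ g a') :
    M.IsContained (deleteVerts G X) := by
  classical
  subst hM
  have hcopy : ∀ D : {D : τ.M.ConnectedComponent // IsMinor C.toSimpleGraph D.toSimpleGraph},
      ∃ h : D.1 → C, Function.Injective h ∧
        ∀ u v, D.1.toSimpleGraph.Adj u v → C.toSimpleGraph.Adj (h u) (h v) :=
    fun D => (hmax D.1 D.2).exists_copy_of_card_le D.2.card_le
  choose h hinj hadj using hcopy
  let F : V → U := fun v =>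
    if hv : IsMinor C.toSimpleGraph (τ.M.connectedComponentMk v).toSimpleGraph
    then f ⟨_, hv⟩ (h ⟨_, hv⟩ ⟨v, rfl⟩) else g v
  have hF1 : ∀ D (v : D.1), F v.1 = f D (h D v) := by
    rintro ⟨D, hD⟩ ⟨v, hv⟩
    obtain rfl : τ.M.connectedComponentMk v = D := hv
    simp only [F, dif_pos hD]
  have hF2 : ∀ v, ¬ IsMinor C.toSimpleGraph (τ.M.connectedComponentMk v).toSimpleGraph →
      F v = g v := fun v hv => dif_neg hv
  have hcases : ∀ v, (∃ D : {D : τ.M.ConnectedComponent //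
      IsMinor C.toSimpleGraph D.toSimpleGraph}, ∃ d : D.1, d.1 = v) ∨
      ¬ IsMinor C.toSimpleGraph (τ.M.connectedComponentMk v).toSimpleGraph := by
    intro v
    by_cases hv : IsMinor C.toSimpleGraph (τ.M.connectedComponentMk v).toSimpleGraph
    · exact Or.inl ⟨⟨_, hv⟩, ⟨v, rfl⟩, rfl⟩
    · exact Or.inr hv
  have hhA : ∀ D d, (h D d : V) ∈ τ.A := fun D d => hA ▸ (h D d).2
  have hFX : ∀ v, F v ∉ X := by
    intro v
    rcases hcases v with ⟨D, d, rfl⟩ | hv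
    · rw [hF1]; exact hfX _ _ (hhA _ _)
    · rw [hF2 v hv]; exact hgX v
  have hFinj : Function.Injective F := by
    intro u v huv
    rcases hcases u with ⟨D, d, rfl⟩ | hu <;> rcases hcases v with ⟨D', d', rfl⟩ | hv
    · rw [hF1, hF1] at huv
      by_cases hDD : D = D'
      · subst hDD
        exact congrArg Subtype.val (hinj D (Subtype.ext ((hf D).1 huv)))
      · exact absurd huv (hff D D' hDD _ (hhA _ _) _ (hhA _ _))
    · rw [hF1, hF2 v hv] at huv
      exact absurd huv (hfg _ _ _)
    · rw [hF1, hF2 u hu] at huv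
      exact absurd huv.symm (hfg _ _ _)
    · rw [hF2 u hu, hF2 v hv] at huv
      exact hg.1 huv
  have hFadj : ∀ u v, τ.M.Adj u v → G.Adj (F u) (F v) := by
    intro u v huv
    have hcomp : τ.M.connectedComponentMk v = τ.M.connectedComponentMk u :=
      (SimpleGraph.ConnectedComponent.connectedComponentMk_eq_of_adj huv).symm
    rcases hcases u with ⟨D, d, rfl⟩ | hu
    · have hv : τ.M.connectedComponentMk v = D.1 := hcomp.trans d.2
      have h1 := hF1 D ⟨v, hv⟩
      simp only at h1
      rw [hF1, h1]
      exact (hf D).2 _ (hhA _ _) _ (hhA _ _) (hadj D d ⟨v, hv⟩ huv)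
    · have hv : ¬ IsMinor C.toSimpleGraph (τ.M.connectedComponentMk v).toSimpleGraph := by
        rwa [hcomp]
      rw [hF2 u hu, hF2 v hv]
      exact hg.2 u (by rw [hY]; exact hu) v (by rw [hY]; exact hv) huv
  exact ⟨⟨⟨fun v => ⟨F v, hFX v⟩, fun {u v} huv => hFadj u v huv⟩,
    fun u v huv => hFinj (congrArg Subtype.val huv)⟩⟩

/-- `H` is not a minor of what survives of `M`. -/
theorem not_isMinor_of_small {V : Type*} [Finite V] {M : SimpleGraph V}
    {C : M.ConnectedComponent} (h3 : 3 ≤ Nat.card C) {τ : Template V}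
    (hA : τ.A = C.supp)
    (hY : τ.Y = {v | ¬ IsMinor C.toSimpleGraph (M.connectedComponentMk v).toSimpleGraph})
    {Z : Set V} (hZ : τ.Small Z) : ¬ IsMinor C.toSimpleGraph (M.induce Z) := by
  intro h
  rcases hZ with ⟨z, hz, hZ⟩ | hZ | hZ
  · have h1 := h.card_le
    rw [natCard_component, Nat.card_coe_set_eq, ← hA] at h1
    have h2 := Set.ncard_le_ncard hZ (Set.toFinite _)
    have h4 := Set.ncard_sdiff_singleton_lt_of_mem hz (Set.toFinite _)
    omega
  · obtain ⟨D, hD⟩ := h.exists_connectedComponent C.connected_toSimpleGraph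
    obtain ⟨d, hd⟩ := D.nonempty_supp
    have hdY := hZ d.2
    rw [hY] at hdY
    refine hdY (hD.trans ?_)
    have hmem : ∀ e : D, M.connectedComponentMk e.1.1 = M.connectedComponentMk d.1 := by
      intro e
      have h1 : (M.induce Z).Reachable e.1 d :=
        SimpleGraph.ConnectedComponent.eq.1 (e.2.trans (Eq.symm hd))
      exact SimpleGraph.ConnectedComponent.eq.2
        (h1.map (SimpleGraph.Embedding.induce Z).toHom)
    exact isMinor_of_injective_hom (fun e => ⟨e.1.1, hmem e⟩)
      (fun e e' hee => Subtype.ext (Subtype.ext (Subtype.mk.inj hee))) fun _ _ h => h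
  · have h1 := h.card_le
    have h2 : Nat.card Z ≤ 1 := by
      rw [Nat.card_coe_set_eq, Set.ncard_le_one (Set.toFinite _)]
      exact hZ
    omega

/-- A connected graph is robust up to the size of its smallest leaf-block. -/
theorem setRobust_of_le_slb {V : Type*} [Finite V] {K : SimpleGraph V} (hK : K.Connected)
    (h2 : 2 ≤ Nat.card V) {s : ℕ} (hs : s ≤ slb K) : SetRobust s K := by
  obtain ⟨L, c, x, -, -, -, hL, -, hrob⟩ := exists_smallest_leafBlock hK h2
  refine ⟨hs.trans (hL ▸ Set.ncard_le_card L), fun v D hD => hs.trans (hrob v D hD)⟩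

/-- The part of the theorem about families. Among the graphs of minimum treewidth that are minimal
for the component-wise minor order, and their maximal components `H`, the graph `M` and `H` are
chosen such that `H` has the smallest leaf-block. -/
theorem exists_reduction_of_family {ι : Type*} [Nonempty ι] {V : ι → Type*} [∀ i, Finite (V i)]
    (F : ∀ i, SimpleGraph (V i)) (h3 : ∀ i, ∃ C : (F i).ConnectedComponent, 3 ≤ C.supp.ncard) :
    ∃ (alg : Prog) (time modulator : Polynomial ℕ),
      ∀ (k : ℕ) (Φ : Std.Sat.CNF (Fin k)),
        ∃ (n : ℕ) (G : SimpleGraph (Fin n)) (ℓ : ℕ),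
          Outputs alg Φ (time.eval (inputSize Φ)) G ℓ ∧
          (∃ S : Set (Fin n), S.ncard ≤ modulator.eval k ∧
            treewidth (deleteVerts G S) ≤ minTreewidth F) ∧
          (¬ Satisfiable Φ →
            ¬ ∃ X : Set (Fin n), X.ncard ≤ ℓ ∧ ∀ i, (F i).Free (deleteVerts G X)) ∧
          (Satisfiable Φ →
            ∃ X : Set (Fin n), X.ncard ≤ ℓ ∧ ∀ i, ¬ IsMinor (F i) (deleteVerts G X)) := by
  have hmin : ∀ j, minTreewidth F ≤ treewidth (F j) := fun j => ciInf_le (OrderBot.bddBelow _) j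
  set I₀ : Set ι := {i | treewidth (F i) = minTreewidth F} with hI₀
  set I₁ : Set ι := {i | i ∈ I₀ ∧ ∀ k ∈ I₀, IsComponentwiseMinor (F k) (F i) →
    IsComponentwiseMinor (F i) (F k)} with hI₁
  have hI₁ex : ∀ j ∈ I₀, ∃ i ∈ I₁, IsComponentwiseMinor (F i) (F j) := by
    intro j hj
    obtain ⟨i, hi, hij, h⟩ := exists_isComponentwiseMinor_minimal F I₀ hj
    exact ⟨i, ⟨hi, h⟩, hij⟩
  obtain ⟨j₀, hj₀⟩ : ∃ j, j ∈ I₀ := ciInf_mem fun i => treewidth (F i)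
  obtain ⟨i₀, hi₀, -⟩ := hI₁ex j₀ hj₀
  obtain ⟨C₀, -⟩ := h3 i₀
  obtain ⟨D₀, -, hD₀⟩ := exists_isMaxComponent (F i₀) C₀
  obtain ⟨⟨i, C⟩, ⟨hi, hC⟩, hslb⟩ :=
    (measure fun p : Σ i, (F i).ConnectedComponent => slb p.2.toSimpleGraph).wf.has_min
      {p | p.1 ∈ I₁ ∧ IsMaxComponent (F p.1) p.2} ⟨⟨i₀, D₀⟩, hi₀, hD₀⟩
  simp only at hi hC
  have hslb : ∀ j ∈ I₁, ∀ K : (F j).ConnectedComponent, IsMaxComponent (F j) K →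
      slb C.toSimpleGraph ≤ slb K.toSimpleGraph :=
    fun j hj K hK => not_lt.1 (hslb ⟨j, K⟩ ⟨hj, hK⟩)
  have hC3 := hC.three_le (h3 i)
  set m := Nat.card {D : (F i).ConnectedComponent // IsMinor C.toSimpleGraph D.toSimpleGraph}
    with hm
  obtain ⟨τ, hM, hA, hY, hL, hN, hq⟩ := exists_template (F i) C hC3 m
  have htw : treewidth τ.M = minTreewidth F := by rw [hM]; exact hi.1
  refine ⟨τ.program, τ.timeBound, Polynomial.C (2 * τ.N) * Polynomial.X, fun k Φ =>
    ⟨_, τ.graph (cnfWord Φ), _, τ.outputs_program Φ, ?_, fun hΦ => ?_, fun hΦ => ?_⟩⟩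
  · obtain ⟨S, hS, h⟩ := τ.exists_modulator Φ
    exact ⟨S, by simpa using hS, h.trans htw.le⟩
  · rintro ⟨X, hX, hfree⟩
    obtain ⟨f, g, hf, hfX, hff, hg, hgX, hfg⟩ := τ.exists_avoiding hΦ (m := m) (by omega)
      (by omega) hX
    let e := Finite.equivFin
      {D : (F i).ConnectedComponent // IsMinor C.toSimpleGraph D.toSimpleGraph}
    exact hfree i (nonempty_copy hC hM hA hY (fun D => f (e D)) g (fun D => hf _)
      (fun D => hfX _) (fun D D' hD => hff _ _ (e.injective.ne hD)) hg hgX fun D => hfg _)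
  · obtain ⟨X, hX, hXtw, -, hXmin⟩ := τ.exists_deletion hΦ
    refine ⟨X, hX, fun j hj => ?_⟩
    rw [hL, hM] at hXmin
    have hj₀ : j ∈ I₀ := le_antisymm (hj.treewidth_le.trans (hXtw.trans htw.le)) (hmin j)
    obtain ⟨j', hj', hjj'⟩ := hI₁ex j hj₀
    -- maximal components of `F j'` survive in `M`, as `slb H` is smallest
    have hmax : ∀ K : (F j').ConnectedComponent, IsMaxComponent (F j') K →
        ∃ Z, τ.Small Z ∧ IsMinor K.toSimpleGraph ((F i).induce Z) := fun K hK =>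
      hXmin K.toSimpleGraph K.connected_toSimpleGraph
        (setRobust_of_le_slb K.connected_toSimpleGraph
          (by have := hK.three_le (h3 j'); omega) (hslb j' hj' K hK)) ((hjj' K).trans hj)
    have hle : IsComponentwiseMinor (F j') (F i) := by
      intro K
      obtain ⟨K', hKK', hK'⟩ := exists_isMaxComponent (F j') K
      obtain ⟨Z, -, hZ⟩ := hmax K' hK'
      exact hKK'.trans (hZ.trans (isMinor_induce Z))
    have hge := hi.2 j' hj'.1 hle
    obtain ⟨K, hK⟩ := (hge C).exists_connectedComponent C.connected_toSimpleGraph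
    obtain ⟨K', hKK', hK'⟩ := exists_isMaxComponent (F j') K
    obtain ⟨Z, hZs, hZ⟩ := hmax K' hK'
    exact not_isMinor_of_small hC3 hA hY hZs (hK.trans (hKK'.trans hZ))

end Family

end MinorDeletion

theorem mainTheorem5 :
    -- one connected graph
    (∀ {V : Type*} [Finite V] (H : SimpleGraph V), H.Connected → 3 ≤ Nat.card V →
      ∃ (alg : Prog) (time : Polynomial ℕ),
        ∀ (k : ℕ) (Φ : Std.Sat.CNF (Fin k)),
          ∃ (n : ℕ) (G : SimpleGraph (Fin n)) (ℓ : ℕ),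
            Outputs alg Φ (time.eval (inputSize Φ)) G ℓ ∧
            (∃ S : Set (Fin n), S.ncard ≤ 2 * k ∧ treewidth (deleteVerts G S) ≤ treewidth H) ∧
            HasPacking H G ℓ ∧
            (¬ Satisfiable Φ →
              ¬ ∃ X : Set (Fin n), X.ncard ≤ ℓ ∧ H.Free (deleteVerts G X)) ∧
            (Satisfiable Φ →
              ∃ X : Set (Fin n), X.ncard ≤ ℓ ∧ ¬ IsMinor H (deleteVerts G X) ∧
                IsComponentwiseMinor (prune (slb H) (deleteVerts G X)).coe H ∧
                treewidth (deleteVerts G X) ≤ treewidth H)) ∧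
    -- a family of graphs
    (∀ {ι : Type*} [Nonempty ι] {V : ι → Type*} [∀ i, Finite (V i)]
        (F : ∀ i, SimpleGraph (V i)),
      (∀ i, ∃ C : (F i).ConnectedComponent, 3 ≤ C.supp.ncard) →
      ∃ (alg : Prog) (time modulator : Polynomial ℕ),
        ∀ (k : ℕ) (Φ : Std.Sat.CNF (Fin k)),
          ∃ (n : ℕ) (G : SimpleGraph (Fin n)) (ℓ : ℕ),
            Outputs alg Φ (time.eval (inputSize Φ)) G ℓ ∧
            (∃ S : Set (Fin n), S.ncard ≤ modulator.eval k ∧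
              treewidth (deleteVerts G S) ≤ minTreewidth F) ∧
            (¬ Satisfiable Φ →
              ¬ ∃ X : Set (Fin n), X.ncard ≤ ℓ ∧ ∀ i, (F i).Free (deleteVerts G X)) ∧
            (Satisfiable Φ →
              ∃ X : Set (Fin n), X.ncard ≤ ℓ ∧ ∀ i, ¬ IsMinor (F i) (deleteVerts G X))) := by
  exact ⟨fun H hH h3 => exists_reduction_of_connected H hH h3,
    fun F hF => exists_reduction_of_family F hF⟩
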